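/- **Setting.** Let $F\in C^3(\mathbb R)$ satisfy $F(\pm1)=F'(\pm1)=0$, $F''(\pm1)>0$ and $F(u)>0$ for $u\ne\pm1$; let $g\in C^1(\mathbb R)$, let $N\ge1$ be an integer, and let $\chi:\mathbb R\to[0,1]$ be a $C^\infty$ function with $\chi=0$ on $(-\infty,-1]$ and $\chi=1$ on $[1,\infty)$. Put $A:=\min\{\sqrt{F''(1)},\sqrt{F''(-1)}\}$, $$C_{F,g}:=\int_{-1}^1\sqrt{2F(s)}\,g(s)\,ds,\qquad D_\infty:=\int_{-1}^1\sqrt{2F(s)}\,ds .$$ For $L>0$ and a sign $\sigma=\pm1$ let $\varphi(\cdot,L,\sigma)$ be the solution on $\mathbb R$ of $-\varphi''+F'(\varphi)=0$, $\varphi(\pm L/2)=0$, $\sigma\varphi>0$ on $(-L/2,L/2)$, where, if there are several solutions, the one with the largest amplitude $|\varphi(0)|$ is taken. For $\varepsilon>0$ put $\phi(x,\ell,\sigma):=\varphi(x/\varepsilon,\ell/\varepsilon,\sigma)$. For $\varepsilon,\rho>0$ let $\Omega_\rho$ be the set of all $h\in\mathbb R^N$ with $0<h_1<\dots<h_N<1$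 and $h_j-h_{j-1}>\varepsilon/\rho$ for $j=1,\dots,N+1$, where $h_0:=-h_1$ and $h_{N+1}:=2-h_N$. Write $h_{j+1/2}:=\frac12(h_j+h_{j+1})$, $\ell^h:=\min_{1\le j\le N+1}(h_j-h_{j-1})$, $\chi^j(x):=\chi((x-h_j)/\varepsilon)$, $\phi^j(x):=\phi(x-h_{j-1/2},h_j-h_{j-1},(-1)^j)$, and $$u^h:=(1-\chi^j)\phi^j+\chi^j\phi^{j+1}\ \text{ on } I_j:=[h_{j-1/2},h_{j+1/2}],\qquad u^h_j:=\partial_{h_j}u^h,$$ $$k^h_j(x):=-\chi\Bigl(\tfrac{x-h_{j-1/2}-\varepsilon}{\varepsilon}\Bigr)\Bigl[1-\chi\Bigl(\tfrac{x-h_{j+1/2}+\varepsilon}{\varepsilon}\Bigr)\Bigr]u^h_x(x),\qquad j=1,\dots,N,$$ $$\beta^{j+1/2}:=1-|\phi(0,h_{j+1}-h_j,(-1)^{j+1})|,\qquad j=0,\dots,N .$$ Let $\langle\cdot,\cdot\rangle$ be the inner product of $L^2(0,1)$, let $D(h)$ be the matrix with entries $D_{ij}(h)=\langle u^h_j,k^h_i\rangle$,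 and let $\mathcal G_{ij}(h):=\sum_{l}D^{-1}_{il}(h)\langle g(u^h)u^h_j,k^h_l\rangle$ be the friction matrix of the reduced equation for $h$. **Proposition.** There are $\rho_0,C_1,C_2>0$, depending only on $F,g,\chi,N$, such that for all $\varepsilon>0$, $0<\rho<\rho_0$ and $h\in\Omega_\rho$ the functions above are well defined (the solutions $\varphi$ used exist and are unique, $u^h(x)$ is differentiable in $x$ and has a derivative in each $h_j$ for every $x\in[0,1]$, and the products $g(u^h)u^h_jk^h_i$ are integrable), and: 1. for $j=1,\dots,N$, $$\bigl|\langle g(u^h)u^h_j,k^h_j\rangle-\varepsilon^{-1}C_{F,g}\bigr|\le C_1\varepsilon^{-1}\max\{\beta^{j-1/2},\beta^{j+1/2}\}\le C_2\varepsilon^{-1}e^{-A\ell^h/2\varepsilon};$$ 2. for $j=1,\dots,N-1$, $$\bigl|\langle g(u^h)u^h_j,k^h_{j+1}\rangle\bigr|+\bigl|\langle g(u^h)u^h_{j+1},k^h_j\rangle\bigr|\le C_1\varepsilon^{-1}\beta^{j+1/2}\le C_2\varepsilon^{-1}e^{-A\ell^h/2\varepsilon};$$ 3. $\langle g(u^h)u^h_j,k^h_i\rangle=0$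 if $|i-j|>1$; 4. $D(h)$ is invertible and, with the friction coefficient $\gamma_\tau:=C_{F,g}/D_\infty$, $$\bigl|\mathcal G_{ij}(h)-\gamma_\tau\delta_{ij}\bigr|\le C_2\,e^{-A\ell^h/2\varepsilon}\qquad(i,j=1,\dots,N).$$ -/

import Mathlib

open Set MeasureTheory
open scoped ContDiff

/-- A double well potential with two nondegenerate zero minima at `-1` and `1`. -/
structure IsDoubleWell (F : ℝ → ℝ) : Prop where
  val_one : F 1 = 0
  val_neg_one : F (-1) = 0
  deriv_one : deriv F 1 = 0
  deriv_neg_one : deriv F (-1) = 0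
  deriv2_one : 0 < deriv (deriv F) 1
  deriv2_neg_one : 0 < deriv (deriv F) (-1)
  pos : ∀ s : ℝ, s ≠ 1 → s ≠ -1 → 0 < F s

/-- A smooth cut-off function: values in `[0,1]`, equal to `0` on `(-∞,-1]` and to `1` on
`[1,∞)`. -/
structure IsCutoff (χ : ℝ → ℝ) : Prop where
  smooth : ContDiff ℝ ∞ χ
  nonneg : ∀ x, 0 ≤ χ x
  le_one : ∀ x, χ x ≤ 1
  eq_zero : ∀ x, x ≤ -1 → χ x = 0
  eq_one : ∀ x, 1 ≤ x → χ x = 1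

/-- `φ` is a (global) solution of `-φ'' + F'(φ) = 0` which vanishes at `±L/2` and has the sign
`σ = ±1` on `(-L/2, L/2)`. -/
structure IsProfile (F : ℝ → ℝ) (L σ : ℝ) (φ : ℝ → ℝ) : Prop where
  contDiff : ContDiff ℝ 2 φ
  ode : ∀ x, -deriv (deriv φ) x + deriv F (φ x) = 0
  left : φ (-(L / 2)) = 0
  right : φ (L / 2) = 0
  sign : ∀ x ∈ Ioo (-(L / 2)) (L / 2), 0 < σ * φ x

/-- The solution of largest amplitude `|φ(0)|`. For a double well with exactly three critical
points and large `L` it is the only profile; if `F` has further local minima in `(-1,1)` there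
can be other profiles of the same length, and this condition selects the branch whose amplitude
tends to `1` as `L → ∞`. -/
def IsMaxProfile (F : ℝ → ℝ) (L σ : ℝ) (φ : ℝ → ℝ) : Prop :=
  IsProfile F L σ φ ∧ ∀ ψ : ℝ → ℝ, IsProfile F L σ ψ → σ * ψ 0 ≤ σ * φ 0

noncomputable section

open Classical in
/-- The function `φ(·, L, σ)`, `σ = ±1` (with value `0` if it does not exist). -/
def profile (F : ℝ → ℝ) (L σ : ℝ) : ℝ → ℝ :=
  if h : ∃ φ : ℝ → ℝ, IsMaxProfile F L σ φ then h.choose else 0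

/-- The rescaled steady state `x ↦ φ(x/ε, ℓ/ε, σ)`. -/
def steady (F : ℝ → ℝ) (ε x ℓ σ : ℝ) : ℝ := profile F (ℓ / ε) σ (x / ε)

/-- `h_k` for `1 ≤ k ≤ N` (the entries of a vector are counted from `1`). -/
def entry {N : ℕ} (h : Fin N → ℝ) (k : ℕ) : ℝ :=
  if hk : k - 1 < N then h ⟨k - 1, hk⟩ else 0

/-- The layer positions `h_k`, `0 ≤ k ≤ N + 1`, with `h_0 = -h_1` and `h_{N+1} = 2 - h_N`. -/
def node {N : ℕ} (h : Fin N → ℝ) (k : ℕ) : ℝ :=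
  if k = 0 then -entry h 1 else if k ≤ N then entry h k else 2 - entry h N

/-- The midpoint `h_{k+1/2} = (h_k + h_{k+1}) / 2`. -/
def mid {N : ℕ} (h : Fin N → ℝ) (k : ℕ) : ℝ := (node h k + node h (k + 1)) / 2

/-- The distance `h_{k+1} - h_k`. -/
def gap {N : ℕ} (h : Fin N → ℝ) (k : ℕ) : ℝ := node h (k + 1) - node h k

/-- The set `Ω_ρ` of admissible layer positions. -/
def layerSet (N : ℕ) (ε ρ : ℝ) : Set (Fin N → ℝ) :=
  {h | StrictMono h ∧ (∀ i, 0 < h i ∧ h i < 1) ∧ ∀ k : Fin (N + 1), ε / ρ < gap h k}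

/-- The minimal distance `ℓ^h` of neighbouring layers. -/
def minGap {N : ℕ} (h : Fin N → ℝ) : ℝ := ⨅ k : Fin (N + 1), gap h k

/-- `φ^j(x) = φ(x - h_{j-1/2}, h_j - h_{j-1}, (-1)^j)` (rescaled by `ε`), for `1 ≤ j ≤ N + 1`. -/
def steadyAt (F : ℝ → ℝ) (ε : ℝ) {N : ℕ} (h : Fin N → ℝ) (j : ℕ) (x : ℝ) : ℝ :=
  steady F ε (x - mid h (j - 1)) (gap h (j - 1)) ((-1) ^ j)

/-- The index `j ∈ {1, …, N}` of the interval `I_j = [h_{j-1/2}, h_{j+1/2}]` that contains `x`. -/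
def pieceIndex {N : ℕ} (h : Fin N → ℝ) (x : ℝ) : ℕ :=
  1 + ((Finset.Icc 1 (N - 1)).filter fun i => mid h i ≤ x).card

/-- The function `u^h`, equal to `(1 - χ^j) φ^j + χ^j φ^{j+1}` on `I_j`,
with `χ^j(x) = χ((x - h_j)/ε)`. -/
def baseFun (F χ : ℝ → ℝ) (ε : ℝ) {N : ℕ} (h : Fin N → ℝ) (x : ℝ) : ℝ :=
  (1 - χ ((x - node h (pieceIndex h x)) / ε)) * steadyAt F ε h (pieceIndex h x) x
    + χ ((x - node h (pieceIndex h x)) / ε) * steadyAt F ε h (pieceIndex h x + 1) x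

/-- The derivative of `u^h(x)` with respect to the entry `i` of `h`. -/
def baseFunPartial (F χ : ℝ → ℝ) (ε : ℝ) {N : ℕ} (h : Fin N → ℝ) (i : Fin N) (x : ℝ) : ℝ :=
  deriv (fun s : ℝ => baseFun F χ ε (Function.update h i s) x) (h i)

/-- The cut-off function `γ^j`, `1 ≤ j ≤ N`. -/
def tangentCutoff (χ : ℝ → ℝ) (ε : ℝ) {N : ℕ} (h : Fin N → ℝ) (j : ℕ) (x : ℝ) : ℝ :=
  χ ((x - mid h (j - 1) - ε) / ε) * (1 - χ ((x - mid h j + ε) / ε))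

/-- The approximate tangent vector `k^h_j = -γ^j u^h_x`; the entry `i : Fin N` is the layer
number `j = i + 1`. -/
def tangentVec (F χ : ℝ → ℝ) (ε : ℝ) {N : ℕ} (h : Fin N → ℝ) (i : Fin N) (x : ℝ) : ℝ :=
  -(tangentCutoff χ ε h (i + 1) x * deriv (fun y => baseFun F χ ε h y) x)

/-- The function `g(u^h) u^h_j k^h_i`. -/
def productFun (F χ g : ℝ → ℝ) (ε : ℝ) {N : ℕ} (h : Fin N → ℝ) (j i : Fin N) (x : ℝ) : ℝ :=
  g (baseFun F χ ε h x) * baseFunPartial F χ ε h j x * tangentVec F χ ε h i x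

/-- The scalar product `⟨g(u^h) u^h_j, k^h_i⟩` in `L²(0,1)`. -/
def scalarProd (F χ g : ℝ → ℝ) (ε : ℝ) {N : ℕ} (h : Fin N → ℝ) (j i : Fin N) : ℝ :=
  ∫ x in (0 : ℝ)..1, productFun F χ g ε h j i x

/-- The matrix with entry `⟨g(u^h) u^h_j, k^h_i⟩` in row `i` and column `j`. -/
def prodMatrix (F χ g : ℝ → ℝ) (ε : ℝ) {N : ℕ} (h : Fin N → ℝ) : Matrix (Fin N) (Fin N) ℝ :=
  Matrix.of fun i j => scalarProd F χ g ε h j i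

/-- The matrix `D(h)`, with entries `⟨u^h_j, k^h_i⟩`. -/
def gramMatrix (F χ : ℝ → ℝ) (ε : ℝ) {N : ℕ} (h : Fin N → ℝ) : Matrix (Fin N) (Fin N) ℝ :=
  prodMatrix F χ (fun _ => 1) ε h

/-- The friction matrix `𝒢(h) = D(h)⁻¹ (⟨g(u^h) u^h_j, k^h_i⟩)_{ij}`, the coefficient of `h'` in the
equation for `h`. -/
def frictionMatrix (F χ g : ℝ → ℝ) (ε : ℝ) {N : ℕ} (h : Fin N → ℝ) :
    Matrix (Fin N) (Fin N) ℝ :=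
  (gramMatrix F χ ε h)⁻¹ * prodMatrix F χ g ε h

/-- `C_{F,g} = ∫_{-1}^1 √(2F(s)) g(s) ds`. -/
def weightConst (F g : ℝ → ℝ) : ℝ := ∫ s in (-1 : ℝ)..1, √(2 * F s) * g s

/-- `D_∞ = ∫_{-1}^1 √(2F(s)) ds`. -/
def dInfty (F : ℝ → ℝ) : ℝ := ∫ s in (-1 : ℝ)..1, √(2 * F s)

/-- `A = min {√F''(1), √F''(-1)}`. -/
def decayRate (F : ℝ → ℝ) : ℝ := min (√(deriv (deriv F) 1)) (√(deriv (deriv F) (-1)))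

/-- `β_±`: one minus the amplitude `|φ(0, ℓ, σ)|`. -/
def betaFun (F : ℝ → ℝ) (ε ℓ σ : ℝ) : ℝ := 1 - σ * steady F ε 0 ℓ σ

/-- `β^{k+1/2}`, `0 ≤ k ≤ N`: it is `β_+` at `ℓ = h_{k+1} - h_k` for odd `k` and `β_-` for
even `k`. -/
def betaAt (F : ℝ → ℝ) (ε : ℝ) {N : ℕ} (h : Fin N → ℝ) (k : ℕ) : ℝ :=
  betaFun F ε (gap h k) ((-1) ^ (k + 1))

end

/-!
The scalar products are computed one layer at a time, from estimates of the profiles in terms of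
`β = 1 - |φ(0)|`.

*Profiles.* By reflection `s ↦ -s` it suffices to treat positive profiles. These are orbits of
`y'' = F' y` that start at rest at an amplitude `a < 1` and reach their first zero at `τ a = L / 2`.
For `a` near `1` the orbit leaves the well of `F` at `1` like an exponential of rate `√F''(1)`, which
gives `1 - a ≤ C exp (-√F''(1) τ)` (`HalfOrbit.beta_exp_le`), and the derivative `M = ∂y/∂a` grows to
the order `1 / (1 - a)` on the way (`HalfOrbit.linearized_exit`). Hence `τ` is strictly increasing,
its inverse is differentiable (`OrbitFamily.exists_amplitude`), and the profile of maximal amplitude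
exists, is unique, and is differentiable in `(x, L)`. The function `w = ∂φ/∂L + φ' / 2` solves the
linearized equation and vanishes at `L / 2`; the Wronskian of `M` and `y'` controls its slope there,
and convexity of `w²` in the well controls the rest, so that `w = O(β)` (`HalfOrbit.abs_w_le`). The
energy identity `φ'² = 2 (F φ - F a)` turns `∫ g(φ) φ'²` into an integral over the range of `φ`
(`HalfOrbit.mass`). These facts are collected in `ProfileEstimates`.

*One layer.* In the variable `y = (x - h_k) / ε` the function `u^h` is two profiles glued at `0`.
They solve the same equation, vanish there, and have opposite slopes up to `O(β)`, so that gluing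
costs `O(β)` (`LayerPair.abs_sub_le`), and the two halves of the layer add up to `C_{F,g}`
(`LayerPair.mass`).

*Products.* Moving `h_j` moves the points `h_{k-1}`, `h_k`, `h_{k+1}` with speeds `n₋`, `n`, `n₊`, and
near the layer `k` the derivative of `u^h` is `-n u_x` plus corrections `(n - n₋) w` and `(n₊ - n) w`
for the two adjacent profiles (`hasDerivAt_baseFun_update`). The first term gives the diagonal
products, and the corrections the errors and the products of neighbours, all of order `β / ε`
(`exists_scalarProd_eq`). Thus `ε D(h)` and `ε` times the weighted matrix are exponentially small
perturbations of `D_∞ • 1` and `C_{F,g} • 1`, and dividing them gives the friction matrix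
(`abs_sub_le_of_mul_eq`).
-/

/-! ### Second order scalar equations -/

/-- Grönwall's inequality between two points in either order. -/
lemma norm_le_exp_of_deriv {E : Type*} [NormedAddCommGroup E] [NormedSpace ℝ E]
    {f f' : ℝ → E} {K η δ c b : ℝ} (hK : 1 ≤ K) (hη : 0 ≤ η)
    (hf : ∀ x ∈ uIcc c b, HasDerivWithinAt f (f' x) (uIcc c b) x) (hc : ‖f c‖ ≤ δ)
    (bound : ∀ x ∈ uIcc c b, ‖f' x‖ ≤ K * ‖f x‖ + η) :
    ‖f b‖ ≤ (δ + η) * Real.exp (K * |b - c|) := by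
  have hδ : 0 ≤ δ := (norm_nonneg _).trans hc
  rcases eq_or_ne b c with rfl | hbc
  · simpa using hc.trans (le_add_of_nonneg_right hη)
  have hpos : 0 < |b - c| := abs_pos.2 (sub_ne_zero.2 hbc)
  have hmem : ∀ s ∈ Icc (0 : ℝ) 1, c + s * (b - c) ∈ uIcc c b := by
    intro s hs
    rw [mem_uIcc]
    rcases le_total c b with h | h
    · left; constructor <;> nlinarith [hs.1, hs.2]
    · right; constructor <;> nlinarith [hs.1, hs.2]
  have hd : ∀ s ∈ Icc (0 : ℝ) 1, HasDerivWithinAt (fun s => f (c + s * (b - c)))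
      ((b - c) • f' (c + s * (b - c))) (Icc 0 1) s := by
    intro s hs
    have h1 : HasDerivWithinAt (fun s : ℝ => c + s * (b - c)) (b - c) (Icc 0 1) s := by
      simpa using (((hasDerivAt_id s).mul_const (b - c)).const_add c).hasDerivWithinAt
    exact (hf _ (hmem s hs)).scomp s h1 hmem
  have key := norm_le_gronwallBound_of_norm_deriv_right_le
    (f := fun s => f (c + s * (b - c))) (f' := fun s => (b - c) • f' (c + s * (b - c)))
    (δ := δ) (K := K * |b - c|) (ε := η * |b - c|) (a := 0) (b := 1)
    (fun s hs => (hd s hs).continuousWithinAt)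
    (fun s hs => (hd s ⟨hs.1, hs.2.le⟩).mono_of_mem_nhdsWithin (Icc_mem_nhdsGE_of_mem hs))
    (by simpa using hc)
    (fun s hs => by
      rw [norm_smul, Real.norm_eq_abs]
      have := bound _ (hmem s ⟨hs.1, hs.2.le⟩)
      nlinarith) 1 (by simp)
  have hK' : K * |b - c| ≠ 0 := by positivity
  rw [gronwallBound_of_K_ne_0 hK'] at key
  simp only [one_mul, sub_zero, mul_one] at key
  rw [show c + (b - c) = b by ring, mul_div_mul_right _ _ hpos.ne'] at key
  have he : 1 ≤ Real.exp (K * |b - c|) := Real.one_le_exp (by positivity)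
  have : η / K ≤ η := div_le_self hη hK
  have : η / K * (Real.exp (K * |b - c|) - 1) ≤ η * (Real.exp (K * |b - c|) - 1) := by
    gcongr
  linarith

/-- Grönwall's inequality for a pair `(D, D')` with `|D''| ≤ K |D| + η`. -/
lemma second_order_gronwall {D P Q : ℝ → ℝ} {K η δ c b : ℝ} (hK : 1 ≤ K) (hη : 0 ≤ η)
    (hD : ∀ x, HasDerivAt D (P x) x) (hP : ∀ x, HasDerivAt P (Q x) x)
    (h0 : |D c| ≤ δ) (h1 : |P c| ≤ δ) (hQ : ∀ x ∈ uIcc c b, |Q x| ≤ K * |D x| + η) :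
    |D b| ≤ (δ + η) * Real.exp (K * |b - c|) ∧ |P b| ≤ (δ + η) * Real.exp (K * |b - c|) := by
  have := norm_le_exp_of_deriv (f := fun x => (D x, P x)) (f' := fun x => (P x, Q x))
    (c := c) (b := b) (δ := δ) hK hη (fun x _ => ((hD x).prodMk (hP x)).hasDerivWithinAt)
    (by simpa [Prod.norm_def] using ⟨h0, h1⟩) (fun x hx => by
      have := hQ x hx
      simp only [Prod.norm_def, Real.norm_eq_abs]
      have h2 := le_max_left |D x| |P x|
      have h3 := le_max_right |D x| |P x|
      refine max_le ?_ ?_ <;> nlinarith [abs_nonneg (P x), abs_nonneg (D x)])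
  simpa [Prod.norm_def] using this

/-- Existence on a bounded interval. The right-hand side is cut off at a height that the solution,
by Grönwall's inequality, does not reach. -/
lemma exists_second_order_on {q : ℝ → ℝ → ℝ} {K : ℝ} (hK : 1 ≤ K)
    (hq : Continuous (Function.uncurry q))
    (hLip : ∀ t y z, |q t y - q t z| ≤ K * |y - z|) (a b T : ℝ) (hT : 0 < T) :
    ∃ y p : ℝ → ℝ, y 0 = a ∧ p 0 = b ∧
      ∀ t ∈ Ioo (-T) T, HasDerivAt y (p t) t ∧ HasDerivAt p (q t (y t)) t := by
  obtain ⟨Q₀, hQ₀⟩ := (isCompact_Icc (a := -T) (b := T)).exists_bound_of_continuousOn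
    (f := fun t => q t 0) (by fun_prop)
  have hQpos : 0 ≤ Q₀ := (norm_nonneg _).trans (hQ₀ 0 (by constructor <;> linarith))
  set δ := max |a| |b|
  set R := (δ + Q₀) * Real.exp (K * T) with hR
  have hδ : 0 ≤ δ := (abs_nonneg a).trans (le_max_left _ _)
  have hR0 : 0 ≤ R := by positivity
  set clip : ℝ → ℝ := fun z => max (-R) (min R z) with hclip
  have clip_le : ∀ z, |clip z| ≤ |z| := fun z => by
    rw [abs_le]; constructor <;> simp only [hclip] <;>
    rcases le_total 0 z with h | h <;> simp [abs_of_nonneg, abs_of_nonpos, h] <;> grind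
  have clip_R : ∀ z, |clip z| ≤ R := fun z => by
    rw [abs_le]; simp only [hclip]; grind
  have clip_id : ∀ z, |z| ≤ R → clip z = z := fun z hz => by
    rw [abs_le] at hz; simp only [hclip]; grind
  have clip_lip : ∀ y z, |clip y - clip z| ≤ |y - z| := fun y z =>
    (abs_max_sub_max_le_max (-R) (min R y) (-R) (min R z)).trans (max_le (by simp)
      ((abs_min_sub_min_le_max R y R z).trans (max_le (by simp) le_rfl)))
  set v : ℝ → ℝ × ℝ → ℝ × ℝ := fun t z => (clip z.2, q t (clip z.1)) with hv
  have qle : ∀ t ∈ Icc (-T) T, ∀ y, |q t y| ≤ K * |y| + Q₀ := fun t ht y => by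
    have h1 := hLip t y 0
    have h2 := hQ₀ t ht
    rw [Real.norm_eq_abs] at h2
    rw [sub_zero] at h1
    have := abs_sub_abs_le_abs_sub (q t y) (q t 0)
    linarith
  have hPL : IsPicardLindelof v (tmin := -T) (tmax := T) ⟨0, by constructor <;> linarith⟩ (a, b)
      ((K * R + Q₀) * T).toNNReal 0 (K * R + Q₀).toNNReal K.toNNReal := by
    have hk1 : (K.toNNReal : ℝ) = K := Real.coe_toNNReal _ (by linarith)
    have hk2 : ((K * R + Q₀).toNNReal : ℝ) = K * R + Q₀ := Real.coe_toNNReal _ (by positivity)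
    have hk3 : (((K * R + Q₀) * T).toNNReal : ℝ) = (K * R + Q₀) * T :=
      Real.coe_toNNReal _ (by positivity)
    refine ⟨fun t _ => ?_, fun x _ => ?_, fun t ht x _ => ?_, ?_⟩
    · refine LipschitzWith.lipschitzOnWith (LipschitzWith.of_dist_le_mul fun z w => ?_)
      simp only [hv, Prod.dist_eq, Real.dist_eq, hk1]
      have h1 := clip_lip z.2 w.2
      have h2 := (hLip t (clip z.1) (clip w.1)).trans
        (mul_le_mul_of_nonneg_left (clip_lip z.1 w.1) (by linarith))
      have h3 := le_max_left |z.1 - w.1| |z.2 - w.2|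
      have h4 := le_max_right |z.1 - w.1| |z.2 - w.2|
      refine max_le ?_ ?_ <;> nlinarith [abs_nonneg (z.1 - w.1), abs_nonneg (z.2 - w.2)]
    · have : Continuous fun t => q t (clip x.1) := by fun_prop
      exact (continuous_const.prodMk this).continuousOn
    · simp only [hv, Prod.norm_def, Real.norm_eq_abs, hk2]
      refine max_le ?_ ?_
      · nlinarith [clip_R x.2]
      · nlinarith [clip_R x.1, qle t ht (clip x.1)]
    · rw [hk2, hk3]; simp
  obtain ⟨α, hα0, hα⟩ := hPL.exists_eq_forall_mem_Icc_hasDerivWithinAt₀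
  have hbd : ∀ t ∈ Icc (-T) T, ‖α t‖ ≤ R := by
    intro t ht
    have hsub : uIcc 0 t ⊆ Icc (-T) T := uIcc_subset_Icc ⟨by linarith, hT.le⟩ ht
    have := norm_le_exp_of_deriv (f := α) (f' := fun s => v s (α s)) (c := 0) (b := t) (δ := δ)
      hK hQpos (fun s hs => (hα s (hsub hs)).mono hsub) (by
        have : α 0 = (a, b) := hα0
        rw [this, Prod.norm_def]; simp [δ]) (fun s hs => by
        simp only [hv, Prod.norm_def, Real.norm_eq_abs]
        have h1 := clip_le (α s).2
        have h2 := clip_le (α s).1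
        have h3 := le_max_left |(α s).1| |(α s).2|
        have h4 := le_max_right |(α s).1| |(α s).2|
        have h5 := qle s (hsub hs) (clip (α s).1)
        refine max_le ?_ ?_ <;> nlinarith [abs_nonneg (α s).1, abs_nonneg (α s).2])
    refine this.trans ?_
    rw [hR]
    have : |t - 0| ≤ T := by rw [sub_zero, abs_le]; exact ht
    gcongr
  refine ⟨fun t => (α t).1, fun t => (α t).2, ?_, ?_, fun t ht => ?_⟩
  · exact congrArg Prod.fst hα0
  · exact congrArg Prod.snd hα0
  · have h1 := (hα t (Ioo_subset_Icc_self ht)).hasDerivAt (Icc_mem_nhds ht.1 ht.2)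
    have h2 := hbd t (Ioo_subset_Icc_self ht)
    rw [Prod.norm_def, max_le_iff, Real.norm_eq_abs, Real.norm_eq_abs] at h2
    have h3 : v t (α t) = ((α t).2, q t (α t).1) := by
      simp [hv, clip_id _ h2.1, clip_id _ h2.2]
    rw [h3] at h1
    exact ⟨h1.fst, h1.snd⟩

/-- Global existence for `y'' = q t y` with `q` Lipschitz in `y`. -/
theorem exists_second_order {q : ℝ → ℝ → ℝ} {K : ℝ} (hK : 1 ≤ K)
    (hq : Continuous (Function.uncurry q))
    (hLip : ∀ t y z, |q t y - q t z| ≤ K * |y - z|) (a b : ℝ) :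
    ∃ y p : ℝ → ℝ, y 0 = a ∧ p 0 = b ∧
      (∀ t, HasDerivAt y (p t) t) ∧ ∀ t, HasDerivAt p (q t (y t)) t := by
  choose! y p hy0 hp0 hyp using fun T (hT : 0 < T) => exists_second_order_on hK hq hLip a b T hT
  have huniq : ∀ S T t, |t| < S → |t| < T → y S t = y T t ∧ p S t = p T t := by
    intro S T t hS hT
    have hS0 := (abs_nonneg t).trans_lt hS
    have hT0 := (abs_nonneg t).trans_lt hT
    have hmem : ∀ U, |t| < U → ∀ x ∈ uIcc 0 t, x ∈ Ioo (-U) U := fun U hU x hx => by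
      refine abs_lt.1 (lt_of_le_of_lt ?_ hU)
      have := abs_sub_left_of_mem_uIcc hx
      simpa using this
    have := norm_le_exp_of_deriv (f := fun s => (y S s - y T s, p S s - p T s))
      (f' := fun s => (p S s - p T s, q s (y S s) - q s (y T s))) (c := 0) (b := t) (δ := 0)
      hK le_rfl (fun s hs => by
        obtain ⟨h1, h2⟩ := hyp S hS0 s (hmem S hS s hs)
        obtain ⟨h3, h4⟩ := hyp T hT0 s (hmem T hT s hs)
        exact ((h1.sub h3).prodMk (h2.sub h4)).hasDerivWithinAt)
      (by simp [hy0, hp0, hS0, hT0]) (fun s hs => by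
        simp only [Prod.norm_def, Real.norm_eq_abs, add_zero]
        have h1 := hLip s (y S s) (y T s)
        have h3 := le_max_left |y S s - y T s| |p S s - p T s|
        have h4 := le_max_right |y S s - y T s| |p S s - p T s|
        refine max_le ?_ ?_ <;>
          nlinarith [abs_nonneg (y S s - y T s), abs_nonneg (p S s - p T s)])
    simp only [add_zero, zero_mul] at this
    have := norm_le_zero_iff.1 this
    simpa [sub_eq_zero] using this
  refine ⟨fun t => y (|t| + 1) t, fun t => p (|t| + 1) t, hy0 _ (by simp), hp0 _ (by simp), ?_⟩
  rw [← forall_and]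
  intro t
  have hpos : 0 < |t| + 1 := by positivity
  obtain ⟨h1, h2⟩ := hyp (|t| + 1) hpos t (abs_lt.1 (by linarith))
  have hev : ∀ᶠ s in nhds t, |s| < |t| + 1 :=
    continuous_abs.continuousAt.eventually_lt continuousAt_const (by linarith)
  exact ⟨h1.congr_of_eventuallyEq (hev.mono fun s hs => (huniq _ _ s (by linarith) hs).1),
    h2.congr_of_eventuallyEq (hev.mono fun s hs => (huniq _ _ s (by linarith) hs).2)⟩

/-- A `C¹` function is Lipschitz on bounded intervals. -/
lemma exists_lipschitz_of_contDiff {f : ℝ → ℝ} (hf : ContDiff ℝ 1 f) (R : ℝ) :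
    ∃ K, 1 ≤ K ∧ ∀ y z, |y| ≤ R → |z| ≤ R → |f y - f z| ≤ K * |y - z| := by
  obtain ⟨C, hC⟩ := (isCompact_Icc (a := -R) (b := R)).exists_bound_of_continuousOn
    (f := deriv f) (hf.continuous_deriv le_rfl).continuousOn
  refine ⟨max 1 C, le_max_left _ _, fun y z hy hz => ?_⟩
  have := (convex_Icc (-R) R).norm_image_sub_le_of_norm_deriv_le (f := f)
    (fun x _ => (hf.differentiable one_ne_zero) x) hC (abs_le.1 hz) (abs_le.1 hy)
  exact this.trans (mul_le_mul_of_nonneg_right (le_max_right _ _) (norm_nonneg _))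

/-- Uniqueness for the autonomous equation `y'' = f y`. -/
lemma second_order_unique {f : ℝ → ℝ} (hf : ContDiff ℝ 1 f) {y p z r : ℝ → ℝ}
    (hy : ∀ t, HasDerivAt y (p t) t) (hp : ∀ t, HasDerivAt p (f (y t)) t)
    (hz : ∀ t, HasDerivAt z (r t) t) (hr : ∀ t, HasDerivAt r (f (z t)) t) {c : ℝ}
    (h0 : y c = z c) (h1 : p c = r c) : y = z := by
  funext t
  have cy : Continuous y := continuous_iff_continuousAt.2 fun t => (hy t).continuousAt
  have cz : Continuous z := continuous_iff_continuousAt.2 fun t => (hz t).continuousAt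
  obtain ⟨R₁, hR₁⟩ := (isCompact_uIcc (a := c) (b := t)).exists_bound_of_continuousOn cy.continuousOn
  obtain ⟨R₂, hR₂⟩ := (isCompact_uIcc (a := c) (b := t)).exists_bound_of_continuousOn cz.continuousOn
  obtain ⟨K, hK, hL⟩ := exists_lipschitz_of_contDiff hf (max R₁ R₂)
  have := (second_order_gronwall (D := fun t => y t - z t) (P := fun t => p t - r t)
    (Q := fun t => f (y t) - f (z t)) (K := K) (η := 0) (δ := 0) (c := c) (b := t) hK le_rfl
    (fun x => (hy x).sub (hz x)) (fun x => (hp x).sub (hr x)) (by simp [h0]) (by simp [h1])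
    (fun x hx => by
      simpa using hL _ _ ((hR₁ x hx).trans (le_max_left _ _)) ((hR₂ x hx).trans (le_max_right _ _)))).1
  simpa [sub_eq_zero] using this

/-! ### Differentiable dependence on the initial value -/

/-- Taylor's formula of first order, with quadratic remainder. -/
lemma abs_taylor_one_le {f : ℝ → ℝ} (hf : Differentiable ℝ f) {K : ℝ} {y z : ℝ}
    (hL : ∀ t ∈ uIcc z y, |deriv f t - deriv f z| ≤ K * |t - z|) (hK : 0 ≤ K) :
    |f y - f z - deriv f z * (y - z)| ≤ K * (y - z) ^ 2 := by
  have hd : ∀ t, HasDerivAt (fun t => f t - deriv f z * t) (deriv f t - deriv f z) t := fun t => by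
    exact ((hf t).hasDerivAt.sub ((hasDerivAt_id t).const_mul (deriv f z))).congr_deriv (by simp)
  have := (convex_uIcc z y).norm_image_sub_le_of_norm_hasDerivWithin_le
    (f := fun t => f t - deriv f z * t) (C := K * |y - z|)
    (fun t _ => (hd t).hasDerivWithinAt) (fun t ht => by
      refine (hL t ht).trans ?_
      have := abs_sub_left_of_mem_uIcc ht
      gcongr) left_mem_uIcc right_mem_uIcc
  rw [Real.norm_eq_abs, Real.norm_eq_abs, mul_assoc, ← sq, sq_abs] at this
  convert this using 2
  ring

/-- The solutions `Y a` of `y'' = f y`, `y 0 = a`, `y' 0 = 0`, for `f` of class `C²` with compact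
support, and the solutions `M a` of the linearized equation with data `(1, 0)`: together they give
the total derivative of `(x, a) ↦ Y a x`. -/
theorem exists_flow {f : ℝ → ℝ} (hf : ContDiff ℝ 2 f) (hc : HasCompactSupport f) :
    ∃ Y P M R : ℝ → ℝ → ℝ, (∀ a, Y a 0 = a) ∧ (∀ a, P a 0 = 0) ∧
      (∀ a x, HasDerivAt (Y a) (P a x) x) ∧ (∀ a x, HasDerivAt (P a) (f (Y a x)) x) ∧
      (∀ a, M a 0 = 1) ∧ (∀ a, R a 0 = 0) ∧
      (∀ a x, HasDerivAt (M a) (R a x) x) ∧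
      (∀ a x, HasDerivAt (R a) (deriv f (Y a x) * M a x) x) ∧
      ∀ a x, HasFDerivAt (fun z : ℝ × ℝ => Y z.2 z.1)
        (P a x • ContinuousLinearMap.fst ℝ ℝ ℝ + M a x • ContinuousLinearMap.snd ℝ ℝ ℝ) (x, a) := by
  obtain ⟨K₁, hK₁⟩ := hf.lipschitzWith_of_hasCompactSupport hc (by norm_num)
  have hf' : ContDiff ℝ 1 (deriv f) := hf.deriv'
  obtain ⟨K₂, hK₂⟩ := hf'.lipschitzWith_of_hasCompactSupport hc.deriv (by norm_num)
  obtain ⟨K₃, hK₃⟩ := hc.deriv.exists_bound_of_continuous hf'.continuous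
  set K : ℝ := 1 + K₁ + K₂ + |K₃|
  have k1 : (0 : ℝ) ≤ K₁ := K₁.2
  have k2 : (0 : ℝ) ≤ K₂ := K₂.2
  have k3 := abs_nonneg K₃
  have hK : 1 ≤ K := by simp only [K]; linarith
  have hL1 : ∀ y z, |f y - f z| ≤ K * |y - z| := fun y z => by
    have := hK₁.dist_le_mul y z
    rw [Real.dist_eq, Real.dist_eq] at this
    refine this.trans (mul_le_mul_of_nonneg_right ?_ (abs_nonneg _))
    simp only [K]; linarith
  have hL2 : ∀ y z, |deriv f y - deriv f z| ≤ K * |y - z| := fun y z => by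
    have := hK₂.dist_le_mul y z
    rw [Real.dist_eq, Real.dist_eq] at this
    refine this.trans (mul_le_mul_of_nonneg_right ?_ (abs_nonneg _))
    simp only [K]; linarith
  have hL3 : ∀ y, |deriv f y| ≤ K := fun y => by
    have := (hK₃ y).trans (le_abs_self _)
    rw [Real.norm_eq_abs] at this
    simp only [K]; linarith
  have cf : Continuous f := hf.continuous
  have cf' : Continuous (deriv f) := hf'.continuous
  have df : Differentiable ℝ f := hf.differentiable (by norm_num)
  choose Y P hY0 hP0 hY hP using fun a => exists_second_order (q := fun _ y => f y) hK
    (by fun_prop) (fun _ => hL1) a 0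
  have cY : ∀ a, Continuous (Y a) := fun a =>
    continuous_iff_continuousAt.2 fun t => (hY a t).continuousAt
  choose M R hM0 hR0 hM hR using fun a => exists_second_order
    (q := fun t y => deriv f (Y a t) * y) hK
    (by have := cY a; fun_prop) (fun t y z => by
      rw [← mul_sub, abs_mul]
      exact mul_le_mul_of_nonneg_right (hL3 _) (abs_nonneg _)) 1 0
  refine ⟨Y, P, M, R, hY0, hP0, hY, hP, hM0, hR0, hM, hR, fun a x => ?_⟩
  set X := |x| + 1
  have hX : ∀ x', |x'| ≤ X → ∀ s ∈ uIcc 0 x', |s| ≤ X := fun x' hx' s hs => by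
    have := abs_sub_left_of_mem_uIcc hs
    simp only [sub_zero] at this
    exact this.trans hx'
  have h1 : ∀ b x', |x'| ≤ X → |Y b x' - Y a x'| ≤ |b - a| * Real.exp (K * X) := by
    intro b x' hx'
    have := (second_order_gronwall (D := fun s => Y b s - Y a s) (P := fun s => P b s - P a s)
      (Q := fun s => f (Y b s) - f (Y a s)) (c := 0) (b := x') (δ := |b - a|) hK le_rfl
      (fun s => (hY b s).sub (hY a s)) (fun s => (hP b s).sub (hP a s))
      (by simp [hY0]) (by simp [hP0]) (fun s _ => by simpa using hL1 _ _)).1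
    rw [add_zero, sub_zero] at this
    refine this.trans ?_
    gcongr
  set C := K * Real.exp (K * X) ^ 2 * Real.exp (K * X)
  have h2 : ∀ b x', |x'| ≤ X → |Y b x' - Y a x' - (b - a) * M a x'| ≤ C * (b - a) ^ 2 := by
    intro b x' hx'
    have := (second_order_gronwall (D := fun s => Y b s - Y a s - (b - a) * M a s)
      (P := fun s => P b s - P a s - (b - a) * R a s)
      (Q := fun s => f (Y b s) - f (Y a s) - (b - a) * (deriv f (Y a s) * M a s))
      (c := 0) (b := x') (δ := 0) (η := K * (|b - a| * Real.exp (K * X)) ^ 2) hK (by positivity)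
      (fun s => ((hY b s).sub (hY a s)).sub ((hM a s).const_mul _))
      (fun s => ((hP b s).sub (hP a s)).sub ((hR a s).const_mul _))
      (by simp [hY0, hM0]) (by simp [hP0, hR0]) (fun s hs => by
        have e1 := abs_taylor_one_le (y := Y b s) (z := Y a s) df (fun t _ => hL2 t _)
          (by linarith)
        have e2 := h1 b s (hX x' hx' s hs)
        have e3 : (Y b s - Y a s) ^ 2 ≤ (|b - a| * Real.exp (K * X)) ^ 2 := by
          rw [← sq_abs]; gcongr
        have e4 : f (Y b s) - f (Y a s) - (b - a) * (deriv f (Y a s) * M a s)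
          = (f (Y b s) - f (Y a s) - deriv f (Y a s) * (Y b s - Y a s))
            + deriv f (Y a s) * (Y b s - Y a s - (b - a) * M a s) := by ring
        rw [e4]
        refine (abs_add_le _ _).trans ?_
        rw [abs_mul, add_comm]
        gcongr
        · exact hL3 _
        · exact e1.trans (by gcongr))).1
    rw [zero_add, sub_zero] at this
    refine this.trans ?_
    rw [mul_pow, sq_abs]
    simp only [C]
    have : Real.exp (K * |x'|) ≤ Real.exp (K * X) := by gcongr
    calc K * ((b - a) ^ 2 * Real.exp (K * X) ^ 2) * Real.exp (K * |x'|)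
        ≤ K * ((b - a) ^ 2 * Real.exp (K * X) ^ 2) * Real.exp (K * X) := by gcongr
      _ = _ := by ring
  have h3 : HasFDerivAt (fun z : ℝ × ℝ => Y z.2 z.1 - Y a z.1 - (z.2 - a) * M a z.1)
      (0 : ℝ × ℝ →L[ℝ] ℝ) (x, a) := by
    refine Asymptotics.IsBigO.hasFDerivAt (n := 2) ?_ one_lt_two
    refine Asymptotics.IsBigO.of_bound C ?_
    have hev : ∀ᶠ z : ℝ × ℝ in nhds (x, a), |z.1| < X :=
      (continuous_abs.comp continuous_fst).continuousAt.eventually_lt continuousAt_const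
        (by simp [X])
    filter_upwards [hev] with z hz
    refine (h2 z.2 z.1 hz.le).trans ?_
    rw [Real.norm_of_nonneg (by positivity)]
    have : |z.2 - a| ≤ ‖z - (x, a)‖ := by
      rw [← Real.norm_eq_abs]; exact norm_snd_le (z - (x, a))
    have : (z.2 - a) ^ 2 ≤ ‖z - (x, a)‖ ^ 2 := by rw [← sq_abs]; gcongr
    gcongr
  have hfst : HasFDerivAt (fun z : ℝ × ℝ => z.1) (ContinuousLinearMap.fst ℝ ℝ ℝ) (x, a) :=
    hasFDerivAt_fst
  have hsnd : HasFDerivAt (fun z : ℝ × ℝ => z.2) (ContinuousLinearMap.snd ℝ ℝ ℝ) (x, a) :=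
    hasFDerivAt_snd
  have h4 : HasFDerivAt (fun z : ℝ × ℝ => Y a z.1) (P a x • ContinuousLinearMap.fst ℝ ℝ ℝ) (x, a) :=
    (hY a x).comp_hasFDerivAt (x, a) hfst
  have h5 : HasFDerivAt (fun z : ℝ × ℝ => M a z.1) (R a x • ContinuousLinearMap.fst ℝ ℝ ℝ) (x, a) :=
    (hM a x).comp_hasFDerivAt (x, a) hfst
  have h6 := h4.add ((hsnd.sub_const a).mul h5)
  have h7 := h3.add h6
  refine (h7.congr_fderiv ?_).congr_of_eventuallyEq (Filter.Eventually.of_forall fun z => ?_)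
  · ext <;> simp
  · simp

/-! ### Orbits starting at rest near the well `1` -/

/-- The solution `y` of `y'' = F' y` with `y 0 = a`, `y' 0 = 0`, together with its derivative
`p`. -/
structure IsOrbit (F : ℝ → ℝ) (a : ℝ) (y p : ℝ → ℝ) : Prop where
  y_zero : y 0 = a
  p_zero : p 0 = 0
  hy : ∀ x, HasDerivAt y (p x) x
  hp : ∀ x, HasDerivAt p (deriv F (y x)) x

/-- Constants for the well of `F` at `1`: `K` bounds `F'`, `F''` and the Lipschitz constant of
`F''` on `[-1, 1]`, `m` is a lower bound for `F''` on `[1 - δ, 1]`, and for amplitudes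
`a ∈ [a₀, 1)` the difference `2 (F - F a)` is at least `c` on `[0, 1 - δ]`. -/
structure WellConst (F : ℝ → ℝ) (K δ m c a₀ : ℝ) : Prop where
  one_le_K : 1 ≤ K
  δ_pos : 0 < δ
  δ_lt : δ < 1
  m_pos : 0 < m
  c_pos : 0 < c
  lt_a₀ : 1 - δ < a₀
  a₀_lt : a₀ < 1
  bound1 : ∀ s ∈ Icc (-1 : ℝ) 1, |deriv F s| ≤ K
  bound2 : ∀ s ∈ Icc (-1 : ℝ) 1, |deriv (deriv F) s| ≤ K
  lip2 : ∀ s ∈ Icc (-1 : ℝ) 1, ∀ t ∈ Icc (-1 : ℝ) 1,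
    |deriv (deriv F) s - deriv (deriv F) t| ≤ K * |s - t|
  conv : ∀ s ∈ Icc (1 - δ) 1, m ≤ deriv (deriv F) s
  gap : ∀ a ∈ Ico a₀ 1, ∀ s ∈ Icc 0 (1 - δ), c ≤ 2 * (F s - F a)

lemma contDiff_three_derivs {F : ℝ → ℝ} (hF : ContDiff ℝ 3 F) :
    Differentiable ℝ F ∧ ContDiff ℝ 2 (deriv F) ∧ Differentiable ℝ (deriv F) ∧
      ContDiff ℝ 1 (deriv (deriv F)) := by
  have h1 : ContDiff ℝ 2 (deriv F) := ContDiff.deriv' (n := 2) (hF.of_le (by norm_num))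
  have h2 : ContDiff ℝ 1 (deriv (deriv F)) := ContDiff.deriv' (n := 1) (h1.of_le (by norm_num))
  exact ⟨hF.differentiable (by norm_num), h1, h1.differentiable (by norm_num), h2⟩

lemma IsDoubleWell.pos_of_abs_lt {F : ℝ → ℝ} (hw : IsDoubleWell F) {s : ℝ} (hs : |s| < 1) :
    0 < F s := by
  rw [abs_lt] at hs
  exact hw.pos s hs.2.ne hs.1.ne'

lemma IsDoubleWell.nonneg {F : ℝ → ℝ} (hw : IsDoubleWell F) (s : ℝ) : 0 ≤ F s := by
  by_cases h1 : s = 1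
  · rw [h1, hw.val_one]
  by_cases h2 : s = -1
  · rw [h2, hw.val_neg_one]
  exact (hw.pos s h1 h2).le

theorem IsDoubleWell.exists_wellConst {F : ℝ → ℝ} (hF : ContDiff ℝ 3 F) (hw : IsDoubleWell F) :
    ∃ K δ m c a₀, WellConst F K δ m c a₀ := by
  obtain ⟨d0, c1, d1, c2⟩ := contDiff_three_derivs hF
  obtain ⟨K₁, hK₁⟩ := (isCompact_Icc (a := (-1 : ℝ)) (b := 1)).exists_bound_of_continuousOn
    (f := deriv F) c1.continuous.continuousOn
  obtain ⟨K₂, hK₂⟩ := (isCompact_Icc (a := (-1 : ℝ)) (b := 1)).exists_bound_of_continuousOn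
    (f := deriv (deriv F)) c2.continuous.continuousOn
  obtain ⟨K₃, hK₃, hL⟩ := exists_lipschitz_of_contDiff c2 1
  obtain ⟨δ', hδ', hball⟩ := Metric.eventually_nhds_iff.1
    ((c2.continuous.tendsto 1).eventually_const_lt (half_lt_self hw.deriv2_one))
  set δ := min (δ' / 2) (1 / 2)
  have hδ : 0 < δ := lt_min (by linarith) (by norm_num)
  have hδ1 : δ ≤ 1 / 2 := min_le_right _ _
  have hδ2 : δ ≤ δ' / 2 := min_le_left _ _
  obtain ⟨s₀, hs₀, hmin⟩ := (isCompact_Icc (a := (0 : ℝ)) (b := 1 - δ)).exists_isMinOn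
    ⟨0, by constructor <;> linarith⟩ d0.continuous.continuousOn
  have hκ : 0 < F s₀ := hw.pos_of_abs_lt (by
    rw [abs_lt]; constructor <;> linarith [hs₀.1, hs₀.2])
  obtain ⟨η, hη, hball2⟩ := Metric.eventually_nhds_iff.1
    ((d0.continuous.tendsto 1).eventually_lt_const (hw.val_one.trans_lt (half_pos hκ)))
  refine ⟨max (max K₁ K₂) K₃, δ, deriv (deriv F) 1 / 2, F s₀, max (1 - δ / 2) (1 - η / 2),
    ⟨hK₃.trans (le_max_right _ _), hδ, by linarith, half_pos hw.deriv2_one, hκ,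
    lt_max_of_lt_left (by linarith), max_lt (by linarith) (by linarith), fun s hs => ?_,
    fun s hs => ?_, fun s hs t ht => ?_, fun s hs => ?_, fun a ha s hs => ?_⟩⟩
  · exact (hK₁ s hs).trans ((le_max_left _ _).trans (le_max_left _ _))
  · exact (hK₂ s hs).trans ((le_max_right _ _).trans (le_max_left _ _))
  · exact (hL s t (abs_le.2 hs) (abs_le.2 ht)).trans
      (mul_le_mul_of_nonneg_right (le_max_right _ _) (abs_nonneg _))
  · refine (hball (y := s) ?_).le
    rw [Real.dist_eq, abs_lt]; constructor <;> linarith [hs.1, hs.2]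
  · have h1 : F s₀ ≤ F s := hmin hs
    have h2 : F a < F s₀ / 2 := hball2 (by
      rw [Real.dist_eq, abs_lt]
      have := (le_max_right _ _).trans ha.1
      constructor <;> linarith [ha.2])
    linarith

namespace WellConst

variable {F : ℝ → ℝ} {K δ m c a₀ : ℝ}

lemma mono (W : WellConst F K δ m c a₀) {a₁ : ℝ} (h : a₀ ≤ a₁) (h1 : a₁ < 1) :
    WellConst F K δ m c a₁ :=
  { W with
    lt_a₀ := W.lt_a₀.trans_le h
    a₀_lt := h1
    gap := fun a ha => W.gap a ⟨h.trans ha.1, ha.2⟩ }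

lemma pos_of_mem (W : WellConst F K δ m c a₀) {a : ℝ} (ha : a ∈ Ico a₀ 1) : 0 < a := by
  linarith [W.lt_a₀, W.δ_lt, ha.1]

lemma deriv_le (W : WellConst F K δ m c a₀) (hF : ContDiff ℝ 3 F) (hw : IsDoubleWell F) {s : ℝ}
    (hs : s ∈ Icc (1 - δ) 1) : deriv F s ≤ -(m * (1 - s)) := by
  obtain ⟨d0, c1, d1, c2⟩ := contDiff_three_derivs hF
  have := (convex_Icc (1 - δ) 1).mul_sub_le_image_sub_of_le_deriv (f := deriv F) (C := m)
    d1.continuous.continuousOn d1.differentiableOn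
    (fun x hx => W.conv x (interior_subset hx)) s hs 1 ⟨by linarith [W.δ_pos], le_rfl⟩ hs.2
  rw [hw.deriv_one] at this
  linarith

lemma abs_deriv_le (W : WellConst F K δ m c a₀) (hF : ContDiff ℝ 3 F) (hw : IsDoubleWell F) {s : ℝ}
    (hs : s ∈ Icc (-1) 1) : |deriv F s| ≤ K * (1 - s) := by
  obtain ⟨d0, c1, d1, c2⟩ := contDiff_three_derivs hF
  have := (convex_Icc (-1 : ℝ) 1).norm_image_sub_le_of_norm_deriv_le (f := deriv F) (C := K)
    (fun x _ => d1 x) (fun x hx => W.bound2 x hx) (x := 1) (y := s) (by simp) hs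
  rw [hw.deriv_one, sub_zero, Real.norm_eq_abs, Real.norm_eq_abs, abs_sub_comm,
    abs_of_nonneg (by linarith [hs.2] : 0 ≤ 1 - s)] at this
  exact this

lemma strictAntiOn (W : WellConst F K δ m c a₀) (hF : ContDiff ℝ 3 F) (hw : IsDoubleWell F) :
    StrictAntiOn F (Icc (1 - δ) 1) := by
  obtain ⟨d0, c1, d1, c2⟩ := contDiff_three_derivs hF
  refine strictAntiOn_of_deriv_neg (convex_Icc _ _) d0.continuous.continuousOn fun x hx => ?_
  rw [interior_Icc] at hx
  have := W.deriv_le hF hw (Ioo_subset_Icc_self hx)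
  have : 0 < m * (1 - x) := mul_pos W.m_pos (by linarith [hx.2])
  linarith

lemma lt_of_lt_amp (W : WellConst F K δ m c a₀) (hF : ContDiff ℝ 3 F) (hw : IsDoubleWell F) {a s : ℝ}
    (ha : a ∈ Ico a₀ 1) (h0 : 0 ≤ s) (hs : s < a) : F a < F s := by
  rcases le_total s (1 - δ) with h | h
  · have := W.gap a ha s ⟨h0, h⟩
    linarith [W.c_pos]
  · exact W.strictAntiOn hF hw ⟨h, by linarith [ha.2]⟩
      ⟨by linarith [W.lt_a₀, ha.1], ha.2.le⟩ hs

end WellConst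

namespace IsOrbit

variable {F : ℝ → ℝ} {a : ℝ} {y p : ℝ → ℝ}

lemma continuous_y (o : IsOrbit F a y p) : Continuous y :=
  continuous_iff_continuousAt.2 fun t => (o.hy t).continuousAt

lemma continuous_p (o : IsOrbit F a y p) : Continuous p :=
  continuous_iff_continuousAt.2 fun t => (o.hp t).continuousAt

lemma energy (o : IsOrbit F a y p) (hF : Differentiable ℝ F) (x : ℝ) :
    p x ^ 2 = 2 * (F (y x) - F a) := by
  have hd : ∀ x, HasDerivAt (fun x => p x ^ 2 - 2 * (F (y x) - F a)) 0 x := fun x => by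
    have h1 := ((o.hp x).fun_pow 2).fun_sub
      ((((hF (y x)).hasDerivAt.comp x (o.hy x)).sub_const (F a)).const_mul 2)
    refine h1.congr_deriv ?_
    norm_num
    ring
  have := is_const_of_deriv_eq_zero (fun x => (hd x).differentiableAt) (fun x => (hd x).deriv) x 0
  simp only [o.y_zero, o.p_zero] at this
  linarith

lemma abs_lt_one (o : IsOrbit F a y p) (hF : Differentiable ℝ F) (h1 : F 1 = 0) (h2 : F (-1) = 0)
    (ha : |a| < 1) (h3 : 0 < F a) (x : ℝ) : |y x| < 1 := by
  by_contra! hx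
  have hc : ContinuousOn (fun x => |y x|) (uIcc 0 x) := o.continuous_y.abs.continuousOn
  obtain ⟨z, -, hz⟩ := intermediate_value_uIcc hc (show (1 : ℝ) ∈ uIcc |y 0| |y x| by
    rw [o.y_zero]; exact mem_uIcc.2 (Or.inl ⟨ha.le, hx⟩))
  have := o.energy hF z
  have h4 : F (y z) = 0 := by
    rcases abs_eq (zero_le_one' ℝ) |>.1 hz with h | h <;> simp [h, h1, h2]
  nlinarith [sq_nonneg (p z)]

lemma unique (hF : ContDiff ℝ 3 F) (o : IsOrbit F a y p) {z q : ℝ → ℝ} (o' : IsOrbit F a z q) :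
    y = z :=
  second_order_unique ((contDiff_three_derivs hF).2.1.of_le (by norm_num))
    o.hy o.hp o'.hy o'.hp (o.y_zero.trans o'.y_zero.symm) (o.p_zero.trans o'.p_zero.symm)

lemma reflect (o : IsOrbit F a y p) : IsOrbit F a (fun x => y (-x)) (fun x => -p (-x)) where
  y_zero := by simp [o.y_zero]
  p_zero := by simp [o.p_zero]
  hy x := ((o.hy (-x)).comp x (hasDerivAt_neg x)).congr_deriv (by simp)
  hp x := ((o.hp (-x)).comp x (hasDerivAt_neg x)).neg.congr_deriv (by simp)

lemma even (o : IsOrbit F a y p) (hF : ContDiff ℝ 3 F) (x : ℝ) : y (-x) = y x :=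
  congrFun (o.reflect.unique hF o) x

variable {K δ m c a₀ : ℝ}

lemma abs_y_lt (o : IsOrbit F a y p) (hF : ContDiff ℝ 3 F) (hw : IsDoubleWell F)
    (W : WellConst F K δ m c a₀) (ha : a ∈ Ico a₀ 1) (x : ℝ) : |y x| < 1 := by
  have ha' : |a| < 1 := by rw [abs_of_pos (W.pos_of_mem ha)]; exact ha.2
  exact o.abs_lt_one (hF.differentiable (by norm_num)) hw.val_one hw.val_neg_one ha'
    (hw.pos_of_abs_lt ha') x

lemma le_amp (o : IsOrbit F a y p) (hF : ContDiff ℝ 3 F) (hw : IsDoubleWell F)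
    (W : WellConst F K δ m c a₀) (ha : a ∈ Ico a₀ 1) (x : ℝ) : y x ≤ a := by
  by_contra! h
  have h1 := (abs_lt.1 (o.abs_y_lt hF hw W ha x)).2
  have h2 := W.lt_a₀
  have := W.strictAntiOn hF hw ⟨by linarith [ha.1], ha.2.le⟩ ⟨by linarith [ha.1], h1.le⟩ h
  have := o.energy (hF.differentiable (by norm_num)) x
  nlinarith [sq_nonneg (p x)]

lemma eq_amp_of_p_eq_zero (o : IsOrbit F a y p) (hF : ContDiff ℝ 3 F) (hw : IsDoubleWell F)
    (W : WellConst F K δ m c a₀) (ha : a ∈ Ico a₀ 1) {x : ℝ} (hx : 0 ≤ y x) (hp : p x = 0) :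
    y x = a := by
  by_contra h
  have := W.lt_of_lt_amp hF hw ha hx (lt_of_le_of_ne (o.le_amp hF hw W ha x) h)
  have := o.energy (hF.differentiable (by norm_num)) x
  rw [hp] at this
  linarith

lemma p_ne_zero (o : IsOrbit F a y p) (hF : ContDiff ℝ 3 F) (hw : IsDoubleWell F)
    (W : WellConst F K δ m c a₀) (ha : a ∈ Ico a₀ 1) {x : ℝ} (hx : 0 < x)
    (hy : ∀ s ∈ Icc 0 x, 0 ≤ y s) : p x ≠ 0 := by
  intro hpx
  obtain ⟨s, hs, hmin⟩ := (isCompact_Icc (a := 0) (b := x)).exists_isMinOn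
    ⟨0, by constructor <;> linarith⟩ o.continuous_y.continuousOn
  have hsa : y s = a := by
    rcases eq_or_lt_of_le hs.1 with h | h
    · rw [← h, o.y_zero]
    rcases eq_or_lt_of_le hs.2 with h' | h'
    · rw [h']; exact o.eq_amp_of_p_eq_zero hF hw W ha (hy x ⟨hx.le, le_rfl⟩) hpx
    · have : IsLocalMin y s := hmin.isLocalMin (Icc_mem_nhds h h')
      exact o.eq_amp_of_p_eq_zero hF hw W ha (hy s hs) (this.hasDerivAt_eq_zero (o.hy s))
  have hya : ∀ t ∈ Icc 0 x, y t = a := fun t ht =>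
    le_antisymm (o.le_amp hF hw W ha t) (hsa ▸ hmin ht)
  have hp0 : p =ᶠ[nhds (x / 2)] fun _ => 0 := by
    filter_upwards [Icc_mem_nhds (by linarith : 0 < x / 2) (by linarith : x / 2 < x)] with t ht
    have := o.energy (hF.differentiable (by norm_num)) t
    rw [hya t ht] at this
    exact pow_eq_zero_iff two_ne_zero |>.1 (by linarith)
  have h1 := (o.hp (x / 2)).unique ((hasDerivAt_const (x / 2) (0 : ℝ)).congr_of_eventuallyEq hp0)
  rw [hya _ ⟨by linarith, by linarith⟩] at h1
  have h2 := W.deriv_le hF hw (s := a) ⟨by linarith [W.lt_a₀, ha.1], ha.2.le⟩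
  have : 0 < m * (1 - a) := mul_pos W.m_pos (by linarith [ha.2])
  linarith

lemma p_neg (o : IsOrbit F a y p) (hF : ContDiff ℝ 3 F) (hw : IsDoubleWell F)
    (W : WellConst F K δ m c a₀) (ha : a ∈ Ico a₀ 1) {x : ℝ} (hx : 0 < x)
    (hy : ∀ s ∈ Icc 0 x, 0 ≤ y s) : p x < 0 := by
  by_contra! h
  have hpos : ∀ t ∈ Ioo 0 x, 0 < p t := by
    intro t ht
    by_contra! h'
    obtain ⟨z, hz, hz0⟩ := intermediate_value_Icc ht.2.le o.continuous_p.continuousOn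
      (show (0 : ℝ) ∈ Icc (p t) (p x) from ⟨h', h⟩)
    exact o.p_ne_zero hF hw W ha (ht.1.trans_le hz.1)
      (fun s hs => hy s ⟨hs.1, hs.2.trans hz.2⟩) hz0
  have := strictMonoOn_of_deriv_pos (convex_Icc 0 x) o.continuous_y.continuousOn (fun t ht => by
    rw [(o.hy t).deriv]; rw [interior_Icc] at ht; exact hpos t ht)
    (left_mem_Icc.2 hx.le) (right_mem_Icc.2 hx.le) hx
  rw [o.y_zero] at this
  exact absurd (o.le_amp hF hw W ha x) (not_le.2 this)

lemma exists_zero (o : IsOrbit F a y p) (hF : ContDiff ℝ 3 F) (hw : IsDoubleWell F)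
    (W : WellConst F K δ m c a₀) (ha : a ∈ Ico a₀ 1) : ∃ x, 0 ≤ x ∧ y x = 0 := by
  by_contra! hne
  have ha0 := W.pos_of_mem ha
  have hpos : ∀ x, 0 ≤ x → 0 < y x := by
    intro x hx
    by_contra! h
    obtain ⟨z, hz, hz0⟩ := intermediate_value_Icc' hx o.continuous_y.continuousOn
      (show (0 : ℝ) ∈ Icc (y x) (y 0) from ⟨h, by rw [o.y_zero]; exact ha0.le⟩)
    exact hne z hz.1 hz0
  have hneg : ∀ x, 0 < x → p x < 0 := fun x hx =>
    o.p_neg hF hw W ha hx fun s hs => (hpos s hs.1).le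
  have hanti : StrictAntiOn y (Ici 0) :=
    strictAntiOn_of_deriv_neg (convex_Ici 0) o.continuous_y.continuousOn (fun t ht => by
      rw [(o.hy t).deriv]; rw [interior_Ici] at ht; exact hneg t ht)
  have h1a : y 1 < a := by
    rw [← o.y_zero]; exact hanti (by simp) (by simp) one_pos
  have d0 : Differentiable ℝ F := hF.differentiable (by norm_num)
  obtain ⟨s₀, hs₀, hmin⟩ := (isCompact_Icc (a := (0 : ℝ)) (b := y 1)).exists_isMinOn
    ⟨0, by constructor <;> linarith [hpos 1 zero_le_one]⟩ d0.continuous.continuousOn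
  set κ := 2 * (F s₀ - F a)
  have hκ : 0 < κ := by
    have := W.lt_of_lt_amp hF hw ha hs₀.1 (hs₀.2.trans_lt h1a)
    simp only [κ]; linarith
  have hp1 : ∀ x ∈ Ici (1 : ℝ), p x ≤ -√κ := by
    intro x hx
    have hx' : (1 : ℝ) ≤ x := hx
    have h2 : y x ≤ y 1 := hanti.antitoneOn (by simp) (by simp; linarith) hx'
    have h3 : F s₀ ≤ F (y x) := hmin ⟨(hpos x (by linarith)).le, h2⟩
    have h4 := o.energy d0 x
    have h5 : √κ ≤ |p x| := Real.sqrt_le_iff.2 ⟨abs_nonneg _, by rw [sq_abs, h4]; simp only [κ]; linarith⟩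
    rw [abs_of_neg (hneg x (by linarith))] at h5
    linarith
  set X := 1 + y 1 / √κ
  have hsq : 0 < √κ := Real.sqrt_pos.2 hκ
  have hX : 1 ≤ X := by
    have := div_pos (hpos 1 zero_le_one) hsq
    simp only [X]; linarith
  have := (convex_Ici (1 : ℝ)).image_sub_le_mul_sub_of_deriv_le (f := y) (C := -√κ)
    o.continuous_y.continuousOn (fun x _ => (o.hy x).differentiableAt.differentiableWithinAt)
    (fun x hx => by rw [(o.hy x).deriv]; exact hp1 x (interior_subset hx)) 1 (by simp) X hX hX
  have h6 : √κ * (X - 1) = y 1 := by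
    simp only [X]; field_simp; ring
  have := hpos X (by linarith)
  linarith

/-- The first zero `τ` of an orbit; the orbit decreases on `[0, τ]`. -/
lemma exists_first_zero (o : IsOrbit F a y p) (hF : ContDiff ℝ 3 F) (hw : IsDoubleWell F)
    (W : WellConst F K δ m c a₀) (ha : a ∈ Ico a₀ 1) :
    ∃ τ, 0 < τ ∧ y τ = 0 ∧ (∀ x ∈ Ico 0 τ, 0 < y x) ∧ ∀ x ∈ Ioc 0 τ, p x < 0 := by
  have ha0 := W.pos_of_mem ha
  set S := {x | 0 ≤ x ∧ y x = 0}
  have hS : IsClosed S := isClosed_Ici.inter (isClosed_eq o.continuous_y continuous_const)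
  have hbdd : BddBelow S := ⟨0, fun x hx => hx.1⟩
  have hmem : sInf S ∈ S := hS.csInf_mem (o.exists_zero hF hw W ha) hbdd
  have h0 : 0 < sInf S := by
    refine lt_of_le_of_ne hmem.1 fun h => ?_
    have := hmem.2
    rw [← h, o.y_zero] at this
    exact ha0.ne' this
  have hpos : ∀ x ∈ Ico 0 (sInf S), 0 < y x := by
    intro x hx
    by_contra! h
    obtain ⟨z, hz, hz0⟩ := intermediate_value_Icc' hx.1 o.continuous_y.continuousOn
      (show (0 : ℝ) ∈ Icc (y x) (y 0) from ⟨h, by rw [o.y_zero]; exact ha0.le⟩)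
    exact absurd (csInf_le hbdd (show z ∈ S from ⟨hz.1, hz0⟩)) (not_le.2 (hz.2.trans_lt hx.2))
  refine ⟨sInf S, h0, hmem.2, hpos, fun x hx => o.p_neg hF hw W ha hx.1 fun s hs => ?_⟩
  rcases eq_or_lt_of_le (hs.2.trans hx.2) with h | h
  · rw [h, hmem.2]
  · exact (hpos s ⟨hs.1, h⟩).le

end IsOrbit

/-! ### Estimates along one orbit -/

/-- An orbit `y` of amplitude `a` near `1` with derivative `p`, its first zero `τ`, and the
solution `M` (with derivative `R`) of the linearized equation with `M 0 = 1`, `M' 0 = 0`; this is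
the derivative of the orbit with respect to `a`. -/
structure HalfOrbit (F : ℝ → ℝ) (K δ m c a₀ a : ℝ) (y p M R : ℝ → ℝ) (τ : ℝ) : Prop where
  hF : ContDiff ℝ 3 F
  hw : IsDoubleWell F
  W : WellConst F K δ m c a₀
  ha : a ∈ Ico a₀ 1
  o : IsOrbit F a y p
  M_zero : M 0 = 1
  R_zero : R 0 = 0
  hM : ∀ x, HasDerivAt M (R x) x
  hR : ∀ x, HasDerivAt R (deriv (deriv F) (y x) * M x) x
  τ_pos : 0 < τ
  y_τ : y τ = 0
  y_pos : ∀ x ∈ Ico 0 τ, 0 < y x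
  p_neg : ∀ x ∈ Ioc 0 τ, p x < 0

/-- Subtracting `t` under a square root changes it by at most `√t`; also for negative arguments,
where the root is `0`. -/
lemma abs_sqrt_sub_sqrt_sub_le {s t : ℝ} (ht : 0 ≤ t) : |√s - √(s - t)| ≤ √t := by
  have h1 : √(s - t) ≤ √s := Real.sqrt_le_sqrt (by linarith)
  rw [abs_of_nonneg (by linarith)]
  have h2 : √s ≤ √(s - t) + √t := by
    refine (Real.sqrt_le_sqrt (show s ≤ max (s - t) 0 + t by
      have := le_max_left (s - t) 0; linarith)).trans ?_
    refine (Real.sqrt_le_iff.2 ⟨by positivity, ?_⟩ : _ ≤ √(max (s - t) 0) + √t).trans ?_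
    · have h3 := Real.sq_sqrt (le_max_right (s - t) 0)
      have h4 := Real.sq_sqrt ht
      have := mul_nonneg (Real.sqrt_nonneg (max (s - t) 0)) (Real.sqrt_nonneg t)
      linarith [add_sq (√(max (s - t) 0)) (√t)]
    have : √(max (s - t) 0) = √(s - t) := by
      rcases le_total 0 (s - t) with h | h
      · rw [max_eq_left h]
      · rw [max_eq_right h, Real.sqrt_zero, Real.sqrt_eq_zero_of_nonpos h]
    rw [this]
  linarith

namespace HalfOrbit

variable {F : ℝ → ℝ} {K δ m c a₀ a : ℝ} {y p M R : ℝ → ℝ} {τ : ℝ}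

lemma p_nonpos (H : HalfOrbit F K δ m c a₀ a y p M R τ) {x : ℝ} (hx : x ∈ Icc 0 τ) : p x ≤ 0 := by
  rcases eq_or_lt_of_le hx.1 with h | h
  · rw [← h, H.o.p_zero]
  · exact (H.p_neg x ⟨h, hx.2⟩).le

lemma strictAntiOn (H : HalfOrbit F K δ m c a₀ a y p M R τ) : StrictAntiOn y (Icc 0 τ) :=
  strictAntiOn_of_deriv_neg (convex_Icc _ _) H.o.continuous_y.continuousOn fun t ht => by
    rw [(H.o.hy t).deriv]; rw [interior_Icc] at ht; exact H.p_neg t (Ioo_subset_Ioc_self ht)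

lemma y_mem (H : HalfOrbit F K δ m c a₀ a y p M R τ) (x : ℝ) : y x ∈ Icc (-1) 1 :=
  abs_le.1 (H.o.abs_y_lt H.hF H.hw H.W H.ha x).le

lemma beta_pos (H : HalfOrbit F K δ m c a₀ a y p M R τ) : 0 < 1 - a := by linarith [H.ha.2]

lemma K_pos (H : HalfOrbit F K δ m c a₀ a y p M R τ) : 0 < K := by linarith [H.W.one_le_K]

lemma F_le (H : HalfOrbit F K δ m c a₀ a y p M R τ) {s : ℝ} (hs : s ∈ Icc (-1) 1) :
    F s ≤ 2 * K := by
  have := (convex_Icc (-1 : ℝ) 1).norm_image_sub_le_of_norm_deriv_le (f := F) (C := K)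
    (fun x _ => (contDiff_three_derivs H.hF).1 x) (fun x hx => H.W.bound1 x hx) (x := 1) (y := s)
    (by simp) hs
  rw [H.hw.val_one, sub_zero, Real.norm_eq_abs, Real.norm_eq_abs, abs_sub_comm,
    abs_of_nonneg (by linarith [hs.2] : 0 ≤ 1 - s)] at this
  have := (le_abs_self _).trans this
  nlinarith [H.K_pos, hs.1]

lemma F_amp_le (H : HalfOrbit F K δ m c a₀ a y p M R τ) : F a ≤ K * (1 - a) ^ 2 := by
  have ha := H.W.pos_of_mem H.ha
  have hb := H.beta_pos
  have := (convex_Icc a 1).norm_image_sub_le_of_norm_deriv_le (f := F) (C := K * (1 - a))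
    (fun x _ => (contDiff_three_derivs H.hF).1 x) (fun x hx => by
      refine (H.W.abs_deriv_le H.hF H.hw ⟨by linarith [hx.1], hx.2⟩).trans ?_
      have := H.K_pos
      gcongr
      exact hx.1) (x := 1) (y := a) ⟨by linarith, le_rfl⟩ ⟨le_rfl, by linarith⟩
  rw [H.hw.val_one, sub_zero, Real.norm_eq_abs, Real.norm_eq_abs, abs_sub_comm,
    abs_of_nonneg hb.le] at this
  have := (le_abs_self _).trans this
  linarith

lemma sqrt_F_amp_le (H : HalfOrbit F K δ m c a₀ a y p M R τ) : √(2 * F a) ≤ 2 * K * (1 - a) := by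
  have h1 := H.F_amp_le
  have h2 := H.W.one_le_K
  have h3 := H.beta_pos
  refine Real.sqrt_le_iff.2 ⟨by positivity, ?_⟩
  have : 0 ≤ (1 - a) ^ 2 := sq_nonneg _
  nlinarith [mul_nonneg (by nlinarith : 0 ≤ K ^ 2 - K) this]

lemma abs_p_le (H : HalfOrbit F K δ m c a₀ a y p M R τ) (x : ℝ) : |p x| ≤ 2 * K := by
  have h1 := H.o.energy (contDiff_three_derivs H.hF).1 x
  have h2 := H.F_le (H.y_mem x)
  have h3 := H.hw.nonneg a
  have h4 := H.W.one_le_K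
  exact abs_le_of_sq_le_sq (by nlinarith) (by linarith)

lemma neg_p_eq_sqrt (H : HalfOrbit F K δ m c a₀ a y p M R τ) {x : ℝ} (hx : x ∈ Icc 0 τ) :
    -p x = √(2 * F (y x) - 2 * F a) := by
  rw [← mul_sub, ← H.o.energy (contDiff_three_derivs H.hF).1 x, Real.sqrt_sq_eq_abs,
    abs_of_nonpos (H.p_nonpos hx)]

lemma slope_bound (H : HalfOrbit F K δ m c a₀ a y p M R τ) :
    |p τ + √(2 * F 0)| ≤ 2 * K * (1 - a) := by
  have h1 := H.neg_p_eq_sqrt (right_mem_Icc.2 H.τ_pos.le)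
  rw [H.y_τ] at h1
  have h2 := abs_sqrt_sub_sqrt_sub_le (s := 2 * F 0) (t := 2 * F a) (by linarith [H.hw.nonneg a])
  rw [← h1, sub_neg_eq_add, add_comm] at h2
  exact h2.trans H.sqrt_F_amp_le

/-- The distance to the well grows at most exponentially. -/
lemma growth (H : HalfOrbit F K δ m c a₀ a y p M R τ) (x : ℝ) :
    1 - y x ≤ (1 - a) * Real.exp (K * |x|) ∧ |p x| ≤ (1 - a) * Real.exp (K * |x|) := by
  have := second_order_gronwall (D := fun x => 1 - y x) (P := fun x => -p x)
    (Q := fun x => -deriv F (y x)) (c := 0) (b := x) (δ := 1 - a) H.W.one_le_K le_rfl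
    (fun x => (H.o.hy x).const_sub 1) (fun x => (H.o.hp x).neg)
    (by rw [H.o.y_zero, abs_of_pos H.beta_pos]) (by simp [H.o.p_zero, H.beta_pos.le])
    (fun s _ => by
      rw [abs_neg, add_zero, abs_of_nonneg (a := 1 - y s) (by linarith [(H.y_mem s).2])]
      exact H.W.abs_deriv_le H.hF H.hw (H.y_mem s))
  rw [abs_neg, add_zero, sub_zero] at this
  exact ⟨(le_abs_self _).trans this.1, this.2⟩

/-- The layer has width `O(1)`: between the level `1 - δ` and the zero, the slope is at
least `√c`. -/
lemma exists_entry (H : HalfOrbit F K δ m c a₀ a y p M R τ) :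
    ∃ x₁, 0 < x₁ ∧ x₁ < τ ∧ y x₁ = 1 - δ ∧ (∀ x ∈ Icc 0 x₁, y x ∈ Icc (1 - δ) a) ∧
      (∀ x ∈ Icc x₁ τ, p x ≤ -√c) ∧ √c * (τ - x₁) ≤ 1 := by
  have hW := H.W
  have ha := H.ha
  have hτ := H.τ_pos
  have hanti := H.strictAntiOn.antitoneOn
  obtain ⟨x₁, hx₁, hy₁⟩ := intermediate_value_Icc' hτ.le H.o.continuous_y.continuousOn
    (show 1 - δ ∈ Icc (y τ) (y 0) by
      rw [H.y_τ, H.o.y_zero]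
      exact ⟨by linarith [hW.δ_lt], by linarith [hW.lt_a₀, ha.1]⟩)
  have h0 : 0 < x₁ := by
    refine lt_of_le_of_ne hx₁.1 fun h => ?_
    rw [← h, H.o.y_zero] at hy₁
    linarith [hW.lt_a₀, ha.1]
  have h1 : x₁ < τ := by
    refine lt_of_le_of_ne hx₁.2 fun h => ?_
    rw [h, H.y_τ] at hy₁
    linarith [hW.δ_lt]
  have hp : ∀ x ∈ Icc x₁ τ, p x ≤ -√c := by
    intro x hx
    have hx' : x ∈ Icc 0 τ := ⟨h0.le.trans hx.1, hx.2⟩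
    have h2 : y x ≤ 1 - δ := hy₁ ▸ hanti hx₁ hx' hx.1
    have h3 : 0 ≤ y x := H.y_τ ▸ hanti hx' (right_mem_Icc.2 hτ.le) hx.2
    have h4 := hW.gap a ha (y x) ⟨h3, h2⟩
    have h5 := H.neg_p_eq_sqrt hx'
    rw [← mul_sub] at h5
    have := Real.sqrt_le_sqrt h4
    linarith
  refine ⟨x₁, h0, h1, hy₁, fun x hx => ⟨?_, H.o.le_amp H.hF H.hw hW ha x⟩, hp, ?_⟩
  · exact hy₁ ▸ hanti ⟨hx.1, hx.2.trans h1.le⟩ hx₁ hx.2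
  · have := (convex_Icc x₁ τ).image_sub_le_mul_sub_of_deriv_le (f := y) (C := -√c)
      H.o.continuous_y.continuousOn
      (fun x _ => (H.o.hy x).differentiableAt.differentiableWithinAt)
      (fun x hx => by rw [(H.o.hy x).deriv]; exact hp x (interior_subset hx))
      x₁ (left_mem_Icc.2 h1.le) τ (right_mem_Icc.2 h1.le) h1.le
    rw [H.y_τ, hy₁] at this
    linarith [hW.δ_pos]

/-- Quadratic approximation of `F'` at `1`, seen from `1` and from `s`. -/
lemma taylor_well (H : HalfOrbit F K δ m c a₀ a y p M R τ) {s : ℝ} (hs : s ∈ Icc (1 - δ) 1) :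
    deriv (deriv F) 1 * (1 - s) - K * (1 - s) ^ 2 ≤ -deriv F s ∧
      -(K * (1 - s) ^ 2) ≤ deriv F s + deriv (deriv F) s * (1 - s) := by
  have hsub : uIcc s 1 ⊆ Icc (-1) 1 := by
    rw [uIcc_of_le hs.2]
    exact Icc_subset_Icc (by linarith [hs.1, H.W.δ_lt]) le_rfl
  have d := (contDiff_three_derivs H.hF).2.2.1
  have h1 := abs_taylor_one_le (y := s) (z := 1) d
    (fun t ht => H.W.lip2 t (hsub (uIcc_comm s 1 ▸ ht)) 1 (hsub right_mem_uIcc)) H.K_pos.le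
  have h2 := abs_taylor_one_le (y := 1) (z := s) d
    (fun t ht => H.W.lip2 t (hsub ht) s (hsub left_mem_uIcc)) H.K_pos.le
  rw [H.hw.deriv_one, abs_le] at h1 h2
  constructor <;> nlinarith [h1.1, h1.2, h2.1, h2.2]

/-- The amplitude is exponentially close to `1`. With `v = 1 - y` and `A² = F''(1)`, the
function `(v' + A v) exp (κ v' - A x)` is nondecreasing while the orbit is in the well. -/
lemma beta_exp_le (H : HalfOrbit F K δ m c a₀ a y p M R τ) {A : ℝ} (hA : 0 < A)
    (hA2 : A ^ 2 = deriv (deriv F) 1) :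
    A * (1 - a) ≤ (2 * K + A) * Real.exp (K / (A * m) * (2 * K) + A / √c) * Real.exp (-(A * τ)) := by
  obtain ⟨x₁, h0, h1, hy₁, hwell, hp, hlen⟩ := H.exists_entry
  have hm := H.W.m_pos
  have hK := H.K_pos
  have hc := Real.sqrt_pos.2 H.W.c_pos
  set κ := K / (A * m) with hκ
  have hκ0 : 0 < κ := by positivity
  set G : ℝ → ℝ := fun x => (-p x + A * (1 - y x)) * Real.exp (κ * (-p x) - A * x)
  have hG : ∀ x, HasDerivAt G (Real.exp (κ * (-p x) - A * x) *
      (-deriv F (y x) - A ^ 2 * (1 - y x)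
        + κ * (-deriv F (y x)) * (-p x + A * (1 - y x)))) x := fun x => by
    have e1 := (H.o.hp x).fun_neg.fun_add (((H.o.hy x).const_sub 1).const_mul A)
    have e2 := (((H.o.hp x).fun_neg.const_mul κ).fun_sub ((hasDerivAt_id' x).const_mul A)).exp
    refine (e1.fun_mul e2).congr_deriv ?_
    ring
  have hmono : MonotoneOn G (Icc 0 x₁) := by
    refine monotoneOn_of_deriv_nonneg (convex_Icc _ _)
      (fun x _ => (hG x).continuousAt.continuousWithinAt)
      (fun x _ => (hG x).differentiableAt.differentiableWithinAt) fun x hx => ?_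
    have hx' := interior_subset hx
    rw [(hG x).deriv]
    refine mul_nonneg (Real.exp_pos _).le ?_
    have hys := hwell x hx'
    have hs : y x ∈ Icc (1 - δ) 1 := ⟨hys.1, hys.2.trans H.ha.2.le⟩
    have t1 := (H.taylor_well hs).1
    have t2 := H.W.deriv_le H.hF H.hw hs
    have t3 := H.p_nonpos ⟨hx'.1, hx'.2.trans h1.le⟩
    have hv : 0 ≤ 1 - y x := by linarith [hs.2]
    rw [← hA2] at t1
    have t4 : κ * (m * (1 - y x)) * (A * (1 - y x)) = K * (1 - y x) ^ 2 := by
      rw [hκ]; field_simp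
    have t5 : κ * (m * (1 - y x)) * (A * (1 - y x))
        ≤ κ * (-deriv F (y x)) * (-p x + A * (1 - y x)) := by
      gcongr
      · have := mul_nonneg hm.le hv
        exact mul_nonneg hκ0.le (by linarith)
      · linarith
      · linarith
    linarith
  have hG0 : G 0 = A * (1 - a) := by simp [G, H.o.p_zero, H.o.y_zero]
  have h3 := hmono (left_mem_Icc.2 h0.le) (right_mem_Icc.2 h0.le) h0.le
  rw [hG0] at h3
  refine h3.trans ?_
  have hpx : -p x₁ ≤ 2 * K := (neg_le_abs _).trans (H.abs_p_le x₁)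
  have hpx0 := H.p_nonpos ⟨h0.le, h1.le⟩
  have hτ : τ - x₁ ≤ 1 / √c := by rw [le_div_iff₀ hc]; linarith
  have hτ' : A * (τ - x₁) ≤ A * (1 / √c) := by gcongr
  have e1 : -p x₁ + A * (1 - y x₁) ≤ 2 * K + A := by
    rw [hy₁]; nlinarith [H.W.δ_lt]
  have e2 : κ * (-p x₁) ≤ κ * (2 * K) := by gcongr
  rw [mul_assoc, ← Real.exp_add]
  have e3 : κ * (-p x₁) - A * x₁ ≤ κ * (2 * K) + A / √c + -(A * τ) := by
    rw [mul_one_div] at hτ'; linarith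
  have e4 : 0 ≤ -p x₁ + A * (1 - y x₁) := by
    rw [hy₁]
    have := mul_pos hA H.W.δ_pos
    linarith
  simp only [G]
  gcongr

lemma linearized_ge_one (H : HalfOrbit F K δ m c a₀ a y p M R τ) {x₁ : ℝ}
    (hwell : ∀ x ∈ Icc 0 x₁, y x ∈ Icc (1 - δ) a) {x : ℝ} (hx : x ∈ Icc 0 x₁) :
    1 ≤ M x ∧ 0 ≤ R x := by
  have hx0 : 0 ≤ x₁ := hx.1.trans hx.2
  have cM : Continuous M := continuous_iff_continuousAt.2 fun t => (H.hM t).continuousAt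
  have d1 : ∀ x, HasDerivAt (fun x => M x * R x)
      (R x * R x + M x * (deriv (deriv F) (y x) * M x)) x := fun x => (H.hM x).fun_mul (H.hR x)
  have hMR : ∀ x ∈ Icc 0 x₁, 0 ≤ M x * R x := by
    have : MonotoneOn (fun x => M x * R x) (Icc 0 x₁) := by
      refine monotoneOn_of_deriv_nonneg (convex_Icc _ _)
        (fun x _ => (d1 x).continuousAt.continuousWithinAt)
        (fun x _ => (d1 x).differentiableAt.differentiableWithinAt) fun x hx => ?_
      rw [(d1 x).deriv]
      have hs := hwell x (interior_subset hx)
      have := H.W.conv (y x) ⟨hs.1, hs.2.trans H.ha.2.le⟩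
      have := H.W.m_pos
      have : 0 ≤ deriv (deriv F) (y x) * (M x * M x) :=
        mul_nonneg (by linarith) (mul_self_nonneg _)
      nlinarith [mul_self_nonneg (R x)]
    intro x hx
    have := this (left_mem_Icc.2 hx0) hx hx.1
    simpa [H.R_zero] using this
  have hM2 : ∀ x ∈ Icc 0 x₁, 1 ≤ M x ^ 2 := by
    have d2 : ∀ x, HasDerivAt (fun x => M x ^ 2) (2 * (M x * R x)) x := fun x =>
      ((H.hM x).fun_pow 2).congr_deriv (by norm_num; ring)
    have : MonotoneOn (fun x => M x ^ 2) (Icc 0 x₁) := by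
      refine monotoneOn_of_deriv_nonneg (convex_Icc _ _)
        (fun x _ => (d2 x).continuousAt.continuousWithinAt)
        (fun x _ => (d2 x).differentiableAt.differentiableWithinAt) fun x hx => ?_
      rw [(d2 x).deriv]
      linarith [hMR x (interior_subset hx)]
    intro x hx
    have := this (left_mem_Icc.2 hx0) hx hx.1
    simpa [H.M_zero] using this
  have hM1 : 1 ≤ M x := by
    by_contra! h
    have hneg : M x ≤ 0 := by nlinarith [hM2 x hx]
    obtain ⟨z, hz, hz0⟩ := intermediate_value_Icc' hx.1 cM.continuousOn
      (show (0 : ℝ) ∈ Icc (M x) (M 0) from ⟨hneg, by rw [H.M_zero]; norm_num⟩)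
    have := hM2 z ⟨hz.1, hz.2.trans hx.2⟩
    rw [hz0] at this
    norm_num at this
  exact ⟨hM1, nonneg_of_mul_nonneg_right (hMR x hx) (by linarith)⟩

/-- The derivative `M` of the orbit with respect to its amplitude reaches the order `1 / β` at
the exit from the well. With `v = 1 - y`, the function `(M / v) exp (κ v)` is nondecreasing
there. -/
lemma linearized_exit (H : HalfOrbit F K δ m c a₀ a y p M R τ) {x₁ : ℝ} (h0 : 0 < x₁)
    (h1 : x₁ < τ) (hy₁ : y x₁ = 1 - δ) (hwell : ∀ x ∈ Icc 0 x₁, y x ∈ Icc (1 - δ) a) :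
    δ * Real.exp (-(K / m)) ≤ M x₁ * (1 - a) := by
  have hm := H.W.m_pos
  have hK := H.K_pos
  have hδ := H.W.δ_pos
  set κ := K / m with hκ
  have hκ0 : 0 < κ := by positivity
  set J : ℝ → ℝ := fun x => R x * (1 - y x) + M x * p x + κ * (M x * (1 - y x) * (-p x))
  have hJ : ∀ x, HasDerivAt J (M x * (deriv F (y x) + deriv (deriv F) (y x) * (1 - y x))
      + κ * (R x * (1 - y x) * (-p x) + M x * p x ^ 2 + M x * (1 - y x) * (-deriv F (y x)))) x :=
    fun x => by
      have v := (H.o.hy x).const_sub 1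
      have e := (((H.hR x).fun_mul v).fun_add ((H.hM x).fun_mul (H.o.hp x))).fun_add
        ((((H.hM x).fun_mul v).fun_mul (H.o.hp x).fun_neg).const_mul κ)
      refine e.congr_deriv ?_
      ring
  have facts : ∀ x ∈ Icc 0 x₁, 1 ≤ M x ∧ 0 ≤ R x ∧ 0 < 1 - y x ∧ p x ≤ 0 ∧
      y x ∈ Icc (1 - δ) 1 := fun x hx => by
    obtain ⟨f1, f2⟩ := H.linearized_ge_one hwell hx
    have f3 := hwell x hx
    have f4 := H.ha.2
    exact ⟨f1, f2, by linarith [f3.2], H.p_nonpos ⟨hx.1, hx.2.trans h1.le⟩, f3.1,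
      f3.2.trans f4.le⟩
  have hJmono : MonotoneOn J (Icc 0 x₁) := by
    refine monotoneOn_of_deriv_nonneg (convex_Icc _ _)
      (fun x _ => (hJ x).continuousAt.continuousWithinAt)
      (fun x _ => (hJ x).differentiableAt.differentiableWithinAt) fun x hx => ?_
    rw [(hJ x).deriv]
    obtain ⟨f1, f2, f3, f4, f5⟩ := facts x (interior_subset hx)
    have t1 := (H.taylor_well f5).2
    have t2 := H.W.deriv_le H.hF H.hw f5
    have t3 : κ * (M x * (1 - y x) * (m * (1 - y x))) = M x * (K * (1 - y x) ^ 2) := by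
      rw [hκ]; field_simp
    have t4 : M x * (1 - y x) * (m * (1 - y x)) ≤ M x * (1 - y x) * (-deriv F (y x)) := by
      have : 0 ≤ M x * (1 - y x) := mul_nonneg (by linarith) f3.le
      gcongr; linarith
    have t5 : M x * (-(K * (1 - y x) ^ 2))
        ≤ M x * (deriv F (y x) + deriv (deriv F) (y x) * (1 - y x)) := by gcongr
    have t6 : 0 ≤ R x * (1 - y x) * (-p x) := mul_nonneg (mul_nonneg f2 f3.le) (by linarith)
    have t7 : 0 ≤ M x * p x ^ 2 := mul_nonneg (by linarith) (sq_nonneg _)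
    have t8 : κ * (M x * (1 - y x) * (m * (1 - y x))) ≤ κ * (R x * (1 - y x) * (-p x)
        + M x * p x ^ 2 + M x * (1 - y x) * (-deriv F (y x))) := by gcongr; linarith
    linarith
  have hJ0 : ∀ x ∈ Icc 0 x₁, 0 ≤ J x := fun x hx => by
    have := hJmono (left_mem_Icc.2 h0.le) hx hx.1
    simpa [J, H.R_zero, H.o.p_zero] using this
  set G : ℝ → ℝ := fun x => M x / (1 - y x) * Real.exp (κ * (1 - y x))
  have hG : ∀ x ∈ Icc 0 x₁, HasDerivAt G (Real.exp (κ * (1 - y x)) / (1 - y x) ^ 2 * J x) x :=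
    fun x hx => by
      have hv := (facts x hx).2.2.1.ne'
      have v := (H.o.hy x).const_sub 1
      have e := ((H.hM x).fun_div v hv).fun_mul (v.const_mul κ).exp
      refine e.congr_deriv ?_
      simp only [J]
      field_simp
      ring
  have hGmono : MonotoneOn G (Icc 0 x₁) := by
    refine monotoneOn_of_deriv_nonneg (convex_Icc _ _)
      (fun x hx => (hG x hx).continuousAt.continuousWithinAt)
      (fun x hx => (hG x (interior_subset hx)).differentiableAt.differentiableWithinAt)
      fun x hx => ?_
    rw [(hG x (interior_subset hx)).deriv]
    have := hJ0 x (interior_subset hx)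
    positivity
  have h3 := hGmono (left_mem_Icc.2 h0.le) (right_mem_Icc.2 h0.le) h0.le
  simp only [G, H.M_zero, H.o.y_zero, hy₁, sub_sub_cancel] at h3
  have hb := H.beta_pos
  have e1 : 1 ≤ Real.exp (κ * (1 - a)) := Real.one_le_exp (by positivity)
  have e2 : Real.exp (κ * δ) ≤ Real.exp κ := by
    gcongr; exact mul_le_of_le_one_right hκ0.le H.W.δ_lt.le
  have hM1 := (facts x₁ (right_mem_Icc.2 h0.le)).1
  have h4 : 1 / (1 - a) ≤ M x₁ / δ * Real.exp κ := by
    calc 1 / (1 - a) ≤ 1 / (1 - a) * Real.exp (κ * (1 - a)) := le_mul_of_one_le_right (by positivity) e1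
      _ ≤ M x₁ / δ * Real.exp (κ * δ) := h3
      _ ≤ _ := by gcongr
  rw [div_le_iff₀ hb] at h4
  rw [Real.exp_neg, ← div_eq_mul_inv, div_le_iff₀ (Real.exp_pos _)]
  have h5 := mul_le_mul_of_nonneg_left h4 hδ.le
  calc δ = δ * 1 := by ring
    _ ≤ δ * (M x₁ / δ * Real.exp κ * (1 - a)) := h5
    _ = _ := by field_simp

lemma wronskian (H : HalfOrbit F K δ m c a₀ a y p M R τ) (x : ℝ) :
    M x * deriv F (y x) - R x * p x = deriv F a := by
  have d := (contDiff_three_derivs H.hF).2.2.1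
  have hd : ∀ x, HasDerivAt (fun x => M x * deriv F (y x) - R x * p x) 0 x := fun x => by
    have h1 := ((H.hM x).fun_mul ((d (y x)).hasDerivAt.comp x (H.o.hy x))).fun_sub
      ((H.hR x).fun_mul (H.o.hp x))
    refine h1.congr_deriv ?_
    simp only [Function.comp]
    ring
  have := is_const_of_deriv_eq_zero (fun x => (hd x).differentiableAt) (fun x => (hd x).deriv) x 0
  simpa [H.M_zero, H.R_zero, H.o.y_zero] using this

/-- The derivative `-M τ / p τ` of the zero with respect to the amplitude is at least of
order `1 / β`. -/
lemma deriv_zero_ge (H : HalfOrbit F K δ m c a₀ a y p M R τ)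
    (hβ : (1 - a) ^ 2 ≤ δ * Real.exp (-(K / m)) * (c * √c) / (4 * K ^ 2)) :
    δ * Real.exp (-(K / m)) / (4 * K) ≤ M τ / (-p τ) * (1 - a) := by
  obtain ⟨x₁, h0, h1, hy₁, hwell, hp, hlen⟩ := H.exists_entry
  have hexit := H.linearized_exit h0 h1 hy₁ hwell
  have hK := H.K_pos
  have hc0 := H.W.c_pos
  have hc := Real.sqrt_pos.2 H.W.c_pos
  have hb := H.beta_pos
  have hδ := H.W.δ_pos
  set κ := δ * Real.exp (-(K / m))
  have hpne : ∀ x ∈ Icc x₁ τ, p x < 0 := fun x hx => by linarith [hp x hx]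
  have hd : ∀ x ∈ Icc x₁ τ, HasDerivAt (fun x => M x / (-p x)) (deriv F a / p x ^ 2) x :=
    fun x hx => by
      have hne : -p x ≠ 0 := by linarith [hpne x hx]
      have := (H.hM x).fun_div (H.o.hp x).fun_neg hne
      refine this.congr_deriv ?_
      rw [← H.wronskian x]
      have := (hpne x hx).ne
      field_simp
      ring
  have h3 := (convex_Icc x₁ τ).mul_sub_le_image_sub_of_le_deriv (f := fun x => M x / (-p x))
    (C := -(K * (1 - a) / c)) (fun x hx => (hd x hx).continuousAt.continuousWithinAt)
    (fun x hx => (hd x (interior_subset hx)).differentiableAt.differentiableWithinAt)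
    (fun x hx => by
      rw [(hd x (interior_subset hx)).deriv]
      have h2 := hp x (interior_subset hx)
      have hsq : c ≤ p x ^ 2 := by
        have := Real.sq_sqrt hc0.le
        nlinarith
      have ha0 := H.W.pos_of_mem H.ha
      have h4 := H.W.abs_deriv_le H.hF H.hw (s := a) ⟨by linarith, by linarith⟩
      rw [← neg_div]
      have hpos : 0 < p x ^ 2 := by linarith
      rw [div_le_div_iff₀ hc0 hpos]
      have h5 := (abs_le.1 h4).1
      have h6 : 0 ≤ K * (1 - a) := by positivity
      nlinarith) x₁ (left_mem_Icc.2 h1.le) τ (right_mem_Icc.2 h1.le) h1.le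
  have hpx₁ : -p x₁ ≤ 2 * K := (neg_le_abs _).trans (H.abs_p_le x₁)
  have hpx₁' : 0 < -p x₁ := by linarith [hpne x₁ (left_mem_Icc.2 h1.le)]
  have h4 : κ / (2 * K) ≤ M x₁ / (-p x₁) * (1 - a) := by
    rw [div_mul_eq_mul_div]
    have : 0 ≤ M x₁ * (1 - a) := le_trans (by positivity) hexit
    gcongr
  have h5 : K * (1 - a) / c * (τ - x₁) * (1 - a) ≤ κ / (4 * K) := by
    have e1 : τ - x₁ ≤ 1 / √c := by rw [le_div_iff₀ hc]; linarith
    calc K * (1 - a) / c * (τ - x₁) * (1 - a) ≤ K * (1 - a) / c * (1 / √c) * (1 - a) := by gcongr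
      _ = K / (c * √c) * (1 - a) ^ 2 := by field_simp
      _ ≤ K / (c * √c) * (κ * (c * √c) / (4 * K ^ 2)) := by gcongr
      _ = κ / (4 * K) := by field_simp
  have h6 : κ / (2 * K) = κ / (4 * K) + κ / (4 * K) := by field_simp; norm_num; ring
  have h7 : -(K * (1 - a) / c) * (τ - x₁) * (1 - a)
      ≤ (M τ / (-p τ) - M x₁ / (-p x₁)) * (1 - a) := by gcongr
  linarith

/-- The function `w = α M + p / 2`, where `α` is chosen so that `w` vanishes at `τ`, is bounded by
a multiple of `α` on `[0, τ + 1]`. It solves the linearized equation, with `w 0 = α`; near `τ` it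
is controlled by its slope there, and in the well `w²` is convex. -/
lemma abs_w_le (H : HalfOrbit F K δ m c a₀ a y p M R τ) {α : ℝ} (hα : 0 < α)
    (hατ : α * M τ + p τ / 2 = 0) {x : ℝ} (hx : x ∈ Icc 0 (τ + 1)) :
    |α * M x + p x / 2| ≤ (1 + K / √c * Real.exp (K * (1 + 1 / √c))) * α := by
  obtain ⟨x₁, h0, h1, hy₁, hwell, hp, hlen⟩ := H.exists_entry
  have hK := H.K_pos
  have hc := Real.sqrt_pos.2 H.W.c_pos
  have hb := H.beta_pos
  set w : ℝ → ℝ := fun x => α * M x + p x / 2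
  set w' : ℝ → ℝ := fun x => α * R x + deriv F (y x) / 2
  have d := (contDiff_three_derivs H.hF).2.2.1
  have hw : ∀ x, HasDerivAt w (w' x) x := fun x =>
    ((H.hM x).const_mul α).fun_add ((H.o.hp x).div_const 2)
  have hw' : ∀ x, HasDerivAt w' (deriv (deriv F) (y x) * w x) x := fun x => by
    have := ((H.hR x).const_mul α).fun_add
      (((d (y x)).hasDerivAt.comp x (H.o.hy x)).div_const 2)
    refine this.congr_deriv ?_
    simp only [w]; ring
  set B := K / √c * Real.exp (K * (1 + 1 / √c)) * α
  have hB : 0 ≤ B := by positivity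
  have hslope : |w' τ| ≤ K / √c * α := by
    have e1 := H.wronskian τ
    have hpτ := hp τ (right_mem_Icc.2 h1.le)
    have e2 : w' τ * (-p τ) = α * deriv F a := by
      simp only [w']; rw [← e1]
      linear_combination -(deriv F (y τ)) * hατ
    have ha0 := H.W.pos_of_mem H.ha
    have e3 := H.W.bound1 a ⟨by linarith, by linarith⟩
    have e4 : |w' τ| * (-p τ) = α * |deriv F a| := by
      rw [← abs_of_pos (show 0 < -p τ by linarith), ← abs_mul, e2, abs_mul, abs_of_pos hα]
    rw [div_mul_eq_mul_div, le_div_iff₀ hc]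
    calc |w' τ| * √c ≤ |w' τ| * (-p τ) := by gcongr; linarith
      _ = α * |deriv F a| := e4
      _ ≤ α * K := by gcongr
      _ = K * α := by ring
  have hτ : τ - x₁ ≤ 1 / √c := by rw [le_div_iff₀ hc]; linarith
  have hnear : ∀ x, |x - τ| ≤ 1 + 1 / √c → |w x| ≤ B := by
    intro x hx
    have := (second_order_gronwall (c := τ) (b := x) (δ := K / √c * α) H.W.one_le_K le_rfl
      hw hw' (by simp only [w]; rw [hατ]; simp; positivity) hslope
      (fun s _ => by
        rw [abs_mul, add_zero]
        gcongr
        exact H.W.bound2 _ (H.y_mem s))).1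
    rw [add_zero] at this
    refine this.trans ?_
    simp only [B]
    calc K / √c * α * Real.exp (K * |x - τ|) ≤ K / √c * α * Real.exp (K * (1 + 1 / √c)) := by gcongr
      _ = _ := by ring
  have hgoal : (1 + K / √c * Real.exp (K * (1 + 1 / √c))) * α = α + B := by simp only [B]; ring
  change |w x| ≤ _
  rw [hgoal]
  rcases le_total x x₁ with hxx | hxx
  · have d2 : ∀ x, HasDerivAt (fun x => w x ^ 2) (2 * (w x * w' x)) x := fun x =>
      ((hw x).fun_pow 2).congr_deriv (by norm_num; ring)
    have d3 : ∀ x, HasDerivAt (fun x => 2 * (w x * w' x))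
        (2 * (w' x * w' x + w x * (deriv (deriv F) (y x) * w x))) x := fun x =>
      ((hw x).fun_mul (hw' x)).const_mul 2
    have hderiv : deriv (fun x => w x ^ 2) = fun x => 2 * (w x * w' x) :=
      funext fun x => (d2 x).deriv
    have hconv : ConvexOn ℝ (Icc 0 x₁) fun x => w x ^ 2 := by
      refine MonotoneOn.convexOn_of_deriv (convex_Icc _ _)
        (fun x _ => (d2 x).continuousAt.continuousWithinAt)
        (fun x _ => (d2 x).differentiableAt.differentiableWithinAt) ?_
      rw [hderiv]
      refine (monotoneOn_of_deriv_nonneg (convex_Icc _ _)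
        (fun x _ => (d3 x).continuousAt.continuousWithinAt)
        (fun x _ => (d3 x).differentiableAt.differentiableWithinAt) fun x hx => ?_).mono
        interior_subset
      rw [(d3 x).deriv]
      have hs := hwell x (interior_subset hx)
      have := H.W.conv (y x) ⟨hs.1, hs.2.trans H.ha.2.le⟩
      have := H.W.m_pos
      have : 0 ≤ deriv (deriv F) (y x) * (w x * w x) :=
        mul_nonneg (by linarith) (mul_self_nonneg _)
      nlinarith [mul_self_nonneg (w' x)]
    have h3 := hconv.le_max_of_mem_Icc (left_mem_Icc.2 h0.le) (right_mem_Icc.2 h0.le) ⟨hx.1, hxx⟩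
    have e1 : w 0 = α := by simp [w, H.M_zero, H.o.p_zero]
    have e2 : |w x₁| ≤ B := hnear x₁ (by
      rw [abs_sub_comm, abs_of_pos (by linarith)]; linarith)
    refine abs_le_of_sq_le_sq (h3.trans (max_le ?_ ?_)) (by positivity)
    · rw [e1]; gcongr; linarith
    · rw [← sq_abs]; gcongr; linarith
  · have : |w x| ≤ B := hnear x (by
      have : 0 < 1 / √c := by positivity
      rw [abs_le]; constructor <;> linarith [hx.2])
    linarith

/-- The energy identity turns `∫ g(y) y'²` into an integral over the range of the orbit. -/
lemma mass (H : HalfOrbit F K δ m c a₀ a y p M R τ) {g : ℝ → ℝ} (hg : Continuous g) {G : ℝ}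
    (hG : ∀ s ∈ Icc (-1) 1, |g s| ≤ G) :
    |(∫ x in (0 : ℝ)..τ, g (y x) * p x ^ 2) - ∫ s in (0 : ℝ)..1, √(2 * F s) * g s|
      ≤ 2 * K * G * (1 - a) := by
  have d0 := (contDiff_three_derivs H.hF).1
  have cF := d0.continuous
  have ha0 := H.W.pos_of_mem H.ha
  set h : ℝ → ℝ := fun s => g s * √(2 * F s - 2 * F a)
  have ch : Continuous h := by fun_prop
  have e1 : (∫ x in (0 : ℝ)..τ, g (y x) * p x ^ 2) = ∫ x in (0 : ℝ)..τ, -((h ∘ y) x * p x) := by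
    refine intervalIntegral.integral_congr fun x hx => ?_
    rw [uIcc_of_le H.τ_pos.le] at hx
    simp only [h, Function.comp, ← H.neg_p_eq_sqrt hx]
    ring
  have e2 : (∫ x in (0 : ℝ)..τ, (h ∘ y) x * p x) = ∫ s in a..0, h s := by
    have := intervalIntegral.integral_comp_mul_deriv (a := 0) (b := τ) (f := y) (f' := p) (g := h)
      (fun x _ => H.o.hy x) H.o.continuous_p.continuousOn ch
    rwa [H.o.y_zero, H.y_τ] at this
  have e3 : (∫ s in a..1, h s) = 0 := by
    rw [intervalIntegral.integral_congr (g := fun _ => 0), intervalIntegral.integral_zero]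
    intro s hs
    rw [uIcc_of_le H.ha.2.le] at hs
    have := (H.W.strictAntiOn H.hF H.hw).antitoneOn
      ⟨by linarith [H.W.lt_a₀, H.ha.1], H.ha.2.le⟩
      ⟨by linarith [H.W.lt_a₀, H.ha.1, hs.1], hs.2⟩ hs.1
    simp only [h]
    rw [Real.sqrt_eq_zero_of_nonpos (by linarith), mul_zero]
  have e4 : (∫ x in (0 : ℝ)..τ, g (y x) * p x ^ 2) = ∫ s in (0 : ℝ)..1, h s := by
    rw [e1, intervalIntegral.integral_neg, e2, ← intervalIntegral.integral_symm,
      ← intervalIntegral.integral_add_adjacent_intervals (ch.intervalIntegrable 0 a)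
        (ch.intervalIntegrable a 1), e3, add_zero]
  have ch2 : Continuous fun s => √(2 * F s) * g s := by fun_prop
  rw [e4, ← intervalIntegral.integral_sub (ch.intervalIntegrable 0 1) (ch2.intervalIntegrable 0 1)]
  have := intervalIntegral.norm_integral_le_of_norm_le_const (a := 0) (b := 1)
    (f := fun s => h s - √(2 * F s) * g s) (C := 2 * K * G * (1 - a)) (fun s hs => by
      rw [uIoc_of_le zero_le_one] at hs
      have f1 := abs_sqrt_sub_sqrt_sub_le (s := 2 * F s) (t := 2 * F a)
        (by linarith [H.hw.nonneg a])
      have f2 := hG s ⟨by linarith [hs.1], hs.2⟩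
      have f3 : h s - √(2 * F s) * g s = -(g s * (√(2 * F s) - √(2 * F s - 2 * F a))) := by
        simp only [h]; ring
      rw [f3, norm_neg, norm_mul, Real.norm_eq_abs, Real.norm_eq_abs]
      have f4 := f1.trans H.sqrt_F_amp_le
      calc |g s| * |√(2 * F s) - √(2 * F s - 2 * F a)| ≤ G * (2 * K * (1 - a)) := by
            gcongr
            exact (abs_nonneg _).trans f2
        _ = _ := by ring)
  simpa using this

end HalfOrbit

/-! ### The family of orbits and its first zero -/

/-- A family of orbits, with amplitudes `a ∈ [a₀, 1)`, differentiable in `(x, a)`. -/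
structure OrbitFamily (F : ℝ → ℝ) (K δ m c a₀ : ℝ) (Y P M R : ℝ → ℝ → ℝ) (τ : ℝ → ℝ) : Prop where
  half : ∀ a ∈ Ico a₀ 1, HalfOrbit F K δ m c a₀ a (Y a) (P a) (M a) (R a) (τ a)
  small : ∀ a ∈ Ico a₀ 1, (1 - a) ^ 2 ≤ δ * Real.exp (-(K / m)) * (c * √c) / (4 * K ^ 2)
  hasFDerivAt : ∀ a x, HasFDerivAt (fun z : ℝ × ℝ => Y z.2 z.1)
        (P a x • ContinuousLinearMap.fst ℝ ℝ ℝ + M a x • ContinuousLinearMap.snd ℝ ℝ ℝ) (x, a)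

/-- The equation is solved globally after `F` has been cut off outside `[-2, 2]`; orbits near the
well stay in `(-1, 1)`, where nothing has changed. -/
theorem exists_orbitFamily {F : ℝ → ℝ} (hF : ContDiff ℝ 3 F) (hw : IsDoubleWell F) :
    ∃ (K δ m c a₀ : ℝ) (Y P M R : ℝ → ℝ → ℝ) (τ : ℝ → ℝ), WellConst F K δ m c a₀ ∧
      OrbitFamily F K δ m c a₀ Y P M R τ := by
  obtain ⟨K, δ, m, c, a₁, W₁⟩ := hw.exists_wellConst hF
  have hK := W₁.one_le_K
  have hδ := W₁.δ_pos
  have hc := W₁.c_pos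
  have hsc := Real.sqrt_pos.2 hc
  set B := δ * Real.exp (-(K / m)) * (c * √c) / (4 * K ^ 2)
  have hB : 0 < B := by positivity
  set a₀ := max a₁ (1 - min 1 B)
  have hmin : 0 < min 1 B := lt_min one_pos hB
  have W : WellConst F K δ m c a₀ := W₁.mono (le_max_left _ _) (max_lt W₁.a₀_lt (by linarith))
  set b : ContDiffBump (0 : ℝ) := ⟨2, 3, by norm_num, by norm_num⟩
  set G : ℝ → ℝ := fun s => b s * F s with hG
  have cG : ContDiff ℝ 3 G := b.contDiff.mul hF
  have sG : HasCompactSupport G := b.hasCompactSupport.mul_right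
  have eG : EqOn G F (Ioo (-2) 2) := fun s hs => by
    have : b s = 1 := b.one_of_mem_closedBall (by
      rw [mem_closedBall_zero_iff, Real.norm_eq_abs]; exact (abs_lt.2 hs).le)
    simp [hG, this]
  have eG1 : EqOn (deriv G) (deriv F) (Ioo (-2) 2) := eG.deriv isOpen_Ioo
  have eG2 : EqOn (deriv (deriv G)) (deriv (deriv F)) (Ioo (-2) 2) := eG1.deriv isOpen_Ioo
  obtain ⟨Y, P, M, R, hY0, hP0, hY, hP, hM0, hR0, hM, hR, hd⟩ :=
    exists_flow (contDiff_three_derivs cG).2.1 sG.deriv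
  have hlt : ∀ a ∈ Ico a₀ 1, ∀ x, Y a x ∈ Ioo (-2 : ℝ) 2 := by
    intro a ha x
    have ha0 := W.pos_of_mem ha
    have ha' : |a| < 1 := by rw [abs_of_pos ha0]; exact ha.2
    have o : IsOrbit G a (Y a) (P a) := ⟨hY0 a, hP0 a, hY a, hP a⟩
    have := o.abs_lt_one (contDiff_three_derivs cG).1
      (by rw [eG ⟨by norm_num, by norm_num⟩, hw.val_one])
      (by rw [eG ⟨by norm_num, by norm_num⟩, hw.val_neg_one]) ha'
      (by rw [eG ⟨by linarith, by linarith [ha.2]⟩]; exact hw.pos_of_abs_lt ha') x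
    rw [abs_lt] at this
    constructor <;> linarith [this.1, this.2]
  have ho : ∀ a ∈ Ico a₀ 1, IsOrbit F a (Y a) (P a) := fun a ha =>
    ⟨hY0 a, hP0 a, hY a, fun x => by rw [← eG1 (hlt a ha x)]; exact hP a x⟩
  choose! τ hτ1 hτ2 hτ3 hτ4 using fun a ha => (ho a ha).exists_first_zero hF hw W ha
  refine ⟨K, δ, m, c, a₀, Y, P, M, R, τ, W, fun a ha => ⟨hF, hw, W, ha, ho a ha, hM0 a, hR0 a,
    hM a, fun x => by rw [← eG2 (hlt a ha x)]; exact hR a x, hτ1 a ha, hτ2 a ha, hτ3 a ha,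
    hτ4 a ha⟩, fun a ha => ?_, hd⟩
  have h1 : 1 - a ≤ min 1 B := by linarith [(le_max_right _ _).trans ha.1]
  have h2 : 0 ≤ 1 - a := by linarith [ha.2]
  calc (1 - a) ^ 2 = (1 - a) * (1 - a) := by ring
    _ ≤ 1 * B := by
      gcongr
      · exact h1.trans (min_le_left _ _)
      · exact h1.trans (min_le_right _ _)
    _ = B := one_mul B

/-- Derivative of an implicitly defined function that is known to be continuous. -/
lemma hasDerivAt_of_implicit {G : ℝ × ℝ → ℝ} {τ : ℝ → ℝ} {a u v : ℝ}
    (hG : HasFDerivAt G (u • ContinuousLinearMap.fst ℝ ℝ ℝ + v • ContinuousLinearMap.snd ℝ ℝ ℝ)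
      (τ a, a)) (hu : u ≠ 0) (hτ : ContinuousAt τ a) (h0 : ∀ᶠ b in nhds a, G (τ b, b) = 0) :
    HasDerivAt τ (-v / u) a := by
  rw [hasDerivAt_iff_isLittleO]
  have htend : Filter.Tendsto (fun b => (τ b, b)) (nhds a) (nhds (τ a, a)) :=
    hτ.prodMk continuousAt_id
  have h1 := (hasFDerivAt_iff_isLittleO_nhds_zero.1 hG)
  have h2 : (fun b => u * (τ b - τ a) + v * (b - a)) =o[nhds a]
      fun b => (τ b - τ a, b - a) := by
    have htend0 : Filter.Tendsto (fun b => (τ b, b) - (τ a, a)) (nhds a) (nhds 0) := by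
      have := htend.sub_const (τ a, a)
      simpa using this
    have h3 := (h1.comp_tendsto htend0).neg_left
    refine h3.congr' ?_ (Filter.Eventually.of_forall fun b => rfl)
    filter_upwards [h0] with b hb
    simp [hb, h0.self_of_nhds]
  have h3 : (fun b => τ b - τ a - (b - a) • (-v / u)) =o[nhds a]
      fun b => (τ b - τ a, b - a) := by
    refine (h2.const_mul_left u⁻¹).congr_left fun b => ?_
    rw [smul_eq_mul]
    field_simp
    ring
  have h4 : (fun b => (τ b - τ a, b - a)) =O[nhds a] fun b => b - a := by
    refine Asymptotics.IsBigO.prod_left ?_ (Asymptotics.isBigO_refl _ _)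
    have h5 : (fun b => τ b - τ a - (b - a) • (-v / u)) =o[nhds a]
        fun b => ‖τ b - τ a‖ + ‖b - a‖ :=
      h3.trans_isBigO (Asymptotics.IsBigO.of_bound 1 (Filter.Eventually.of_forall fun b => by
        rw [one_mul, Prod.norm_def,
          Real.norm_of_nonneg (add_nonneg (norm_nonneg (τ b - τ a)) (norm_nonneg (b - a)))]
        exact max_le_add_of_nonneg (norm_nonneg _) (norm_nonneg _)))
    have h6 := h5.bound (c := 1 / 2) (by norm_num)
    refine Asymptotics.IsBigO.of_bound (1 + 2 * ‖-v / u‖) ?_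
    filter_upwards [h6] with b hb
    rw [Real.norm_of_nonneg (add_nonneg (norm_nonneg (τ b - τ a)) (norm_nonneg (b - a)))] at hb
    have h7 : ‖τ b - τ a‖ ≤ ‖τ b - τ a - (b - a) • (-v / u)‖ + ‖(b - a) • (-v / u)‖ := by
      simpa using norm_add_le (τ b - τ a - (b - a) • (-v / u)) ((b - a) • (-v / u))
    rw [norm_smul] at h7
    linarith
  exact h3.trans_isBigO h4

namespace OrbitFamily

variable {F : ℝ → ℝ} {K δ m c a₀ : ℝ} {Y P M R : ℝ → ℝ → ℝ} {τ : ℝ → ℝ}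

lemma continuousAt_uncurry (Φ : OrbitFamily F K δ m c a₀ Y P M R τ) (a x : ℝ) :
    ContinuousAt (fun z : ℝ × ℝ => Y z.2 z.1) (x, a) :=
  (Φ.hasFDerivAt a x).continuousAt

lemma continuousAt_zero (Φ : OrbitFamily F K δ m c a₀ Y P M R τ) {a : ℝ} (ha : a ∈ Ioo a₀ 1) :
    ContinuousAt τ a := by
  have H := Φ.half a (Ioo_subset_Ico_self ha)
  have hmem : ∀ᶠ b in nhds a, b ∈ Ico a₀ 1 :=
    Filter.mem_of_superset (Ioo_mem_nhds ha.1 ha.2) Ioo_subset_Ico_self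
  have cY : Continuous fun z : ℝ × ℝ => Y z.2 z.1 :=
    continuous_iff_continuousAt.2 fun z => Φ.continuousAt_uncurry z.2 z.1
  rw [Metric.continuousAt_iff']
  intro η hη
  have hlow : ∀ᶠ b in nhds a, ∀ x ∈ Icc 0 (τ a - η / 2), 0 < Y b x := by
    refine isCompact_Icc.eventually_forall_of_forall_eventually fun x hx => ?_
    have : Continuous fun z : ℝ × ℝ => Y z.1 z.2 := cY.comp continuous_swap
    exact this.continuousAt.eventually_const_lt (H.y_pos x ⟨hx.1, by linarith [hx.2]⟩)
  obtain ⟨x₀, hx₀, hneg⟩ : ∃ x₀ ∈ Icc 0 (τ a + η / 2), Y a x₀ < 0 := by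
    by_contra! hcon
    have hτ := H.τ_pos
    have hanti : StrictAntiOn (Y a) (Icc 0 (τ a + η / 2)) :=
      strictAntiOn_of_deriv_neg (convex_Icc _ _) H.o.continuous_y.continuousOn fun t ht => by
        rw [interior_Icc] at ht
        rw [(H.o.hy t).deriv]
        exact H.o.p_neg H.hF H.hw H.W H.ha ht.1
          fun s hs => hcon s ⟨hs.1, hs.2.trans ht.2.le⟩
    have h1 := hanti (a := τ a) (b := τ a + η / 2) ⟨hτ.le, by linarith⟩ ⟨by linarith, le_rfl⟩
      (by linarith)
    rw [H.y_τ] at h1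
    exact absurd (hcon _ ⟨by linarith, le_rfl⟩) (not_le.2 h1)
  have hupp : ∀ᶠ b in nhds a, Y b x₀ < 0 := by
    have : Continuous fun b => Y b x₀ := cY.comp (by fun_prop : Continuous fun b : ℝ => (x₀, b))
    exact this.continuousAt.eventually_lt_const hneg
  filter_upwards [hmem, hlow, hupp] with b hb h1 h2
  have Hb := Φ.half b hb
  have h3 : τ a - η / 2 < τ b := by
    by_contra! h
    have := h1 (τ b) ⟨Hb.τ_pos.le, h⟩
    rw [Hb.y_τ] at this
    exact lt_irrefl _ this
  have h4 : τ b ≤ x₀ := by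
    by_contra! h
    exact absurd (Hb.y_pos x₀ ⟨hx₀.1, h⟩) (not_lt.2 h2.le)
  rw [Real.dist_eq, abs_lt]
  constructor <;> linarith [hx₀.2]

lemma linearized_pos (Φ : OrbitFamily F K δ m c a₀ Y P M R τ) {a : ℝ} (ha : a ∈ Ico a₀ 1) :
    0 < M a (τ a) := by
  have H := Φ.half a ha
  have h1 := H.deriv_zero_ge (Φ.small a ha)
  have hδ := H.W.δ_pos
  have hK := H.K_pos
  have h2 : 0 < M a (τ a) / (-P a (τ a)) := by
    have : 0 < M a (τ a) / (-P a (τ a)) * (1 - a) := lt_of_lt_of_le (by positivity) h1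
    exact pos_of_mul_pos_left this H.beta_pos.le
  have h3 : 0 < -P a (τ a) := by linarith [H.p_neg (τ a) ⟨H.τ_pos, le_rfl⟩]
  exact (div_pos_iff_of_pos_right h3).1 h2

lemma hasDerivAt_zero (Φ : OrbitFamily F K δ m c a₀ Y P M R τ) {a : ℝ} (ha : a ∈ Ioo a₀ 1) :
    HasDerivAt τ (-M a (τ a) / P a (τ a)) a := by
  have H := Φ.half a (Ioo_subset_Ico_self ha)
  refine hasDerivAt_of_implicit (Φ.hasFDerivAt a (τ a))
    (H.p_neg (τ a) ⟨H.τ_pos, le_rfl⟩).ne (Φ.continuousAt_zero ha) ?_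
  filter_upwards [Ioo_mem_nhds ha.1 ha.2] with b hb
  exact (Φ.half b (Ioo_subset_Ico_self hb)).y_τ

lemma strictMonoOn_zero (Φ : OrbitFamily F K δ m c a₀ Y P M R τ) : StrictMonoOn τ (Ioo a₀ 1) := by
  refine strictMonoOn_of_deriv_pos (convex_Ioo _ _)
    (fun a ha => (Φ.continuousAt_zero ha).continuousWithinAt) fun a ha => ?_
  rw [interior_Ioo] at ha
  have H := Φ.half a (Ioo_subset_Ico_self ha)
  rw [(Φ.hasDerivAt_zero ha).deriv]
  have h1 := Φ.linearized_pos (Ioo_subset_Ico_self ha)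
  exact div_pos_of_neg_of_neg (by linarith) (H.p_neg (τ a) ⟨H.τ_pos, le_rfl⟩)

lemma one_le_beta_exp (Φ : OrbitFamily F K δ m c a₀ Y P M R τ) {a : ℝ} (ha : a ∈ Ico a₀ 1) :
    1 ≤ (1 - a) * Real.exp (K * τ a) := by
  have H := Φ.half a ha
  have := (H.growth (τ a)).1
  rwa [H.y_τ, sub_zero, abs_of_pos H.τ_pos] at this

/-- The amplitude as a function of the length `L = 2 τ`: the inverse of `2 τ`. -/
theorem exists_amplitude (Φ : OrbitFamily F K δ m c a₀ Y P M R τ) (ha₀ : a₀ < 1) :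
    ∃ (L₀ a₁ : ℝ) (amp : ℝ → ℝ), 0 < L₀ ∧ a₁ ∈ Ioo a₀ 1 ∧
      (∀ L, L₀ < L → amp L ∈ Ioo a₁ 1 ∧ τ (amp L) = L / 2 ∧
        HasDerivAt amp (-P (amp L) (L / 2) / (2 * M (amp L) (L / 2))) L) := by
  have hmono := Φ.strictMonoOn_zero
  have hex : ∀ a ∈ Ioo a₀ 1, ∀ l, τ a < l → ∃ b ∈ Ioo a 1, τ b = l := by
    intro a ha l hl
    have hl0 : 0 < l := (Φ.half a (Ioo_subset_Ico_self ha)).τ_pos.trans hl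
    have hK := (Φ.half a (Ioo_subset_Ico_self ha)).K_pos
    set b := max a (1 - Real.exp (-(K * l)))
    have hb : b < 1 := max_lt ha.2 (by linarith [Real.exp_pos (-(K * l))])
    have hab : a ≤ b := le_max_left _ _
    have hbmem : b ∈ Ioo a₀ 1 := ⟨ha.1.trans_le hab, hb⟩
    have hτb : l ≤ τ b := by
      have h1 := Φ.one_le_beta_exp (Ioo_subset_Ico_self hbmem)
      have h2 : 1 - b ≤ Real.exp (-(K * l)) := by linarith [le_max_right a (1 - Real.exp (-(K * l)))]
      have h3 : 1 ≤ Real.exp (-(K * l)) * Real.exp (K * τ b) :=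
        h1.trans (by gcongr)
      rw [← Real.exp_add, Real.one_le_exp_iff] at h3
      have h4 : K * l ≤ K * τ b := by linarith
      exact le_of_mul_le_mul_left h4 hK
    obtain ⟨z, hz, hz0⟩ := intermediate_value_Icc hab (fun x hx =>
      (Φ.continuousAt_zero ⟨ha.1.trans_le hx.1, hx.2.trans_lt hb⟩).continuousWithinAt)
      (show l ∈ Icc (τ a) (τ b) from ⟨hl.le, hτb⟩)
    refine ⟨z, ⟨lt_of_le_of_ne hz.1 fun h => ?_, hz.2.trans_lt hb⟩, hz0⟩
    rw [← h] at hz0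
    exact hl.ne hz0
  set a₂ := (a₀ + 1) / 2
  have ha₂ : a₂ ∈ Ioo a₀ 1 := by constructor <;> simp only [a₂] <;> linarith
  obtain ⟨a₁, ha₁, -⟩ := hex a₂ ha₂ (τ a₂ + 1) (by linarith)
  have ha₁' : a₁ ∈ Ioo a₀ 1 := ⟨ha₂.1.trans ha₁.1, ha₁.2⟩
  choose! amp hamp1 hamp2 using fun L (hL : 2 * τ a₁ < L) => hex a₁ ha₁' (L / 2) (by linarith)
  have hmem : ∀ L, 2 * τ a₁ < L → amp L ∈ Ioo a₀ 1 := fun L hL =>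
    ⟨ha₁'.1.trans (hamp1 L hL).1, (hamp1 L hL).2⟩
  refine ⟨2 * τ a₁, a₁, amp, ?_, ha₁', fun L hL => ⟨hamp1 L hL, hamp2 L hL, ?_⟩⟩
  · linarith [(Φ.half a₁ (Ioo_subset_Ico_self ha₁')).τ_pos]
  have hampmono : MonotoneOn amp (Ioi (2 * τ a₁)) := by
    intro l hl l' hl' hll
    rw [← hmono.le_iff_le (hmem l hl) (hmem l' hl'), hamp2 l hl, hamp2 l' hl']
    linarith
  have himage : amp '' Ioi (2 * τ a₁) ∈ nhds (amp L) := by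
    refine Filter.mem_of_superset (Ioo_mem_nhds (hamp1 L hL).1 (hamp1 L hL).2) fun b hb => ?_
    have hb' : b ∈ Ioo a₀ 1 := ⟨ha₁'.1.trans hb.1, hb.2⟩
    have hlt : 2 * τ a₁ < 2 * τ b := by linarith [hmono ha₁' hb' hb.1]
    refine ⟨2 * τ b, hlt, hmono.injOn (hmem _ hlt) hb' ?_⟩
    rw [hamp2 _ hlt]; ring
  have hcont : ContinuousAt amp L :=
    continuousAt_of_monotoneOn_of_image_mem_nhds hampmono (Ioi_mem_nhds hL) himage
  have H := Φ.half (amp L) (Ioo_subset_Ico_self (hmem L hL))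
  have hp := H.p_neg _ ⟨H.τ_pos, le_rfl⟩
  have hM := Φ.linearized_pos (Ioo_subset_Ico_self (hmem L hL))
  have hd := (Φ.hasDerivAt_zero (hmem L hL)).const_mul 2
  rw [hamp2 L hL] at hp hM hd
  have := hd.of_local_left_inverse hcont
    (mul_ne_zero two_ne_zero (div_ne_zero (neg_ne_zero.2 hM.ne') hp.ne)) (by
      filter_upwards [Ioi_mem_nhds hL] with l hl
      rw [hamp2 l hl]; ring)
  refine this.congr_deriv ?_
  have := hp.ne
  field_simp

end OrbitFamily

/-! ### The profiles of maximal amplitude -/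

/-- What is needed of the profiles `φ L` of sign `σ` and length `L > L₀`: existence and uniqueness,
total differentiability in `(x, L)` with partial derivatives `p` and `q`, and the estimates in terms
of `β = 1 - σ φ L 0`. The function `q + p / 2` in `abs_w_le` is the difference between the
derivative in `L` and the translation that keeps the right zero `L / 2` fixed. -/
structure ProfileEstimates (F : ℝ → ℝ) (σ A K L₀ : ℝ) (φ p q : ℝ → ℝ → ℝ) : Prop where
  isMax : ∀ L, L₀ < L → IsMaxProfile F L σ (φ L)
  unique : ∀ L, L₀ < L → ∀ ψ, IsMaxProfile F L σ ψ → ψ = φ L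
  hasFDerivAt : ∀ L, L₀ < L → ∀ x, HasFDerivAt (fun z : ℝ × ℝ => φ z.2 z.1)
    (p L x • ContinuousLinearMap.fst ℝ ℝ ℝ + q L x • ContinuousLinearMap.snd ℝ ℝ ℝ) (x, L)
  hasDerivAt_p : ∀ L, L₀ < L → ∀ x, HasDerivAt (p L) (deriv F (φ L x)) x
  continuous_q : ∀ L, L₀ < L → Continuous (q L)
  even : ∀ L, L₀ < L → ∀ x, φ L (-x) = φ L x
  abs_le : ∀ L, L₀ < L → ∀ x, |φ L x| ≤ 1
  abs_p_le : ∀ L, L₀ < L → ∀ x, |p L x| ≤ K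
  beta_pos : ∀ L, L₀ < L → 0 < 1 - σ * φ L 0
  p_sign : ∀ L, L₀ < L → ∀ x ∈ Icc 0 (L / 2), σ * p L x ≤ 0
  core : ∀ L, L₀ < L → ∀ x, |x| ≤ 2 → |p L x| ≤ K * (1 - σ * φ L 0)
  beta_le : ∀ L, L₀ < L → 1 - σ * φ L 0 ≤ K * Real.exp (-(A * (L / 2)))
  slope : ∀ L, L₀ < L → |p L (L / 2) + σ * √(2 * F 0)| ≤ K * (1 - σ * φ L 0)
  abs_w_le : ∀ L, L₀ < L → ∀ x ∈ Icc 0 (L / 2 + 1), |q L x + p L x / 2| ≤ K * (1 - σ * φ L 0)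
  mass : ∀ L, L₀ < L → ∀ g : ℝ → ℝ, Continuous g → ∀ G, (∀ s ∈ Icc (-1) 1, |g s| ≤ G) →
    |(∫ x in (0 : ℝ)..L / 2, g (φ L x) * p L x ^ 2)
      - ∫ s in (0 : ℝ)..1, √(2 * F (σ * s)) * g (σ * s)| ≤ K * G * (1 - σ * φ L 0)

namespace IsProfile

variable {F : ℝ → ℝ} {L : ℝ} {ψ : ℝ → ℝ}

/-- A positive profile is an orbit that starts at rest in the middle: by uniqueness it is
symmetric about its maximum, and a maximum off the middle would reflect one of the end points into
the interior. -/
lemma isOrbit (hF : ContDiff ℝ 3 F) (hL : 0 < L) (h : IsProfile F L 1 ψ) :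
    IsOrbit F (ψ 0) ψ (deriv ψ) := by
  have d1 : ∀ x, HasDerivAt ψ (deriv ψ x) x := fun x =>
    (h.contDiff.differentiable (by norm_num) x).hasDerivAt
  have c1 : ContDiff ℝ 1 (deriv ψ) := ContDiff.deriv' (n := 1) (h.contDiff.of_le (by norm_num))
  have d2 : ∀ x, HasDerivAt (deriv ψ) (deriv F (ψ x)) x := fun x => by
    have := (c1.differentiable (by norm_num) x).hasDerivAt
    rwa [show deriv (deriv ψ) x = deriv F (ψ x) by linarith [h.ode x]] at this
  obtain ⟨s, hs, hmax⟩ := (isCompact_Icc (a := -(L / 2)) (b := L / 2)).exists_isMaxOn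
    ⟨0, by constructor <;> linarith⟩ (continuous_iff_continuousAt.2
      fun x => (d1 x).continuousAt).continuousOn
  have hs0 : 0 < ψ s := by
    have := h.sign 0 ⟨by linarith, by linarith⟩
    rw [one_mul] at this
    exact this.trans_le (hmax ⟨by linarith, by linarith⟩)
  have hs1 : -(L / 2) < s := lt_of_le_of_ne hs.1 fun e => by
    rw [← e, h.left] at hs0; exact lt_irrefl _ hs0
  have hs2 : s < L / 2 := lt_of_le_of_ne hs.2 fun e => by
    rw [e, h.right] at hs0; exact lt_irrefl _ hs0
  have hp : deriv ψ s = 0 := (hmax.isLocalMax (Icc_mem_nhds hs1 hs2)).deriv_eq_zero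
  have hsub : ∀ x, HasDerivAt (fun x => 2 * s - x) (-1) x := fun x => by
    simpa using (hasDerivAt_id x).const_sub (2 * s)
  have hrefl : (fun x => ψ (2 * s - x)) = ψ := by
    refine second_order_unique ((contDiff_three_derivs hF).2.1.of_le (by norm_num))
      (p := fun x => -deriv ψ (2 * s - x)) (c := s)
      (fun x => ((d1 _).comp x (hsub x)).congr_deriv (by simp))
      (fun x => ((d2 _).comp x (hsub x)).neg.congr_deriv (by simp)) d1 d2 ?_ ?_
    · ring_nf
    · rw [show 2 * s - s = s by ring, hp, neg_zero]
  have hs00 : s = 0 := by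
    rcases lt_trichotomy s 0 with hneg | h0 | hpos
    · have h1 := congrFun hrefl (-(L / 2))
      have h2 := h.sign (2 * s - -(L / 2)) ⟨by linarith, by linarith⟩
      rw [one_mul, h1, h.left] at h2
      exact absurd h2 (lt_irrefl _)
    · exact h0
    · have h1 := congrFun hrefl (L / 2)
      have h2 := h.sign (2 * s - L / 2) ⟨by linarith, by linarith⟩
      rw [one_mul, h1, h.right] at h2
      exact absurd h2 (lt_irrefl _)
  exact ⟨rfl, hs00 ▸ hp, d1, d2⟩

lemma amp_lt_one (hF : ContDiff ℝ 3 F) (hw : IsDoubleWell F) (hL : 0 < L)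
    (h : IsProfile F L 1 ψ) : ψ 0 < 1 := by
  have o := h.isOrbit hF hL
  by_contra! h1
  rcases eq_or_lt_of_le h1 with h1 | h1
  · have o' : IsOrbit F (ψ 0) (fun _ => 1) (fun _ => 0) :=
      ⟨h1, rfl, fun x => hasDerivAt_const _ _, fun x => by
        rw [hw.deriv_one]; exact hasDerivAt_const _ _⟩
    have := congrFun (o.unique hF o') (L / 2)
    rw [h.right] at this
    exact zero_ne_one this
  · obtain ⟨z, -, hz⟩ := intermediate_value_Icc' (by linarith : (0 : ℝ) ≤ L / 2)
      o.continuous_y.continuousOn (show (1 : ℝ) ∈ Icc (ψ (L / 2)) (ψ 0) by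
        rw [h.right]; exact ⟨zero_le_one, h1.le⟩)
    have h2 := o.energy (contDiff_three_derivs hF).1 z
    have h3 := hw.pos (ψ 0) h1.ne' (by linarith)
    rw [hz, hw.val_one] at h2
    nlinarith [sq_nonneg (deriv ψ z)]

end IsProfile

/-- The estimates for positive profiles. -/
theorem exists_profileEstimates_one {F : ℝ → ℝ} (hF : ContDiff ℝ 3 F) (hw : IsDoubleWell F) :
    ∃ (K L₀ : ℝ) (φ p q : ℝ → ℝ → ℝ), 0 < L₀ ∧
      ProfileEstimates F 1 (√(deriv (deriv F) 1)) K L₀ φ p q := by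
  obtain ⟨K, δ, m, c, a₀, Y, P, M, R, τ, W, Φ⟩ := exists_orbitFamily hF hw
  obtain ⟨L₀, a₁, amp, hL₀, ha₁, hamp⟩ := Φ.exists_amplitude W.a₀_lt
  set A := √(deriv (deriv F) 1)
  have hA : 0 < A := Real.sqrt_pos.2 hw.deriv2_one
  have hA2 : A ^ 2 = deriv (deriv F) 1 := Real.sq_sqrt hw.deriv2_one.le
  have hK := W.one_le_K
  have hK0 : 0 < K := by linarith
  have hδ := W.δ_pos
  have hm := W.m_pos
  have hc := Real.sqrt_pos.2 W.c_pos
  have hmem : ∀ L, L₀ < L → amp L ∈ Ico a₀ 1 := fun L hL =>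
    ⟨ha₁.1.le.trans (hamp L hL).1.1.le, (hamp L hL).1.2⟩
  have hH : ∀ L, L₀ < L → HalfOrbit F K δ m c a₀ (amp L) (Y (amp L)) (P (amp L)) (M (amp L))
      (R (amp L)) (L / 2) := fun L hL => by
    have := Φ.half (amp L) (hmem L hL)
    rwa [(hamp L hL).2.1] at this
  set α : ℝ → ℝ := fun L => -P (amp L) (L / 2) / (2 * M (amp L) (L / 2))
  set κ := δ * Real.exp (-(K / m))
  have hκ : 0 < κ := by positivity
  set C₁ := (2 * K + A) * Real.exp (K / (A * m) * (2 * K) + A / √c) / A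
  set C₂ := (1 + K / √c * Real.exp (K * (1 + 1 / √c))) * (2 * K / κ)
  have hC₁ : 0 < C₁ := by positivity
  have hC₂ : 0 < C₂ := by positivity
  have hE := Real.exp_pos (K * 2)
  set K' := 2 * K + Real.exp (K * 2) + C₁ + C₂
  have hprofile : ∀ L, L₀ < L → IsProfile F L 1 (Y (amp L)) := fun L hL => by
    have H := hH L hL
    have e1 : deriv (Y (amp L)) = P (amp L) := funext fun x => (H.o.hy x).deriv
    have e2 : deriv (P (amp L)) = fun x => deriv F (Y (amp L) x) :=
      funext fun x => (H.o.hp x).deriv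
    have c1 : ContDiff ℝ 1 (P (amp L)) := contDiff_one_iff_deriv.2
      ⟨fun x => (H.o.hp x).differentiableAt, by
        rw [e2]; exact (contDiff_three_derivs hF).2.1.continuous.comp H.o.continuous_y⟩
    refine ⟨?_, fun x => by rw [e1, e2]; simp, ?_, H.y_τ, fun x hx => ?_⟩
    · rw [show (2 : WithTop ℕ∞) = 1 + 1 by norm_num]
      exact contDiff_succ_iff_deriv.2 ⟨fun x => (H.o.hy x).differentiableAt, by simp, by rwa [e1]⟩
    · rw [H.o.even hF, H.y_τ]
    · rw [one_mul]
      have : Y (amp L) |x| = Y (amp L) x := by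
        rcases abs_choice x with h | h <;> rw [h]
        exact H.o.even hF x
      rw [← this]
      exact H.y_pos _ ⟨abs_nonneg _, abs_lt.2 hx⟩
  -- A profile with at least the amplitude `amp L` belongs to the family, where `τ` is injective.
  have hmaximal : ∀ L, L₀ < L → ∀ ψ, IsProfile F L 1 ψ → amp L ≤ ψ 0 → ψ = Y (amp L) := by
    intro L hL ψ hψ hle
    have hLpos : 0 < L := hL₀.trans hL
    have o := hψ.isOrbit hF hLpos
    have hb : ψ 0 ∈ Ioo a₀ 1 :=
      ⟨ha₁.1.trans ((hamp L hL).1.1.trans_le hle), hψ.amp_lt_one hF hw hLpos⟩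
    have Hb := Φ.half _ (Ioo_subset_Ico_self hb)
    have e1 : ψ = Y (ψ 0) := o.unique hF Hb.o
    have e2 : τ (ψ 0) = L / 2 := by
      rcases lt_trichotomy (τ (ψ 0)) (L / 2) with h | h | h
      · have h1 := hψ.sign (τ (ψ 0)) ⟨by linarith [Hb.τ_pos], h⟩
        rw [one_mul, congrFun e1, Hb.y_τ] at h1
        exact absurd h1 (lt_irrefl _)
      · exact h
      · have h1 := Hb.y_pos (L / 2) ⟨by linarith, h⟩
        rw [← congrFun e1, hψ.right] at h1
        exact absurd h1 (lt_irrefl _)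
    have e3 : ψ 0 = amp L := Φ.strictMonoOn_zero.injOn hb
      ⟨ha₁.1.trans (hamp L hL).1.1, (hamp L hL).1.2⟩ (e2.trans (hamp L hL).2.1.symm)
    rw [e1, e3]
  refine ⟨K', L₀, fun L => Y (amp L), fun L => P (amp L), fun L x => M (amp L) x * α L, hL₀,
    ⟨?_, ?_, ?_, ?_, ?_, ?_, ?_, ?_, ?_, ?_, ?_, ?_, ?_, ?_, ?_⟩⟩
  · refine fun L hL => ⟨hprofile L hL, fun ψ hψ => ?_⟩
    by_contra! h
    simp only [one_mul, (hH L hL).o.y_zero] at h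
    have := congrFun (hmaximal L hL ψ hψ h.le) 0
    rw [(hH L hL).o.y_zero] at this
    exact h.ne' this
  · intro L hL ψ hψ
    refine hmaximal L hL ψ hψ.1 ?_
    have := hψ.2 _ (hprofile L hL)
    simpa only [one_mul, (hH L hL).o.y_zero] using this
  · intro L hL x
    have h1 : HasFDerivAt (fun z : ℝ × ℝ => (z.1, amp z.2)) ((ContinuousLinearMap.fst ℝ ℝ ℝ).prod
        (α L • ContinuousLinearMap.snd ℝ ℝ ℝ)) (x, L) := by
      have hsnd : HasFDerivAt (fun z : ℝ × ℝ => z.2) (ContinuousLinearMap.snd ℝ ℝ ℝ) (x, L) :=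
        hasFDerivAt_snd
      exact (hasFDerivAt_fst (p := (x, L))).prodMk ((hamp L hL).2.2.comp_hasFDerivAt (x, L) hsnd)
    have h2 := (Φ.hasFDerivAt (amp L) x).comp (x, L) h1
    refine h2.congr_fderiv ?_
    ext <;> simp
  · exact fun L hL x => (hH L hL).o.hp x
  · intro L hL
    have : Continuous (M (amp L)) :=
      continuous_iff_continuousAt.2 fun t => ((hH L hL).hM t).continuousAt
    exact this.mul continuous_const
  · exact fun L hL x => (hH L hL).o.even hF x
  · exact fun L hL x => abs_le.2 ((hH L hL).y_mem x)
  · exact fun L hL x => ((hH L hL).abs_p_le x).trans (by simp only [K']; linarith)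
  · intro L hL
    simpa only [one_mul, (hH L hL).o.y_zero] using (hH L hL).beta_pos
  · intro L hL x hx
    rw [one_mul]
    exact (hH L hL).p_nonpos hx
  · intro L hL x hx
    have H := hH L hL
    rw [one_mul, H.o.y_zero]
    have hb := H.beta_pos
    calc |P (amp L) x| ≤ (1 - amp L) * Real.exp (K * |x|) := (H.growth x).2
      _ ≤ (1 - amp L) * Real.exp (K * 2) := by gcongr
      _ = Real.exp (K * 2) * (1 - amp L) := mul_comm _ _
      _ ≤ K' * (1 - amp L) := by gcongr; simp only [K']; linarith
  · intro L hL
    have H := hH L hL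
    rw [one_mul, H.o.y_zero]
    have h1 := H.beta_exp_le hA hA2
    have h2 : 1 - amp L ≤ C₁ * Real.exp (-(A * (L / 2))) := by
      simp only [C₁]
      rw [div_mul_eq_mul_div, le_div_iff₀ hA]
      linarith
    refine h2.trans ?_
    gcongr; simp only [K']; linarith
  · intro L hL
    have H := hH L hL
    have hb := H.beta_pos
    rw [one_mul, one_mul, H.o.y_zero]
    refine H.slope_bound.trans ?_
    gcongr; simp only [K']; linarith
  · intro L hL x hx
    have H := hH L hL
    have hb := H.beta_pos
    have hp := H.p_neg _ ⟨H.τ_pos, le_rfl⟩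
    have hM := Φ.linearized_pos (hmem L hL)
    rw [(hamp L hL).2.1] at hM
    have hα : 0 < α L := div_pos (by linarith) (by linarith)
    have h1 := H.abs_w_le hα (by simp only [α]; field_simp; ring) hx
    have h2 := H.deriv_zero_ge (Φ.small _ (hmem L hL))
    have h3 : α L ≤ 2 * K / κ * (1 - amp L) := by
      have hp' : 0 < -P (amp L) (L / 2) := by linarith
      rw [div_mul_eq_mul_div, div_le_div_iff₀ (by positivity) hp'] at h2
      simp only [α]
      rw [div_mul_eq_mul_div, div_le_div_iff₀ (by positivity) hκ]
      linarith
    rw [one_mul, H.o.y_zero, mul_comm (M (amp L) x)]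
    calc _ ≤ _ := h1
      _ ≤ (1 + K / √c * Real.exp (K * (1 + 1 / √c))) * (2 * K / κ * (1 - amp L)) := by gcongr
      _ = C₂ * (1 - amp L) := by simp only [C₂]; ring
      _ ≤ K' * (1 - amp L) := by gcongr; simp only [K']; linarith
  · intro L hL g hg G hG
    have H := hH L hL
    have hb := H.beta_pos
    simp only [one_mul, H.o.y_zero]
    have hG0 : 0 ≤ G := (abs_nonneg _).trans (hG 0 (by simp))
    refine (H.mass hg hG).trans ?_
    gcongr; simp only [K']; linarith

/-! ### Negative profiles, and profiles of both signs -/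

section Reflection

variable {F : ℝ → ℝ}

lemma deriv_comp_neg_eq (F : ℝ → ℝ) : deriv (fun s => F (-s)) = fun s => -deriv F (-s) :=
  funext fun s => deriv_comp_neg F s

lemma deriv2_comp_neg_eq (F : ℝ → ℝ) :
    deriv (deriv fun s => F (-s)) = fun s => deriv (deriv F) (-s) := by
  rw [deriv_comp_neg_eq]
  funext s
  rw [deriv.fun_neg, deriv_comp_neg, neg_neg]

lemma IsDoubleWell.reflect (hw : IsDoubleWell F) : IsDoubleWell fun s => F (-s) where
  val_one := hw.val_neg_one
  val_neg_one := by rw [neg_neg]; exact hw.val_one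
  deriv_one := by rw [deriv_comp_neg_eq]; simp [hw.deriv_neg_one]
  deriv_neg_one := by rw [deriv_comp_neg_eq]; simp [hw.deriv_one]
  deriv2_one := by rw [deriv2_comp_neg_eq]; exact hw.deriv2_neg_one
  deriv2_neg_one := by rw [deriv2_comp_neg_eq]; simpa using hw.deriv2_one
  pos s h1 h2 := hw.pos (-s) (fun h => h2 (by linarith)) (fun h => h1 (by linarith))

lemma IsProfile.neg {L σ : ℝ} {ψ : ℝ → ℝ} (h : IsProfile F L σ ψ) :
    IsProfile (fun s => F (-s)) L (-σ) fun x => -ψ x where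
  contDiff := h.contDiff.neg
  ode x := by
    have e : deriv (fun x => -ψ x) = fun x => -deriv ψ x := funext fun x => deriv.fun_neg
    rw [e, deriv_comp_neg_eq, deriv.fun_neg, neg_neg]
    simp only [neg_neg]
    linarith [h.ode x]
  left := by rw [h.left, neg_zero]
  right := by rw [h.right, neg_zero]
  sign x hx := by simpa using h.sign x hx

lemma IsMaxProfile.neg {L σ : ℝ} {ψ : ℝ → ℝ} (h : IsMaxProfile F L σ ψ) :
    IsMaxProfile (fun s => F (-s)) L (-σ) fun x => -ψ x :=
  ⟨h.1.neg, fun ζ hζ => by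
    have := hζ.neg
    simp only [neg_neg] at this
    simpa using h.2 _ this⟩

lemma ProfileEstimates.neg {σ A K L₀ : ℝ} {φ p q : ℝ → ℝ → ℝ}
    (E : ProfileEstimates F σ A K L₀ φ p q) :
    ProfileEstimates (fun s => F (-s)) (-σ) A K L₀ (fun L x => -φ L x) (fun L x => -p L x)
      (fun L x => -q L x) where
  isMax L hL := (E.isMax L hL).neg
  unique L hL ψ hψ := by
    have h1 := hψ.neg
    simp only [neg_neg] at h1
    have := E.unique L hL _ h1
    funext x
    rw [← congrFun this x, neg_neg]
  hasFDerivAt L hL x := by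
    refine (E.hasFDerivAt L hL x).neg.congr_fderiv ?_
    ext <;> simp
  hasDerivAt_p L hL x := by
    rw [deriv_comp_neg_eq]
    simpa using (E.hasDerivAt_p L hL x).fun_neg
  continuous_q L hL := (E.continuous_q L hL).neg
  even L hL x := by rw [E.even L hL]
  abs_le L hL x := by rw [abs_neg]; exact E.abs_le L hL x
  abs_p_le L hL x := by rw [abs_neg]; exact E.abs_p_le L hL x
  beta_pos L hL := by simpa using E.beta_pos L hL
  p_sign L hL x hx := by simpa using E.p_sign L hL x hx
  core L hL x hx := by simpa using E.core L hL x hx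
  beta_le L hL := by simpa using E.beta_le L hL
  slope L hL := by
    have := E.slope L hL
    rw [← abs_neg] at this
    simpa [neg_add_eq_sub, add_comm] using this
  abs_w_le L hL x hx := by
    have := E.abs_w_le L hL x hx
    rw [← abs_neg, neg_add, ← neg_div] at this
    simpa using this
  mass L hL g hg G hG := by
    have := E.mass L hL (fun s => g (-s)) (by fun_prop) G (fun s hs =>
      hG (-s) ⟨by linarith [hs.2], by linarith [hs.1]⟩)
    simpa using this

lemma ProfileEstimates.mono {σ A K L₀ : ℝ} {φ p q : ℝ → ℝ → ℝ}
    (E : ProfileEstimates F σ A K L₀ φ p q) {A' K' L₀' : ℝ} (hA : A' ≤ A) (hK : K ≤ K')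
    (hK0 : 0 ≤ K') (hL₀ : 0 ≤ L₀) (hL : L₀ ≤ L₀') : ProfileEstimates F σ A' K' L₀' φ p q where
  isMax L h := E.isMax L (hL.trans_lt h)
  unique L h := E.unique L (hL.trans_lt h)
  hasFDerivAt L h := E.hasFDerivAt L (hL.trans_lt h)
  hasDerivAt_p L h := E.hasDerivAt_p L (hL.trans_lt h)
  continuous_q L h := E.continuous_q L (hL.trans_lt h)
  even L h := E.even L (hL.trans_lt h)
  abs_le L h := E.abs_le L (hL.trans_lt h)
  abs_p_le L h x := (E.abs_p_le L (hL.trans_lt h) x).trans hK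
  beta_pos L h := E.beta_pos L (hL.trans_lt h)
  p_sign L h := E.p_sign L (hL.trans_lt h)
  core L h x hx := (E.core L (hL.trans_lt h) x hx).trans
    (mul_le_mul_of_nonneg_right hK (E.beta_pos L (hL.trans_lt h)).le)
  beta_le L h := by
    have := E.beta_le L (hL.trans_lt h)
    have h0 : 0 < L := hL₀.trans_lt (hL.trans_lt h)
    calc _ ≤ K * Real.exp (-(A * (L / 2))) := this
      _ ≤ K' * Real.exp (-(A' * (L / 2))) := by gcongr
  slope L h := (E.slope L (hL.trans_lt h)).trans
    (mul_le_mul_of_nonneg_right hK (E.beta_pos L (hL.trans_lt h)).le)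
  abs_w_le L h x hx := (E.abs_w_le L (hL.trans_lt h) x hx).trans
    (mul_le_mul_of_nonneg_right hK (E.beta_pos L (hL.trans_lt h)).le)
  mass L h g hg G hG := (E.mass L (hL.trans_lt h) g hg G hG).trans (by
    have := (E.beta_pos L (hL.trans_lt h)).le
    have : 0 ≤ G := (abs_nonneg _).trans (hG 0 (by simp))
    gcongr)

lemma ProfileEstimates.profile_eq {σ A K L₀ : ℝ} {φ p q : ℝ → ℝ → ℝ}
    (E : ProfileEstimates F σ A K L₀ φ p q) {L : ℝ} (hL : L₀ < L) : profile F L σ = φ L := by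
  have h : ∃ φ, IsMaxProfile F L σ φ := ⟨_, E.isMax L hL⟩
  rw [profile, dif_pos h]
  exact E.unique L hL _ h.choose_spec

lemma ProfileEstimates.of_profile {σ A K L₀ : ℝ} {φ p q : ℝ → ℝ → ℝ}
    (E : ProfileEstimates F σ A K L₀ φ p q) :
    ProfileEstimates F σ A K L₀ (fun L => profile F L σ) p q := by
  have e := fun L (hL : L₀ < L) => E.profile_eq hL
  refine ⟨fun L hL => ?_, fun L hL => ?_, fun L hL x => ?_, fun L hL => ?_, fun L hL => ?_,
    fun L hL => ?_, fun L hL => ?_, fun L hL => ?_, fun L hL => ?_, fun L hL => ?_,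
    fun L hL => ?_, fun L hL => ?_, fun L hL => ?_, fun L hL => ?_, fun L hL => ?_⟩
  on_goal 3 =>
    refine (E.hasFDerivAt L hL x).congr_of_eventuallyEq ?_
    have : ∀ᶠ z : ℝ × ℝ in nhds (x, L), L₀ < z.2 :=
      continuous_snd.continuousAt.eventually_const_lt hL
    exact this.mono fun z hz => congrFun (e z.2 hz) z.1
  all_goals try simp only [e L hL]
  · exact E.isMax L hL
  · exact E.unique L hL
  · exact E.hasDerivAt_p L hL
  · exact E.continuous_q L hL
  · exact E.even L hL
  · exact E.abs_le L hL
  · exact E.abs_p_le L hL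
  · exact E.beta_pos L hL
  · exact E.p_sign L hL
  · exact E.core L hL
  · exact E.beta_le L hL
  · exact E.slope L hL
  · exact E.abs_w_le L hL
  · exact E.mass L hL

end Reflection

/-- The estimates for profiles of both signs, with common constants. -/
theorem exists_profileEstimates {F : ℝ → ℝ} (hF : ContDiff ℝ 3 F) (hw : IsDoubleWell F) :
    ∃ (K L₀ : ℝ) (p q : ℝ → ℝ → ℝ → ℝ), 1 ≤ K ∧ 8 ≤ L₀ ∧ ∀ σ, σ = 1 ∨ σ = -1 →
      ProfileEstimates F σ (decayRate F) K L₀ (fun L => profile F L σ) (p σ) (q σ) := by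
  obtain ⟨K₁, L₁, φ₁, p₁, q₁, hL₁, E₁⟩ := exists_profileEstimates_one hF hw
  obtain ⟨K₂, L₂, φ₂, p₂, q₂, hL₂, E₂⟩ := exists_profileEstimates_one
    (F := fun s => F (-s)) (hF.comp contDiff_neg) hw.reflect
  have E₂' := E₂.neg
  simp only [neg_neg, deriv2_comp_neg_eq] at E₂'
  set K := max (max K₁ K₂) 1
  set L₀ := max (max L₁ L₂) 8
  have h1 : K₁ ≤ K := (le_max_left _ _).trans (le_max_left _ _)
  have h2 : K₂ ≤ K := (le_max_right _ _).trans (le_max_left _ _)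
  have h3 : L₁ ≤ L₀ := (le_max_left _ _).trans (le_max_left _ _)
  have h4 : L₂ ≤ L₀ := (le_max_right _ _).trans (le_max_left _ _)
  have h5 : 1 ≤ K := le_max_right _ _
  refine ⟨K, L₀, fun σ => if σ = 1 then p₁ else fun L x => -p₂ L x,
    fun σ => if σ = 1 then q₁ else fun L x => -q₂ L x, h5, le_max_right _ _, fun σ hσ => ?_⟩
  rcases hσ with rfl | rfl
  · simp only [if_true]
    exact (E₁.mono (min_le_left _ _) h1 (by linarith) hL₁.le h3).of_profile
  · simp only [show (-1 : ℝ) ≠ 1 by norm_num, if_false]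
    exact (E₂'.mono (min_le_right _ _) h2 (by linarith) hL₂.le h4).of_profile

/-! ### One layer in rescaled coordinates -/

noncomputable section

/-- Two profiles glued at a layer at `0`: `f` is centred at `-L / 2` and `f'` at `L' / 2`, and both
functions are even. -/
def layerFun (χ f f' : ℝ → ℝ) (L L' y : ℝ) : ℝ :=
  (1 - χ y) * f (L / 2 + y) + χ y * f' (L' / 2 - y)

/-- The derivative of `layerFun`, where `p`, `p'` are the derivatives of `f`, `f'`. -/
def layerDeriv (χ f p f' p' : ℝ → ℝ) (L L' y : ℝ) : ℝ :=
  (1 - χ y) * p (L / 2 + y) - χ y * p' (L' / 2 - y)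
    + deriv χ y * (f' (L' / 2 - y) - f (L / 2 + y))

/-- The cut-off near the two ends of the interval `[-L / 2, L' / 2]`. -/
def layerCut (χ : ℝ → ℝ) (L L' y : ℝ) : ℝ := χ (y + L / 2 - 1) * (1 - χ (y - L' / 2 + 1))

end

namespace IsCutoff

variable {χ : ℝ → ℝ}

lemma deriv_eq_zero (hχ : IsCutoff χ) {y : ℝ} (hy : 1 ≤ |y|) : deriv χ y = 0 := by
  rcases le_abs.1 hy with h | h
  · refine IsLocalMax.deriv_eq_zero (Filter.Eventually.of_forall fun x => ?_)
    rw [hχ.eq_one y h]; exact hχ.le_one x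
  · refine IsLocalMin.deriv_eq_zero (Filter.Eventually.of_forall fun x => ?_)
    rw [hχ.eq_zero y (by linarith)]; exact hχ.nonneg x

lemma continuous (hχ : IsCutoff χ) : Continuous χ := hχ.smooth.continuous

lemma differentiable (hχ : IsCutoff χ) : Differentiable ℝ χ := hχ.smooth.differentiable (by simp)

lemma continuous_deriv (hχ : IsCutoff χ) : Continuous (deriv χ) :=
  hχ.smooth.continuous_deriv (by simp)

lemma exists_bound_deriv (hχ : IsCutoff χ) : ∃ X, 0 ≤ X ∧ ∀ y, |deriv χ y| ≤ X := by
  obtain ⟨X, hX⟩ := (isCompact_Icc (a := (-1 : ℝ)) (b := 1)).exists_bound_of_continuousOn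
    hχ.continuous_deriv.continuousOn
  refine ⟨X, (norm_nonneg _).trans (hX 0 (by simp)), fun y => ?_⟩
  rcases le_total |y| 1 with h | h
  · exact hX y (abs_le.1 h)
  · rw [hχ.deriv_eq_zero h, abs_zero]
    exact (norm_nonneg _).trans (hX 0 (by simp))

lemma reflect (hχ : IsCutoff χ) : IsCutoff fun y => 1 - χ (-y) where
  smooth := contDiff_const.sub (hχ.smooth.comp contDiff_neg)
  nonneg x := by linarith [hχ.le_one (-x)]
  le_one x := by linarith [hχ.nonneg (-x)]
  eq_zero x hx := by rw [hχ.eq_one _ (by linarith), sub_self]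
  eq_one x hx := by rw [hχ.eq_zero _ (by linarith), sub_zero]

lemma deriv_reflect (χ : ℝ → ℝ) (y : ℝ) : deriv (fun y => 1 - χ (-y)) y = deriv χ (-y) := by
  rw [deriv_const_sub, deriv_comp_neg, neg_neg]

lemma abs_one_sub_le (hχ : IsCutoff χ) (y : ℝ) : |1 - χ y| ≤ 1 := by
  rw [abs_le]; constructor <;> linarith [hχ.nonneg y, hχ.le_one y]

lemma abs_le_one (hχ : IsCutoff χ) (y : ℝ) : |χ y| ≤ 1 := by
  rw [abs_le]; constructor <;> linarith [hχ.nonneg y, hχ.le_one y]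

lemma abs_layerCut_le (hχ : IsCutoff χ) (L L' y : ℝ) : |layerCut χ L L' y| ≤ 1 := by
  rw [layerCut, abs_mul]
  exact mul_le_one₀ (hχ.abs_le_one _) (abs_nonneg _) (hχ.abs_one_sub_le _)

end IsCutoff

/-- Bounds for the data: `Λ` is a Lipschitz constant of `F'` and `g` on the range `[-1, 1]` of the
profiles, `G` bounds `g` there, and `X` bounds `χ'`. -/
structure DataBounds (F χ g : ℝ → ℝ) (Λ X G : ℝ) : Prop where
  one_le_Λ : 1 ≤ Λ
  lipF : ∀ y z, |y| ≤ 1 → |z| ≤ 1 → |deriv F y - deriv F z| ≤ Λ * |y - z|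
  X_nonneg : 0 ≤ X
  hX : ∀ y, |deriv χ y| ≤ X
  g_cont : Continuous g
  g_le : ∀ s ∈ Icc (-1) 1, |g s| ≤ G
  lipg : ∀ y z, |y| ≤ 1 → |z| ≤ 1 → |g y - g z| ≤ Λ * |y - z|

/-- Two neighbouring profiles of opposite signs `σ`, `-σ`, of lengths `L`, `L'`, together with a
weight `g`. -/
structure LayerPair (F χ g : ℝ → ℝ) (σ A K L₀ Λ X G : ℝ) (φ p q φ' p' q' : ℝ → ℝ → ℝ)
    (L L' : ℝ) : Prop extends DataBounds F χ g Λ X G where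
  E : ProfileEstimates F σ A K L₀ φ p q
  E' : ProfileEstimates F (-σ) A K L₀ φ' p' q'
  hχ : IsCutoff χ
  one_le_K : 1 ≤ K
  le_L₀ : 8 ≤ L₀
  hL : L₀ < L
  hL' : L₀ < L'
  hσ : σ = 1 ∨ σ = -1

lemma layerFun_reflect (χ f f' : ℝ → ℝ) (L L' y : ℝ) :
    layerFun (fun y => 1 - χ (-y)) f' f L' L (-y) = layerFun χ f f' L L' y := by
  simp only [layerFun, neg_neg, sub_neg_eq_add, sub_sub_cancel, ← sub_eq_add_neg]
  ring

lemma layerDeriv_reflect (χ f p f' p' : ℝ → ℝ) (L L' y : ℝ) :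
    layerDeriv (fun y => 1 - χ (-y)) f' p' f p L' L (-y) = -layerDeriv χ f p f' p' L L' y := by
  simp only [layerDeriv, IsCutoff.deriv_reflect, neg_neg, sub_neg_eq_add, sub_sub_cancel,
    ← sub_eq_add_neg]
  ring

lemma layerCut_reflect (χ : ℝ → ℝ) (L L' y : ℝ) :
    layerCut (fun y => 1 - χ (-y)) L' L (-y) = layerCut χ L L' y := by
  simp only [layerCut, sub_sub_cancel]
  rw [mul_comm]
  congr 2 <;> ring_nf

/-- The two halves of `weightConst F g`. -/
lemma weightConst_eq {F g : ℝ → ℝ} (hF : Continuous F) (hg : Continuous g) {σ : ℝ}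
    (hσ : σ = 1 ∨ σ = -1) :
    (∫ s in (0 : ℝ)..1, √(2 * F (σ * s)) * g (σ * s))
      + (∫ s in (0 : ℝ)..1, √(2 * F (-σ * s)) * g (-σ * s)) = weightConst F g := by
  set k : ℝ → ℝ := fun s => √(2 * F s) * g s
  have ck : Continuous k := by fun_prop
  have h1 : (∫ s in (0 : ℝ)..1, k (-s)) = ∫ s in (-1 : ℝ)..0, k s := by
    rw [intervalIntegral.integral_comp_neg, neg_zero]
  have h2 : weightConst F g = (∫ s in (-1 : ℝ)..0, k s) + ∫ s in (0 : ℝ)..1, k s :=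
    (intervalIntegral.integral_add_adjacent_intervals (ck.intervalIntegrable _ _)
      (ck.intervalIntegrable _ _)).symm
  rw [h2, ← h1]
  rcases hσ with rfl | rfl
  · simp only [one_mul, neg_mul]
    exact add_comm _ _
  · simp only [one_mul, neg_mul, neg_neg, k]

namespace LayerPair

variable {F χ g : ℝ → ℝ} {σ A K L₀ Λ X G : ℝ} {φ p q φ' p' q' : ℝ → ℝ → ℝ} {L L' : ℝ}

lemma reflect (h : LayerPair F χ g σ A K L₀ Λ X G φ p q φ' p' q' L L') :
    LayerPair F (fun y => 1 - χ (-y)) g (-σ) A K L₀ Λ X G φ' p' q' φ p q L' L :=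
  { h with
    E := h.E'
    E' := by rw [neg_neg]; exact h.E
    hχ := h.hχ.reflect
    hL := h.hL'
    hL' := h.hL
    hσ := by rcases h.hσ with h | h <;> simp [h]
    hX := fun y => by rw [IsCutoff.deriv_reflect]; exact h.hX _ }

lemma hasDerivAt_left (h : LayerPair F χ g σ A K L₀ Λ X G φ p q φ' p' q' L L') (x : ℝ) :
    HasDerivAt (φ L) (p L x) x := by
  have h3 : HasDerivAt (fun x : ℝ => (x, L)) ((1, 0) : ℝ × ℝ) x :=
    (hasDerivAt_id _).prodMk (hasDerivAt_const _ _)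
  have := (h.E.hasFDerivAt L h.hL x).comp_hasDerivAt x h3
  exact this.congr_deriv (by simp)

lemma continuous_left (h : LayerPair F χ g σ A K L₀ Λ X G φ p q φ' p' q' L L') :
    Continuous (φ L) ∧ Continuous (p L) ∧ Continuous (q L) :=
  ⟨continuous_iff_continuousAt.2 fun x => (h.hasDerivAt_left x).continuousAt,
    continuous_iff_continuousAt.2 fun x => (h.E.hasDerivAt_p L h.hL x).continuousAt,
    h.E.continuous_q L h.hL⟩

lemma continuous_layer (h : LayerPair F χ g σ A K L₀ Λ X G φ p q φ' p' q' L L') :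
    Continuous (layerFun χ (φ L) (φ' L') L L') ∧
      Continuous (layerDeriv χ (φ L) (p L) (φ' L') (p' L') L L') ∧
      Continuous (layerCut χ L L') := by
  obtain ⟨c1, c2, -⟩ := h.continuous_left
  obtain ⟨c3, c4, -⟩ := h.reflect.continuous_left
  have c5 := h.hχ.continuous
  have c6 := h.hχ.continuous_deriv
  refine ⟨?_, ?_, ?_⟩
  · unfold layerFun; fun_prop
  · unfold layerDeriv; fun_prop
  · unfold layerCut; fun_prop

lemma eight_lt (h : LayerPair F χ g σ A K L₀ Λ X G φ p q φ' p' q' L L') : 8 < L ∧ 8 < L' :=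
  ⟨h.le_L₀.trans_lt h.hL, h.le_L₀.trans_lt h.hL'⟩

lemma G_nonneg (h : LayerPair F χ g σ A K L₀ Λ X G φ p q φ' p' q' L L') : 0 ≤ G :=
  (abs_nonneg _).trans (h.g_le 0 (by simp))

lemma abs_layerFun_le (h : LayerPair F χ g σ A K L₀ Λ X G φ p q φ' p' q' L L') (y : ℝ) :
    |layerFun χ (φ L) (φ' L') L L' y| ≤ 1 := by
  have h1 := h.E.abs_le L h.hL (L / 2 + y)
  have h2 := h.E'.abs_le L' h.hL' (L' / 2 - y)
  have h3 := h.hχ.nonneg y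
  have h4 := h.hχ.le_one y
  rw [layerFun]
  refine (abs_add_le _ _).trans ?_
  rw [abs_mul, abs_mul, abs_of_nonneg h3, abs_of_nonneg (by linarith : 0 ≤ 1 - χ y)]
  nlinarith

lemma abs_g_layerFun_le (h : LayerPair F χ g σ A K L₀ Λ X G φ p q φ' p' q' L L') (y : ℝ) :
    |g (layerFun χ (φ L) (φ' L') L L' y)| ≤ G :=
  h.g_le _ (abs_le.1 (h.abs_layerFun_le y))

lemma abs_layerDeriv_le (h : LayerPair F χ g σ A K L₀ Λ X G φ p q φ' p' q' L L') (y : ℝ) :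
    |layerDeriv χ (φ L) (p L) (φ' L') (p' L') L L' y| ≤ 2 * K + 2 * X := by
  have h1 := h.E.abs_le L h.hL (L / 2 + y)
  have h2 := h.E'.abs_le L' h.hL' (L' / 2 - y)
  have h3 := h.E.abs_p_le L h.hL (L / 2 + y)
  have h4 := h.E'.abs_p_le L' h.hL' (L' / 2 - y)
  have h5 := h.hX y
  have hX := h.X_nonneg
  have hK := h.one_le_K
  rw [layerDeriv]
  refine (abs_add_le _ _).trans (add_le_add ((abs_sub _ _).trans ?_) ?_)
  · rw [abs_mul, abs_mul]
    have := mul_le_mul (h.hχ.abs_one_sub_le y) h3 (abs_nonneg _) zero_le_one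
    have := mul_le_mul (h.hχ.abs_le_one y) h4 (abs_nonneg _) zero_le_one
    linarith
  · rw [abs_mul, mul_comm]
    have := (abs_sub (φ' L' (L' / 2 - y)) (φ L (L / 2 + y)))
    gcongr
    linarith

lemma layer_eq_left (h : LayerPair F χ g σ A K L₀ Λ X G φ p q φ' p' q' L L') {y : ℝ}
    (hy : y ≤ -1) : layerFun χ (φ L) (φ' L') L L' y = φ L (L / 2 + y) ∧
      layerDeriv χ (φ L) (p L) (φ' L') (p' L') L L' y = p L (L / 2 + y) := by
  have h1 := h.hχ.eq_zero y hy
  have h2 := h.hχ.deriv_eq_zero (y := y) (by rw [abs_of_nonpos (by linarith)]; linarith)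
  simp [layerFun, layerDeriv, h1, h2]

lemma beta_le_two (h : LayerPair F χ g σ A K L₀ Λ X G φ p q φ' p' q' L L') :
    1 - σ * φ L 0 ≤ 2 := by
  have h1 := abs_le.1 (h.E.abs_le L h.hL 0)
  rcases h.hσ with h | h <;> rw [h] <;> linarith [h1.1, h1.2]

/-- Near the layer the two profiles solve the same equation, both vanish at `0`, and their
slopes there differ by `O(β + β')`. -/
lemma abs_sub_le (h : LayerPair F χ g σ A K L₀ Λ X G φ p q φ' p' q' L L') {y : ℝ} (hy : |y| ≤ 1) :
    |φ L (L / 2 + y) - φ' L' (L' / 2 - y)|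
        ≤ K * Real.exp Λ * ((1 - σ * φ L 0) + (1 - -σ * φ' L' 0)) ∧
      |p L (L / 2 + y) + p' L' (L' / 2 - y)|
        ≤ K * Real.exp Λ * ((1 - σ * φ L 0) + (1 - -σ * φ' L' 0)) := by
  have hadd : ∀ y, HasDerivAt (fun y => L / 2 + y) 1 y := fun y => (hasDerivAt_id y).const_add _
  have hsub : ∀ y, HasDerivAt (fun y => L' / 2 - y) (-1) y := fun y => (hasDerivAt_id y).const_sub _
  have hb := h.E.beta_pos L h.hL
  have hb' := h.E'.beta_pos L' h.hL'
  have hK := h.one_le_K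
  have h1 := second_order_gronwall (D := fun y => φ L (L / 2 + y) - φ' L' (L' / 2 - y))
    (P := fun y => p L (L / 2 + y) + p' L' (L' / 2 - y))
    (Q := fun y => deriv F (φ L (L / 2 + y)) - deriv F (φ' L' (L' / 2 - y))) (c := 0) (b := y)
    (δ := K * ((1 - σ * φ L 0) + (1 - -σ * φ' L' 0))) h.one_le_Λ le_rfl
    (fun y => (((h.hasDerivAt_left _).comp y (hadd y)).fun_sub
      ((h.reflect.hasDerivAt_left _).comp y (hsub y))).congr_deriv (by ring))
    (fun y => (((h.E.hasDerivAt_p L h.hL _).comp y (hadd y)).fun_add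
      ((h.E'.hasDerivAt_p L' h.hL' _).comp y (hsub y))).congr_deriv (by ring))
    (by
      rw [add_zero, sub_zero, (h.E.isMax L h.hL).1.right, (h.E'.isMax L' h.hL').1.right, sub_zero,
        abs_zero]
      have : 0 < K := by linarith
      exact mul_nonneg this.le (by linarith))
    (by
      rw [add_zero, sub_zero, show p L (L / 2) + p' L' (L' / 2)
        = (p L (L / 2) + σ * √(2 * F 0)) + (p' L' (L' / 2) + -σ * √(2 * F 0)) by ring, mul_add]
      exact (abs_add_le _ _).trans (add_le_add (h.E.slope L h.hL) (h.E'.slope L' h.hL')))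
    (fun s _ => by
      rw [add_zero]
      exact h.lipF _ _ (h.E.abs_le L h.hL _) (h.E'.abs_le L' h.hL' _))
  rw [add_zero, sub_zero] at h1
  have hΛ := h.one_le_Λ
  have h2 : Real.exp (Λ * |y|) ≤ Real.exp Λ := by
    gcongr; exact mul_le_of_le_one_right (by linarith) hy
  have h3 : K * ((1 - σ * φ L 0) + (1 - -σ * φ' L' 0)) * Real.exp (Λ * |y|)
      ≤ K * Real.exp Λ * ((1 - σ * φ L 0) + (1 - -σ * φ' L' 0)) := by
    have : 0 ≤ K * ((1 - σ * φ L 0) + (1 - -σ * φ' L' 0)) := mul_nonneg (by linarith) (by linarith)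
    calc _ ≤ K * ((1 - σ * φ L 0) + (1 - -σ * φ' L' 0)) * Real.exp Λ := by gcongr
      _ = _ := by ring
  exact ⟨h1.1.trans h3, h1.2.trans h3⟩

lemma layerCut_eq_one (h : LayerPair F χ g σ A K L₀ Λ X G φ p q φ' p' q' L L') {y : ℝ}
    (h1 : -(L / 2) + 2 ≤ y) (h2 : y ≤ L' / 2 - 2) : layerCut χ L L' y = 1 := by
  rw [layerCut, h.hχ.eq_one _ (by linarith), h.hχ.eq_zero _ (by linarith)]
  norm_num

/-- In the transition region the glued function differs from the left profile
by `O(β + β')`. -/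
lemma transition_bound (h : LayerPair F χ g σ A K L₀ Λ X G φ p q φ' p' q' L L') {y : ℝ}
    (hy : |y| ≤ 1) :
    |g (layerFun χ (φ L) (φ' L') L L' y) * layerDeriv χ (φ L) (p L) (φ' L') (p' L') L L' y ^ 2
        - g (φ L (L / 2 + y)) * p L (L / 2 + y) ^ 2|
      ≤ (Λ * (2 * K + 2 * X) ^ 2 + G * ((1 + X) * ((2 * K + 2 * X) + K)))
        * (K * Real.exp Λ * ((1 - σ * φ L 0) + (1 - -σ * φ' L' 0))) := by
  obtain ⟨d1, d2⟩ := h.abs_sub_le hy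
  set d := K * Real.exp Λ * ((1 - σ * φ L 0) + (1 - -σ * φ' L' 0))
  have hd : 0 ≤ d := (abs_nonneg _).trans d1
  have u1 := h.abs_layerDeriv_le y
  have u2 := h.abs_layerFun_le y
  have e1 : layerFun χ (φ L) (φ' L') L L' y - φ L (L / 2 + y)
      = -(χ y * (φ L (L / 2 + y) - φ' L' (L' / 2 - y))) := by rw [layerFun]; ring
  have e2 : layerDeriv χ (φ L) (p L) (φ' L') (p' L') L L' y - p L (L / 2 + y)
      = -(χ y * (p L (L / 2 + y) + p' L' (L' / 2 - y)))
        - deriv χ y * (φ L (L / 2 + y) - φ' L' (L' / 2 - y)) := by rw [layerDeriv]; ring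
  set U := layerFun χ (φ L) (φ' L') L L' y
  set V := layerDeriv χ (φ L) (p L) (φ' L') (p' L') L L' y
  have f1 : |U - φ L (L / 2 + y)| ≤ d := by
    rw [e1, abs_neg, abs_mul]
    calc _ ≤ 1 * d := mul_le_mul (h.hχ.abs_le_one y) d1 (abs_nonneg _) zero_le_one
      _ = d := one_mul d
  have f2 : |V - p L (L / 2 + y)| ≤ (1 + X) * d := by
    rw [e2]
    refine (abs_sub _ _).trans ?_
    rw [abs_neg, abs_mul, abs_mul]
    have g1 := mul_le_mul (h.hχ.abs_le_one y) d2 (abs_nonneg _) zero_le_one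
    have g2 := mul_le_mul (h.hX y) d1 (abs_nonneg _) h.X_nonneg
    linarith
  have f3 := h.E.abs_p_le L h.hL (L / 2 + y)
  have f4 := h.lipg U (φ L (L / 2 + y)) u2 (h.E.abs_le L h.hL _)
  have f5 := h.g_le _ (abs_le.1 (h.E.abs_le L h.hL (L / 2 + y)))
  have hΛ := h.one_le_Λ
  have hX := h.X_nonneg
  have hK := h.one_le_K
  have hG := h.G_nonneg
  rw [show g U * V ^ 2 - g (φ L (L / 2 + y)) * p L (L / 2 + y) ^ 2
    = (g U - g (φ L (L / 2 + y))) * V ^ 2 + g (φ L (L / 2 + y)) *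
      ((V - p L (L / 2 + y)) * (V + p L (L / 2 + y))) by ring]
  refine (abs_add_le _ _).trans ?_
  rw [abs_mul, abs_mul, abs_mul, abs_pow]
  have f6 : |V + p L (L / 2 + y)| ≤ 2 * K + 2 * X + K := (abs_add_le _ _).trans (by linarith)
  calc _ ≤ Λ * d * (2 * K + 2 * X) ^ 2 + G * ((1 + X) * d * (2 * K + 2 * X + K)) := by
        gcongr
        exact f4.trans (by gcongr)
    _ = _ := by ring

/-- The contribution of the left half of a layer. -/
lemma half_mass (h : LayerPair F χ g σ A K L₀ Λ X G φ p q φ' p' q' L L') :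
    |(∫ y in -(L / 2)..0, layerCut χ L L' y * (g (layerFun χ (φ L) (φ' L') L L' y)
        * layerDeriv χ (φ L) (p L) (φ' L') (p' L') L L' y ^ 2))
      - ∫ s in (0 : ℝ)..1, √(2 * F (σ * s)) * g (σ * s)|
      ≤ (K * G + 4 * G * K ^ 2 + (Λ * (2 * K + 2 * X) ^ 2
        + G * ((1 + X) * ((2 * K + 2 * X) + K))) * (K * Real.exp Λ))
        * ((1 - σ * φ L 0) + (1 - -σ * φ' L' 0)) := by
  obtain ⟨c1, c2, c3⟩ := h.continuous_layer
  obtain ⟨c4, c5, -⟩ := h.continuous_left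
  have c6 := h.g_cont
  have hK := h.one_le_K
  have hG := h.G_nonneg
  have hX := h.X_nonneg
  have hΛ := h.one_le_Λ
  obtain ⟨hL8, hL8'⟩ := h.eight_lt
  set β := 1 - σ * φ L 0
  set β' := 1 - -σ * φ' L' 0
  have hβ : 0 < β := h.E.beta_pos L h.hL
  have hβ' : 0 < β' := h.E'.beta_pos L' h.hL'
  have hβ2 : β ≤ 2 := h.beta_le_two
  set C := Λ * (2 * K + 2 * X) ^ 2 + G * ((1 + X) * ((2 * K + 2 * X) + K))
  have hC : 0 ≤ C := by positivity
  set f₁ : ℝ → ℝ := fun y => layerCut χ L L' y * (g (layerFun χ (φ L) (φ' L') L L' y)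
        * layerDeriv χ (φ L) (p L) (φ' L') (p' L') L L' y ^ 2)
  set f₂ : ℝ → ℝ := fun y => g (φ L (L / 2 + y)) * p L (L / 2 + y) ^ 2
  have cf₁ : Continuous f₁ := by fun_prop
  have cf₂ : Continuous f₂ := by fun_prop
  have e1 : (∫ y in -(L / 2)..0, f₂ y) = ∫ x in (0 : ℝ)..L / 2, g (φ L x) * p L x ^ 2 := by
    have := intervalIntegral.integral_comp_add_left (a := -(L / 2)) (b := 0)
      (fun x => g (φ L x) * p L x ^ 2) (L / 2)
    simpa using this
  have h1 := h.E.mass L h.hL g c6 G h.g_le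
  rw [← e1] at h1
  have cd : Continuous fun y => f₁ y - f₂ y := cf₁.sub cf₂
  have i1 : |∫ y in -(L / 2)..(-(L / 2) + 2), (f₁ y - f₂ y)| ≤ 4 * G * K ^ 2 * β := by
    have := intervalIntegral.norm_integral_le_of_norm_le_const (a := -(L / 2)) (b := -(L / 2) + 2)
      (f := fun y => f₁ y - f₂ y) (C := G * (K ^ 2 * (2 * β))) (fun y hy => by
        rw [uIoc_of_le (by linarith)] at hy
        obtain ⟨e2, e3⟩ := h.layer_eq_left (y := y) (by linarith [hy.2])
        simp only [f₁, f₂, e2, e3]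
        have g1 := h.E.core L h.hL (L / 2 + y) (by
          rw [abs_le]; constructor <;> linarith [hy.1, hy.2])
        have g2 := h.g_le _ (abs_le.1 (h.E.abs_le L h.hL (L / 2 + y)))
        have g3 : |layerCut χ L L' y - 1| ≤ 1 := by
          have n1 : 0 ≤ layerCut χ L L' y := mul_nonneg (h.hχ.nonneg _)
            (by linarith [h.hχ.le_one (y - L' / 2 + 1)])
          have n2 := (abs_le.1 (h.hχ.abs_layerCut_le L L' y)).2
          rw [abs_le]; constructor <;> linarith
        rw [Real.norm_eq_abs, show layerCut χ L L' y * (g (φ L (L / 2 + y)) * p L (L / 2 + y) ^ 2)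
          - g (φ L (L / 2 + y)) * p L (L / 2 + y) ^ 2
          = (layerCut χ L L' y - 1) * (g (φ L (L / 2 + y)) * p L (L / 2 + y) ^ 2) by ring,
          abs_mul, abs_mul, abs_pow]
        calc _ ≤ 1 * (G * (K * β) ^ 2) := by gcongr
          _ = G * (K ^ 2 * (β * β)) := by ring
          _ ≤ G * (K ^ 2 * (2 * β)) := by gcongr)
    rw [Real.norm_eq_abs, show -(L / 2) + 2 - -(L / 2) = 2 by ring, abs_two] at this
    linarith
  have i2 : (∫ y in (-(L / 2) + 2)..(-1), (f₁ y - f₂ y)) = 0 := by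
    rw [intervalIntegral.integral_congr (g := fun _ => 0), intervalIntegral.integral_zero]
    intro y hy
    rw [uIcc_of_le (by linarith)] at hy
    obtain ⟨e2, e3⟩ := h.layer_eq_left (y := y) hy.2
    simp only [f₁, f₂, e2, e3, h.layerCut_eq_one hy.1 (by linarith [hy.2])]
    ring
  have i3 : |∫ y in (-1)..0, (f₁ y - f₂ y)| ≤ C * (K * Real.exp Λ * (β + β')) := by
    have := intervalIntegral.norm_integral_le_of_norm_le_const (a := -1) (b := 0)
      (f := fun y => f₁ y - f₂ y) (C := C * (K * Real.exp Λ * (β + β'))) (fun y hy => by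
        rw [uIoc_of_le (by norm_num)] at hy
        have := h.transition_bound (y := y) (by rw [abs_le]; constructor <;> linarith [hy.1, hy.2])
        simp only [f₁, f₂, h.layerCut_eq_one (y := y) (by linarith [hy.1]) (by linarith [hy.2])]
        rw [one_mul]
        exact this)
    simpa using this
  have e4 : (∫ y in -(L / 2)..0, f₁ y) - ∫ y in -(L / 2)..0, f₂ y
      = (∫ y in -(L / 2)..(-(L / 2) + 2), (f₁ y - f₂ y)) + ∫ y in (-1)..0, (f₁ y - f₂ y) := by
    rw [← intervalIntegral.integral_sub (cf₁.intervalIntegrable _ _) (cf₂.intervalIntegrable _ _),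
      ← intervalIntegral.integral_add_adjacent_intervals
        (cd.intervalIntegrable (-(L / 2)) (-(L / 2) + 2)) (cd.intervalIntegrable _ 0),
      ← intervalIntegral.integral_add_adjacent_intervals
        (cd.intervalIntegrable (-(L / 2) + 2) (-1)) (cd.intervalIntegrable _ 0), i2, zero_add]
  have e5 : (∫ y in -(L / 2)..0, f₁ y) - ∫ s in (0 : ℝ)..1, √(2 * F (σ * s)) * g (σ * s)
      = ((∫ y in -(L / 2)..0, f₁ y) - ∫ y in -(L / 2)..0, f₂ y)
        + ((∫ y in -(L / 2)..0, f₂ y) - ∫ s in (0 : ℝ)..1, √(2 * F (σ * s)) * g (σ * s)) := by ring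
  rw [e5, e4]
  refine (abs_add_le _ _).trans ?_
  have h2 := abs_add_le (∫ y in -(L / 2)..(-(L / 2) + 2), (f₁ y - f₂ y))
    (∫ y in (-1)..0, (f₁ y - f₂ y))
  have h3 : 0 ≤ (K * G + 4 * G * K ^ 2) * β' := by positivity
  linarith

/-- The contribution of a layer to a diagonal product. -/
lemma mass (h : LayerPair F χ g σ A K L₀ Λ X G φ p q φ' p' q' L L') (hF : Continuous F) :
    |(∫ y in -(L / 2)..L' / 2, layerCut χ L L' y * (g (layerFun χ (φ L) (φ' L') L L' y)
        * layerDeriv χ (φ L) (p L) (φ' L') (p' L') L L' y ^ 2)) - weightConst F g|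
      ≤ 2 * (K * G + 4 * G * K ^ 2 + (Λ * (2 * K + 2 * X) ^ 2
        + G * ((1 + X) * ((2 * K + 2 * X) + K))) * (K * Real.exp Λ))
        * ((1 - σ * φ L 0) + (1 - -σ * φ' L' 0)) := by
  obtain ⟨c1, c2, c3⟩ := h.continuous_layer
  have c6 := h.g_cont
  set f₁ : ℝ → ℝ := fun y => layerCut χ L L' y * (g (layerFun χ (φ L) (φ' L') L L' y)
        * layerDeriv χ (φ L) (p L) (φ' L') (p' L') L L' y ^ 2)
  have cf₁ : Continuous f₁ := by fun_prop
  have h1 := h.half_mass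
  have h2 := h.reflect.half_mass
  have e1 : (∫ y in -(L' / 2)..0, layerCut (fun y => 1 - χ (-y)) L' L y *
      (g (layerFun (fun y => 1 - χ (-y)) (φ' L') (φ L) L' L y)
        * layerDeriv (fun y => 1 - χ (-y)) (φ' L') (p' L') (φ L) (p L) L' L y ^ 2))
      = ∫ y in (0 : ℝ)..L' / 2, f₁ y := by
    rw [← neg_zero, ← intervalIntegral.integral_comp_neg, neg_zero]
    refine intervalIntegral.integral_congr fun y _ => ?_
    simp only [layerCut_reflect, layerFun_reflect, layerDeriv_reflect, f₁, neg_sq]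
  rw [e1] at h2
  rw [← weightConst_eq hF c6 h.hσ, ← intervalIntegral.integral_add_adjacent_intervals
    (cf₁.intervalIntegrable (-(L / 2)) 0) (cf₁.intervalIntegrable 0 (L' / 2)), add_sub_add_comm]
  refine (abs_add_le _ _).trans ?_
  rw [neg_neg] at h2
  simp only [f₁] at h2 ⊢
  linarith

/-- The contribution of the correction `w` from the left profile. -/
lemma correction_le (h : LayerPair F χ g σ A K L₀ Λ X G φ p q φ' p' q' L L') :
    |∫ y in -(L / 2)..L' / 2, layerCut χ L L' y * (g (layerFun χ (φ L) (φ' L') L L' y)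
        * ((1 - χ y) * (q L (L / 2 + y) + p L (L / 2 + y) / 2)
          * layerDeriv χ (φ L) (p L) (φ' L') (p' L') L L' y))|
      ≤ G * K * (2 + 2 * (2 * K + 2 * X)) * (1 - σ * φ L 0) := by
  obtain ⟨c1, c2, c3⟩ := h.continuous_layer
  obtain ⟨c4, c5, c7⟩ := h.continuous_left
  have c6 := h.g_cont
  have c8 := h.hχ.continuous
  have hK := h.one_le_K
  have hG := h.G_nonneg
  have hX := h.X_nonneg
  obtain ⟨hL8, hL8'⟩ := h.eight_lt
  set β := 1 - σ * φ L 0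
  have hβ : 0 < β := h.E.beta_pos L h.hL
  set f₁ : ℝ → ℝ := fun y => layerCut χ L L' y * (g (layerFun χ (φ L) (φ' L') L L' y)
        * ((1 - χ y) * (q L (L / 2 + y) + p L (L / 2 + y) / 2)
          * layerDeriv χ (φ L) (p L) (φ' L') (p' L') L L' y))
  have cf₁ : Continuous f₁ := by fun_prop
  have hpt : ∀ y ∈ Icc (-(L / 2)) 1, |f₁ y|
      ≤ G * K * β * |layerDeriv χ (φ L) (p L) (φ' L') (p' L') L L' y| := by
    intro y hy
    have g1 := h.E.abs_w_le L h.hL (L / 2 + y) ⟨by linarith [hy.1], by linarith [hy.2]⟩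
    have g2 := h.abs_g_layerFun_le y
    have g3 := h.hχ.abs_layerCut_le L L' y
    have g4 := h.hχ.abs_one_sub_le y
    simp only [f₁, abs_mul]
    calc _ ≤ 1 * (G * (1 * (K * β)
          * |layerDeriv χ (φ L) (p L) (φ' L') (p' L') L L' y|)) := by gcongr
      _ = _ := by ring
  have i1 : |∫ y in -(L / 2)..(-1), f₁ y| ≤ G * K * β * 2 := by
    have hd : ∀ y, HasDerivAt (fun y => G * K * β * (-σ * φ L (L / 2 + y)))
        (G * K * β * (-σ * p L (L / 2 + y))) y := fun y =>
      ((((h.hasDerivAt_left _).comp y ((hasDerivAt_id y).const_add (L / 2))).const_mul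
        (-σ)).const_mul (G * K * β)).congr_deriv (by simp)
    have cd : Continuous fun y => G * K * β * (-σ * p L (L / 2 + y)) := by fun_prop
    have := intervalIntegral.norm_integral_le_of_norm_le (a := -(L / 2)) (b := -1)
      (f := f₁) (μ := volume) (g := fun y => G * K * β * (-σ * p L (L / 2 + y))) (by linarith)
      (Filter.Eventually.of_forall fun y hy => by
        refine (hpt y ⟨hy.1.le, by linarith [hy.2]⟩).trans ?_
        rw [(h.layer_eq_left hy.2).2]
        have s := h.E.p_sign L h.hL (L / 2 + y) ⟨by linarith [hy.1], by linarith [hy.2]⟩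
        have : |p L (L / 2 + y)| = -σ * p L (L / 2 + y) := by
          rcases h.hσ with rfl | rfl
          · rw [abs_of_nonpos (by linarith)]; ring
          · rw [abs_of_nonneg (by linarith)]; ring
        rw [this]) (cd.intervalIntegrable _ _)
    rw [intervalIntegral.integral_eq_sub_of_hasDerivAt (fun y _ => hd y)
      (cd.intervalIntegrable _ _), Real.norm_eq_abs] at this
    refine this.trans ?_
    rw [← mul_sub]
    have h1 := abs_le.1 (h.E.abs_le L h.hL (L / 2 + -1))
    have h2 := abs_le.1 (h.E.abs_le L h.hL (L / 2 + -(L / 2)))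
    gcongr
    rcases h.hσ with h | h <;> rw [h] <;> linarith [h1.1, h1.2, h2.1, h2.2]
  have i2 : |∫ y in (-1)..1, f₁ y| ≤ G * K * β * (2 * K + 2 * X) * 2 := by
    have := intervalIntegral.norm_integral_le_of_norm_le_const (a := -1) (b := 1)
      (f := f₁) (C := G * K * β * (2 * K + 2 * X)) (fun y hy => by
        rw [uIoc_of_le (by norm_num)] at hy
        refine (hpt y ⟨by linarith [hy.1], hy.2⟩).trans ?_
        have := h.abs_layerDeriv_le y
        gcongr)
    rw [show (1 : ℝ) - -1 = 2 by norm_num, abs_two] at this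
    exact this
  have i3 : (∫ y in 1..L' / 2, f₁ y) = 0 := by
    rw [intervalIntegral.integral_congr (g := fun _ => 0), intervalIntegral.integral_zero]
    intro y hy
    rw [uIcc_of_le (by linarith)] at hy
    simp [f₁, h.hχ.eq_one y hy.1]
  rw [← intervalIntegral.integral_add_adjacent_intervals
    (cf₁.intervalIntegrable (-(L / 2)) (-1)) (cf₁.intervalIntegrable (-1) _),
    ← intervalIntegral.integral_add_adjacent_intervals
    (cf₁.intervalIntegrable (-1) 1) (cf₁.intervalIntegrable 1 _), i3, add_zero]
  refine (abs_add_le _ _).trans ?_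
  linarith

/-- The contribution of the correction `w` from the right profile. -/
lemma correction_le' (h : LayerPair F χ g σ A K L₀ Λ X G φ p q φ' p' q' L L') :
    |∫ y in -(L / 2)..L' / 2, layerCut χ L L' y * (g (layerFun χ (φ L) (φ' L') L L' y)
        * (χ y * (q' L' (L' / 2 - y) + p' L' (L' / 2 - y) / 2)
          * layerDeriv χ (φ L) (p L) (φ' L') (p' L') L L' y))|
      ≤ G * K * (2 + 2 * (2 * K + 2 * X)) * (1 - -σ * φ' L' 0) := by
  have h1 := h.reflect.correction_le
  rw [show L / 2 = - -(L / 2) by ring, ← intervalIntegral.integral_comp_neg] at h1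
  rw [← abs_neg, ← intervalIntegral.integral_neg]
  convert h1 using 2
  refine intervalIntegral.integral_congr fun y _ => ?_
  simp only [layerCut_reflect, layerFun_reflect, layerDeriv_reflect, neg_neg, sub_sub_cancel,
    ← sub_eq_add_neg]
  ring

end LayerPair

/-! ### Layer positions -/

/-- The derivative of `node h k` with respect to the entry `j` of `h`. -/
noncomputable def nodeDeriv {N : ℕ} (j : Fin N) (k : ℕ) : ℝ :=
  if k = 0 then -(if (j : ℕ) = 0 then 1 else 0)
  else if k ≤ N then (if k = j + 1 then 1 else 0) else -(if (j : ℕ) + 1 = N then 1 else 0)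

section Nodes

variable {N : ℕ}

lemma hasDerivAt_entry (h : Fin N → ℝ) (j : Fin N) {k : ℕ} (hk : 1 ≤ k) (hkN : k ≤ N) (t : ℝ) :
    HasDerivAt (fun s => entry (Function.update h j s) k) (if k = j + 1 then 1 else 0) t := by
  have hlt : k - 1 < N := by omega
  simp only [entry, hlt, dif_pos]
  by_cases hj : k = j + 1
  · have : (⟨k - 1, hlt⟩ : Fin N) = j := Fin.ext (by simp [hj])
    simp only [this, Function.update_self, if_pos hj]
    exact hasDerivAt_id' t
  · have : (⟨k - 1, hlt⟩ : Fin N) ≠ j := fun e => hj (by rw [← e]; simp; omega)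
    simp only [Function.update_of_ne this, hj, if_false]
    exact hasDerivAt_const _ _

lemma hasDerivAt_node (h : Fin N → ℝ) (j : Fin N) (k : ℕ) (t : ℝ) :
    HasDerivAt (fun s => node (Function.update h j s) k) (nodeDeriv j k) t := by
  have hN : 1 ≤ N := j.pos
  unfold node nodeDeriv
  split_ifs with h1 h2 h3 h4 h5
  · have := (hasDerivAt_entry h j le_rfl hN t).fun_neg
    simpa [h2] using this
  · have := (hasDerivAt_entry h j le_rfl hN t).fun_neg
    have h2' : ¬1 = (j : ℕ) + 1 := by omega
    simpa [h2, h2'] using this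
  · have := hasDerivAt_entry h j (by omega) h3 t
    simpa only [if_pos h4] using this
  · have := hasDerivAt_entry h j (by omega) h3 t
    simpa only [if_neg h4] using this
  · have := (hasDerivAt_entry h j hN le_rfl t).const_sub 2
    simpa only [if_pos h5.symm] using this
  · have := (hasDerivAt_entry h j hN le_rfl t).const_sub 2
    simpa only [if_neg (Ne.symm h5)] using this

lemma nodeDeriv_self (j : Fin N) : nodeDeriv j (j + 1) = 1 := by
  have := j.2
  simp [nodeDeriv]

lemma nodeDeriv_eq_zero {i j : Fin N} (hij : i ≠ j) : nodeDeriv j (i + 1) = 0 := by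
  have := i.2
  have : (i : ℕ) ≠ j := fun e => hij (Fin.ext e)
  simp [nodeDeriv]
  omega

/-- The left neighbour of the layer `i` moves with `h_j` only if it is the layer `j`, or if it is
the reflection `h_0` of the layer `i = j`. -/
lemma nodeDeriv_pred_eq_zero {i j : Fin N} (hij : i ≠ j) (h : (i : ℕ) ≠ j + 1) :
    nodeDeriv j i = 0 := by
  have := i.2
  have : (i : ℕ) ≠ j := fun e => hij (Fin.ext e)
  unfold nodeDeriv
  split_ifs <;> first | contradiction | omega | simp

lemma nodeDeriv_succ_eq_zero {i j : Fin N} (hij : i ≠ j) (h : (j : ℕ) ≠ i + 1) :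
    nodeDeriv j (i + 2) = 0 := by
  have := i.2
  have := j.2
  have : (i : ℕ) ≠ j := fun e => hij (Fin.ext e)
  unfold nodeDeriv
  split_ifs <;> first | contradiction | omega | simp

lemma abs_nodeDeriv_le (j : Fin N) (k : ℕ) : |nodeDeriv j k| ≤ 1 := by
  unfold nodeDeriv
  split_ifs <;> norm_num

lemma mid_zero (h : Fin N → ℝ) (hN : 0 < N) : mid h 0 = 0 := by
  have : 1 ≤ N := hN
  simp [mid, node, this]

lemma mid_last (h : Fin N → ℝ) (hN : 0 < N) : mid h N = 1 := by
  simp [mid, node, hN.ne']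

variable {h : Fin N → ℝ} {ε : ℝ}

lemma mid_bounds (hε : 0 < ε) (hg : ∀ k ≤ N, 8 * ε < gap h k) {k : ℕ} (hk : k ≤ N) :
    node h k + 4 * ε < mid h k ∧ mid h k + 4 * ε < node h (k + 1) := by
  have := hg k hk
  simp only [gap] at this
  simp only [mid]
  constructor <;> linarith

lemma mid_mono (hε : 0 < ε) (hg : ∀ k ≤ N, 8 * ε < gap h k) {i k : ℕ} (hik : i ≤ k) (hk : k ≤ N) :
    mid h i ≤ mid h k := by
  induction k, hik using Nat.le_induction with
  | base => exact le_rfl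
  | succ k hik ih =>
    have h1 := (mid_bounds hε hg (k := k) (by omega)).2
    have h2 := (mid_bounds hε hg hk).1
    linarith [ih (by omega)]

lemma exists_piece (h : Fin N → ℝ) (x : ℝ) {n : ℕ} (hn : 1 ≤ n) :
    ∃ p, 1 ≤ p ∧ p ≤ n ∧ (p = 1 ∨ mid h (p - 1) ≤ x) ∧ (p = n ∨ x < mid h p) := by
  induction n, hn using Nat.le_induction with
  | base => exact ⟨1, le_rfl, le_rfl, Or.inl rfl, Or.inl rfl⟩
  | succ n hn ih =>
    obtain ⟨p, h1, h2, h3, h4⟩ := ih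
    rcases h4 with rfl | h4
    · rcases lt_or_ge x (mid h p) with hx | hx
      · exact ⟨p, h1, by omega, h3, Or.inr hx⟩
      · exact ⟨p + 1, by omega, le_rfl, Or.inr (by simpa using hx), Or.inl rfl⟩
    · exact ⟨p, h1, by omega, h3, Or.inr h4⟩

lemma pieceIndex_eq (hε : 0 < ε) (hg : ∀ k ≤ N, 8 * ε < gap h k) {x : ℝ} {p : ℕ} (h1 : 1 ≤ p)
    (h2 : p ≤ N) (h3 : p = 1 ∨ mid h (p - 1) ≤ x) (h4 : p = N ∨ x < mid h p) :
    pieceIndex h x = p := by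
  have : (Finset.Icc 1 (N - 1)).filter (fun i => mid h i ≤ x) = Finset.Icc 1 (p - 1) := by
    ext i
    simp only [Finset.mem_filter, Finset.mem_Icc]
    constructor
    · rintro ⟨⟨hi1, hi2⟩, hix⟩
      refine ⟨hi1, ?_⟩
      by_contra! hcon
      rcases h4 with rfl | h4
      · omega
      · have := mid_mono hε hg (show p ≤ i by omega) (by omega)
        linarith
    · rintro ⟨hi1, hi2⟩
      refine ⟨⟨hi1, by omega⟩, ?_⟩
      rcases h3 with rfl | h3
      · omega
      · exact (mid_mono hε hg hi2 (by omega)).trans h3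
  rw [pieceIndex, this, Nat.card_Icc]
  omega

end Nodes

/-! ### The base function near one layer -/

/-- The formula for `u^h` on the interval `I_k`, regarded as a function on the whole line. -/
noncomputable def pieceFun (F χ : ℝ → ℝ) (ε : ℝ) {N : ℕ} (h : Fin N → ℝ) (k : ℕ) (x : ℝ) : ℝ :=
  (1 - χ ((x - node h k) / ε)) * steadyAt F ε h k x
    + χ ((x - node h k) / ε) * steadyAt F ε h (k + 1) x

/-- The formula of the interval `I_k` is valid on a larger interval, because neighbouring
formulas agree between the transition regions of the two layers. -/
lemma baseFun_eq_pieceFun {F χ : ℝ → ℝ} (hχ : IsCutoff χ) {ε : ℝ} {N : ℕ} {h : Fin N → ℝ}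
    (hε : 0 < ε) (hg : ∀ k ≤ N, 8 * ε < gap h k) {k : ℕ} (hk : 1 ≤ k) (hkN : k ≤ N) {x : ℝ}
    (hl : k = 1 ∨ node h (k - 1) + ε < x) (hr : k = N ∨ x < node h (k + 1) - ε) :
    baseFun F χ ε h x = pieceFun F χ ε h k x := by
  obtain ⟨p, h1, h2, h3, h4⟩ := exists_piece h x (hk.trans hkN)
  have hbase : baseFun F χ ε h x = pieceFun F χ ε h p x := by
    rw [baseFun, pieceIndex_eq hε hg h1 h2 h3 h4, pieceFun]
  have hone : ∀ i, node h i + ε ≤ x → pieceFun F χ ε h i x = steadyAt F ε h (i + 1) x :=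
    fun i hi => by
      rw [pieceFun, hχ.eq_one _ (by rw [le_div_iff₀ hε]; linarith)]; ring
  have hzero : ∀ i, x ≤ node h i - ε → pieceFun F χ ε h i x = steadyAt F ε h i x :=
    fun i hi => by
      rw [pieceFun, hχ.eq_zero _ (by rw [div_le_iff₀ hε]; linarith)]; ring
  rw [hbase]
  rcases lt_trichotomy p k with hpk | rfl | hpk
  · have hx1 : x < mid h p := h4.resolve_left (by omega)
    have hx2 : node h (k - 1) + ε < x := hl.resolve_left (by omega)
    have hb := (mid_bounds hε hg (k := k - 1) (by omega)).2
    rw [show k - 1 + 1 = k by omega] at hb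
    have hp : p = k - 1 := by
      by_contra hne
      have e1 := mid_mono hε hg (show p ≤ k - 2 by omega) (by omega)
      have e2 := (mid_bounds hε hg (k := k - 2) (by omega)).2
      rw [show k - 2 + 1 = k - 1 by omega] at e2
      linarith
    subst hp
    rw [hone _ hx2.le, hzero k (by linarith), show k - 1 + 1 = k by omega]
  · rfl
  · have hx1 : mid h (p - 1) ≤ x := h3.resolve_left (by omega)
    have hx2 : x < node h (k + 1) - ε := hr.resolve_left (by omega)
    have hp : p = k + 1 := by
      by_contra hne
      have e1 := mid_mono hε hg (show k + 1 ≤ p - 1 by omega) (by omega)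
      have e2 := (mid_bounds hε hg (k := k + 1) (by omega)).1
      linarith
    subst hp
    rw [Nat.add_sub_cancel] at hx1
    have e2 := (mid_bounds hε hg (k := k) (by omega)).1
    rw [hzero _ hx2.le, hone k (by linarith)]

/-- The estimates for the profiles of both signs, with the sign as an argument. -/
def BothSigns (F : ℝ → ℝ) (K L₀ : ℝ) (p q : ℝ → ℝ → ℝ → ℝ) : Prop :=
  1 ≤ K ∧ 8 ≤ L₀ ∧ ∀ σ, σ = 1 ∨ σ = -1 →
    ProfileEstimates F σ (decayRate F) K L₀ (fun L => profile F L σ) (p σ) (q σ)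

section Derivatives

variable {F χ : ℝ → ℝ} {K L₀ : ℝ} {p q : ℝ → ℝ → ℝ → ℝ}

/-- The derivative of the glued function along a motion of the two lengths and of the point: a
translation, and two correction terms. -/
lemma hasDerivAt_layerFun (B : BothSigns F K L₀ p q) (hχ : IsCutoff χ) {σ : ℝ}
    (hσ : σ = 1 ∨ σ = -1) {L L' y : ℝ → ℝ} {t l l' η : ℝ} (hL : L₀ < L t) (hL' : L₀ < L' t)
    (dL : HasDerivAt L l t) (dL' : HasDerivAt L' l' t) (dy : HasDerivAt y η t) :
    HasDerivAt (fun s => layerFun χ (profile F (L s) σ) (profile F (L' s) (-σ)) (L s) (L' s) (y s))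
      (η * layerDeriv χ (profile F (L t) σ) (p σ (L t)) (profile F (L' t) (-σ)) (p (-σ) (L' t))
          (L t) (L' t) (y t)
        + (1 - χ (y t)) * (l * (q σ (L t) (L t / 2 + y t) + p σ (L t) (L t / 2 + y t) / 2))
        + χ (y t) * (l' * (q (-σ) (L' t) (L' t / 2 - y t)
          + p (-σ) (L' t) (L' t / 2 - y t) / 2))) t := by
  have hσ' : -σ = 1 ∨ -σ = -1 := by rcases hσ with rfl | rfl <;> simp
  have h1 : HasDerivAt (fun s => profile F (L s) σ (L s / 2 + y s))
      (p σ (L t) (L t / 2 + y t) * (l / 2 + η) + q σ (L t) (L t / 2 + y t) * l) t := by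
    have e : HasDerivAt (fun s => (L s / 2 + y s, L s)) ((l / 2 + η, l) : ℝ × ℝ) t :=
      ((dL.div_const 2).fun_add dy).prodMk dL
    have := ((B.2.2 σ hσ).hasFDerivAt (L t) hL (L t / 2 + y t)).comp_hasDerivAt t e
    exact this.congr_deriv (by simp)
  have h2 : HasDerivAt (fun s => profile F (L' s) (-σ) (L' s / 2 - y s))
      (p (-σ) (L' t) (L' t / 2 - y t) * (l' / 2 - η) + q (-σ) (L' t) (L' t / 2 - y t) * l') t := by
    have e : HasDerivAt (fun s => (L' s / 2 - y s, L' s)) ((l' / 2 - η, l') : ℝ × ℝ) t :=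
      ((dL'.div_const 2).fun_sub dy).prodMk dL'
    have := ((B.2.2 (-σ) hσ').hasFDerivAt (L' t) hL' (L' t / 2 - y t)).comp_hasDerivAt t e
    exact this.congr_deriv (by simp)
  have h3 : HasDerivAt (fun s => χ (y s)) (deriv χ (y t) * η) t :=
    (hχ.differentiable (y t)).hasDerivAt.comp t dy
  have h4 := ((h3.const_sub 1).fun_mul h1).fun_add (h3.fun_mul h2)
  refine h4.congr_deriv ?_
  rw [layerDeriv]
  ring

variable {ε : ℝ} {N : ℕ} {h : Fin N → ℝ}

lemma pieceFun_eq_layerFun (B : BothSigns F K L₀ p q) (hε : 0 < ε) {k : ℕ} (hk : 1 ≤ k)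
    (hgk : L₀ < gap h k / ε) (x : ℝ) :
    pieceFun F χ ε h k x = layerFun χ (profile F (gap h (k - 1) / ε) ((-1) ^ k))
      (profile F (gap h k / ε) (-(-1) ^ k)) (gap h (k - 1) / ε) (gap h k / ε)
      ((x - node h k) / ε) := by
  have hσ' : -(-1 : ℝ) ^ k = 1 ∨ -(-1 : ℝ) ^ k = -1 := by
    rcases neg_one_pow_eq_or ℝ k with e | e <;> simp [e]
  have e1 : (x - mid h (k - 1)) / ε = gap h (k - 1) / ε / 2 + (x - node h k) / ε := by
    simp only [mid, gap, show k - 1 + 1 = k by omega]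
    field_simp
    ring
  have e2 : (x - mid h k) / ε = -(gap h k / ε / 2 - (x - node h k) / ε) := by
    simp only [mid, gap]
    field_simp
    ring
  have e3 : (-1 : ℝ) ^ (k + 1) = -(-1) ^ k := by rw [pow_succ]; ring
  simp only [pieceFun, layerFun, steadyAt, steady, Nat.add_sub_cancel, e1, e2, e3]
  rw [(B.2.2 _ hσ').even _ hgk]

lemma gap_bound (B : BothSigns F K L₀ p q) (hε : 0 < ε) (hg : ∀ k ≤ N, L₀ * ε < gap h k) :
    ∀ k ≤ N, 8 * ε < gap h k := fun k hk =>
  lt_of_le_of_lt (mul_le_mul_of_nonneg_right B.2.1 hε.le) (hg k hk)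

lemma lt_gap_div (hε : 0 < ε) (hg : ∀ k ≤ N, L₀ * ε < gap h k) {k : ℕ} (hk : k ≤ N) :
    L₀ < gap h k / ε := (lt_div_iff₀ hε).2 (hg k hk)

lemma hasDerivAt_baseFun (B : BothSigns F K L₀ p q) (hχ : IsCutoff χ) (hε : 0 < ε)
    (hg : ∀ k ≤ N, L₀ * ε < gap h k) {k : ℕ} (hk : 1 ≤ k) (hkN : k ≤ N) {x : ℝ}
    (hl : k = 1 ∨ node h (k - 1) + ε < x) (hr : k = N ∨ x < node h (k + 1) - ε) :
    HasDerivAt (fun y => baseFun F χ ε h y)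
      (ε⁻¹ * layerDeriv χ (profile F (gap h (k - 1) / ε) ((-1) ^ k))
        (p ((-1) ^ k) (gap h (k - 1) / ε)) (profile F (gap h k / ε) (-(-1) ^ k))
        (p (-(-1) ^ k) (gap h k / ε)) (gap h (k - 1) / ε) (gap h k / ε) ((x - node h k) / ε)) x := by
  have hgk := lt_gap_div hε hg hkN
  have h8 := gap_bound B hε hg
  have d := hasDerivAt_layerFun B hχ (neg_one_pow_eq_or ℝ k) (t := x)
    (lt_gap_div hε hg (show k - 1 ≤ N by omega)) hgk
    (hasDerivAt_const x (gap h (k - 1) / ε)) (hasDerivAt_const x (gap h k / ε))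
    (((hasDerivAt_id x).sub_const (node h k)).div_const ε)
  have hev : (fun y => baseFun F χ ε h y) =ᶠ[nhds x] fun y =>
      layerFun χ (profile F (gap h (k - 1) / ε) ((-1) ^ k))
      (profile F (gap h k / ε) (-(-1) ^ k)) (gap h (k - 1) / ε) (gap h k / ε)
      ((y - node h k) / ε) := by
    have e1 : ∀ᶠ y in nhds x, k = 1 ∨ node h (k - 1) + ε < y := by
      rcases hl with hl | hl
      · exact Filter.Eventually.of_forall fun _ => Or.inl hl
      · exact (eventually_gt_nhds hl).mono fun _ h => Or.inr h
    have e2 : ∀ᶠ y in nhds x, k = N ∨ y < node h (k + 1) - ε := by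
      rcases hr with hr | hr
      · exact Filter.Eventually.of_forall fun _ => Or.inl hr
      · exact (eventually_lt_nhds hr).mono fun _ h => Or.inr h
    filter_upwards [e1, e2] with y h1 h2
    rw [baseFun_eq_pieceFun hχ hε h8 hk hkN h1 h2, pieceFun_eq_layerFun B hε hk hgk]
  refine (d.congr_of_eventuallyEq hev).congr_deriv ?_
  simp only [zero_mul, mul_zero, add_zero, one_div, id]

lemma hasDerivAt_baseFun_update (B : BothSigns F K L₀ p q) (hχ : IsCutoff χ) (hε : 0 < ε)
    (hg : ∀ k ≤ N, L₀ * ε < gap h k) {k : ℕ} (hk : 1 ≤ k) (hkN : k ≤ N) {x : ℝ}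
    (hl : k = 1 ∨ node h (k - 1) + ε < x) (hr : k = N ∨ x < node h (k + 1) - ε) (j : Fin N) :
    HasDerivAt (fun s => baseFun F χ ε (Function.update h j s) x)
      (ε⁻¹ * (-nodeDeriv j k * layerDeriv χ (profile F (gap h (k - 1) / ε) ((-1) ^ k))
        (p ((-1) ^ k) (gap h (k - 1) / ε)) (profile F (gap h k / ε) (-(-1) ^ k))
        (p (-(-1) ^ k) (gap h k / ε)) (gap h (k - 1) / ε) (gap h k / ε) ((x - node h k) / ε)
        + (nodeDeriv j k - nodeDeriv j (k - 1)) * ((1 - χ ((x - node h k) / ε))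
          * (q ((-1) ^ k) (gap h (k - 1) / ε) (gap h (k - 1) / ε / 2 + (x - node h k) / ε)
            + p ((-1) ^ k) (gap h (k - 1) / ε) (gap h (k - 1) / ε / 2 + (x - node h k) / ε) / 2))
        + (nodeDeriv j (k + 1) - nodeDeriv j k) * (χ ((x - node h k) / ε)
          * (q (-(-1) ^ k) (gap h k / ε) (gap h k / ε / 2 - (x - node h k) / ε)
            + p (-(-1) ^ k) (gap h k / ε) (gap h k / ε / 2 - (x - node h k) / ε) / 2)))) (h j) := by
  have dn := fun i => hasDerivAt_node h j i (h j)
  have dgap : ∀ i, HasDerivAt (fun s => gap (Function.update h j s) i)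
      (nodeDeriv j (i + 1) - nodeDeriv j i) (h j) := fun i => (dn (i + 1)).fun_sub (dn i)
  have hself : Function.update h j (h j) = h := Function.update_eq_self j h
  have cn : ∀ i, Filter.Tendsto (fun s => node (Function.update h j s) i) (nhds (h j))
      (nhds (node h i)) := fun i => by
    have := (dn i).continuousAt.tendsto
    rwa [hself] at this
  have hgev : ∀ᶠ s in nhds (h j), ∀ i ≤ N, L₀ * ε < gap (Function.update h j s) i := by
    have : ∀ᶠ s in nhds (h j), ∀ i ∈ Finset.range (N + 1),
        L₀ * ε < gap (Function.update h j s) i := by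
      rw [Filter.eventually_all_finset]
      intro i hi
      refine (dgap i).continuousAt.tendsto.eventually_const_lt ?_
      rw [hself]
      exact hg i (by simpa [Nat.lt_succ_iff] using hi)
    exact this.mono fun s hs i hi => hs i (by simpa [Nat.lt_succ_iff] using hi)
  have d := hasDerivAt_layerFun B hχ (neg_one_pow_eq_or ℝ k) (t := h j)
    (L := fun s => gap (Function.update h j s) (k - 1) / ε)
    (L' := fun s => gap (Function.update h j s) k / ε)
    (by rw [hself]; exact lt_gap_div hε hg (show k - 1 ≤ N by omega))
    (by rw [hself]; exact lt_gap_div hε hg hkN)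
    ((dgap (k - 1)).div_const ε) ((dgap k).div_const ε) (((dn k).const_sub x).div_const ε)
  have hev : (fun s => baseFun F χ ε (Function.update h j s) x) =ᶠ[nhds (h j)] fun s =>
      layerFun χ (profile F (gap (Function.update h j s) (k - 1) / ε) ((-1) ^ k))
      (profile F (gap (Function.update h j s) k / ε) (-(-1) ^ k))
      (gap (Function.update h j s) (k - 1) / ε) (gap (Function.update h j s) k / ε)
      ((x - node (Function.update h j s) k) / ε) := by
    have e1 : ∀ᶠ s in nhds (h j), k = 1 ∨ node (Function.update h j s) (k - 1) + ε < x := by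
      rcases hl with hl | hl
      · exact Filter.Eventually.of_forall fun _ => Or.inl hl
      · exact (((cn (k - 1)).add_const ε).eventually_lt_const hl).mono fun _ h => Or.inr h
    have e2 : ∀ᶠ s in nhds (h j), k = N ∨ x < node (Function.update h j s) (k + 1) - ε := by
      rcases hr with hr | hr
      · exact Filter.Eventually.of_forall fun _ => Or.inl hr
      · exact (((cn (k + 1)).sub_const ε).eventually_const_lt hr).mono fun _ h => Or.inr h
    filter_upwards [e1, e2, hgev] with s h1 h2 h3
    rw [baseFun_eq_pieceFun hχ hε (gap_bound B hε h3) hk hkN h1 h2,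
      pieceFun_eq_layerFun B hε hk (lt_gap_div hε h3 hkN)]
  refine (d.congr_of_eventuallyEq hev).congr_deriv ?_
  simp only [hself, show k - 1 + 1 = k by omega]
  ring

/-- Every point lies in the domain of validity of one of the formulas. -/
lemma exists_piece_domain (hε : 0 < ε) (hg : ∀ k ≤ N, 8 * ε < gap h k) (hN : 0 < N) (x : ℝ) :
    ∃ k, 1 ≤ k ∧ k ≤ N ∧ (k = 1 ∨ node h (k - 1) + ε < x) ∧
      (k = N ∨ x < node h (k + 1) - ε) := by
  obtain ⟨k, h1, h2, h3, h4⟩ := exists_piece h x (n := N) hN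
  refine ⟨k, h1, h2, h3.imp_right fun h => ?_, h4.imp_right fun h => ?_⟩
  · have := (mid_bounds hε hg (k := k - 1) (by omega)).1
    linarith
  · have := (mid_bounds hε hg h2).2
    linarith

end Derivatives

/-! ### Scalar products -/

lemma exists_dataBounds {F χ g : ℝ → ℝ} (hF : ContDiff ℝ 3 F) (hχ : IsCutoff χ)
    (hg : ContDiff ℝ 1 g) : ∃ Λ X G, DataBounds F χ g Λ X G := by
  obtain ⟨K₁, h1, h2⟩ :=
    exists_lipschitz_of_contDiff ((contDiff_three_derivs hF).2.1.of_le (by norm_num)) 1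
  obtain ⟨K₂, h3, h4⟩ := exists_lipschitz_of_contDiff hg 1
  obtain ⟨X, h5, h6⟩ := hχ.exists_bound_deriv
  obtain ⟨G, h7⟩ := (isCompact_Icc (a := (-1 : ℝ)) (b := 1)).exists_bound_of_continuousOn
    hg.continuous.continuousOn
  exact ⟨max K₁ K₂, X, G, h1.trans (le_max_left _ _),
    fun y z hy hz => (h2 y z hy hz).trans (by gcongr; exact le_max_left _ _), h5, h6,
    hg.continuous, h7, fun y z hy hz => (h4 y z hy hz).trans (by gcongr; exact le_max_right _ _)⟩

section Products

variable {F χ g : ℝ → ℝ} {K L₀ Λ X G ε : ℝ} {p q : ℝ → ℝ → ℝ → ℝ} {N : ℕ} {h : Fin N → ℝ}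

lemma layerPair_of_gaps (B : BothSigns F K L₀ p q) (hχ : IsCutoff χ)
    (D : DataBounds F χ g Λ X G) (hε : 0 < ε) (hg : ∀ k ≤ N, L₀ * ε < gap h k) (i : Fin N) :
    LayerPair F χ g ((-1) ^ ((i : ℕ) + 1)) (decayRate F) K L₀ Λ X G
      (fun L => profile F L ((-1) ^ ((i : ℕ) + 1))) (p ((-1) ^ ((i : ℕ) + 1)))
      (q ((-1) ^ ((i : ℕ) + 1))) (fun L => profile F L (-(-1) ^ ((i : ℕ) + 1)))
      (p (-(-1) ^ ((i : ℕ) + 1))) (q (-(-1) ^ ((i : ℕ) + 1)))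
      (gap h i / ε) (gap h (i + 1) / ε) where
  toDataBounds := D
  E := B.2.2 _ (neg_one_pow_eq_or ℝ _)
  E' := B.2.2 _ (by rcases neg_one_pow_eq_or ℝ ((i : ℕ) + 1) with e | e <;> simp [e])
  hχ := hχ
  one_le_K := B.1
  le_L₀ := B.2.1
  hL := lt_gap_div hε hg i.2.le
  hL' := lt_gap_div hε hg i.2
  hσ := neg_one_pow_eq_or ℝ _

lemma tangentCutoff_eq_layerCut (hε : 0 < ε) (h : Fin N → ℝ) (i : ℕ) (x : ℝ) :
    tangentCutoff χ ε h (i + 1) x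
      = layerCut χ (gap h i / ε) (gap h (i + 1) / ε) ((x - node h (i + 1)) / ε) := by
  have e1 : (x - mid h i - ε) / ε = (x - node h (i + 1)) / ε + gap h i / ε / 2 - 1 := by
    simp only [mid, gap]
    field_simp
    ring
  have e2 : (x - mid h (i + 1) + ε) / ε
      = (x - node h (i + 1)) / ε - gap h (i + 1) / ε / 2 + 1 := by
    simp only [mid, gap]
    field_simp
    ring
  rw [tangentCutoff, layerCut, Nat.add_sub_cancel, e1, e2]

lemma tangentCutoff_eq_zero (hχ : IsCutoff χ) (hε : 0 < ε) {i : ℕ} {x : ℝ}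
    (hx : x ≤ mid h i ∨ mid h (i + 1) ≤ x) : tangentCutoff χ ε h (i + 1) x = 0 := by
  rw [tangentCutoff, Nat.add_sub_cancel]
  rcases hx with hx | hx
  · rw [hχ.eq_zero _ (by rw [div_le_iff₀ hε]; linarith), zero_mul]
  · rw [hχ.eq_one ((x - mid h (i + 1) + ε) / ε) (by rw [le_div_iff₀ hε]; linarith), sub_self,
      mul_zero]

lemma mem_of_tangentCutoff_ne_zero (hχ : IsCutoff χ) (hε : 0 < ε) {i : ℕ} {x : ℝ}
    (hx : tangentCutoff χ ε h (i + 1) x ≠ 0) : mid h i < x ∧ x < mid h (i + 1) := by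
  constructor <;> by_contra! hcon
  · exact hx (tangentCutoff_eq_zero hχ hε (Or.inl hcon))
  · exact hx (tangentCutoff_eq_zero hχ hε (Or.inr hcon))

/-- The support of `k^h_i` lies between two midpoints, where `u^h` is given by one formula; the
product is therefore a combination of three functions of the rescaled variable. -/
lemma productFun_eq (B : BothSigns F K L₀ p q) (hχ : IsCutoff χ) (hε : 0 < ε)
    (hg : ∀ k ≤ N, L₀ * ε < gap h k) (i j : Fin N) {f f' r r' s s' : ℝ → ℝ} {L L' : ℝ}
    (hf : f = profile F (gap h i / ε) ((-1) ^ ((i : ℕ) + 1)))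
    (hf' : f' = profile F (gap h (i + 1) / ε) (-(-1) ^ ((i : ℕ) + 1)))
    (hr : r = p ((-1) ^ ((i : ℕ) + 1)) (gap h i / ε))
    (hr' : r' = p (-(-1) ^ ((i : ℕ) + 1)) (gap h (i + 1) / ε))
    (hs : s = q ((-1) ^ ((i : ℕ) + 1)) (gap h i / ε))
    (hs' : s' = q (-(-1) ^ ((i : ℕ) + 1)) (gap h (i + 1) / ε))
    (hL : L = gap h i / ε) (hL' : L' = gap h (i + 1) / ε) (x : ℝ) :
    productFun F χ g ε h j i x = (fun y => ε⁻¹ ^ 2 *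
      (nodeDeriv j (i + 1) * (layerCut χ L L' y * (g (layerFun χ f f' L L' y)
          * layerDeriv χ f r f' r' L L' y ^ 2))
        - (nodeDeriv j (i + 1) - nodeDeriv j i) * (layerCut χ L L' y *
          (g (layerFun χ f f' L L' y) * ((1 - χ y) * (s (L / 2 + y) + r (L / 2 + y) / 2)
            * layerDeriv χ f r f' r' L L' y)))
        - (nodeDeriv j (i + 2) - nodeDeriv j (i + 1)) * (layerCut χ L L' y *
          (g (layerFun χ f f' L L' y) * (χ y * (s' (L' / 2 - y) + r' (L' / 2 - y) / 2)
            * layerDeriv χ f r f' r' L L' y))))) ((x - node h (i + 1)) / ε) := by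
  have hcut := tangentCutoff_eq_layerCut (χ := χ) hε h i x
  have h8 := gap_bound B hε hg
  have hi := i.2
  by_cases hc : tangentCutoff χ ε h (i + 1) x = 0
  · rw [productFun, tangentVec, hc]
    rw [hc, ← hL, ← hL'] at hcut
    simp only [← hcut]
    ring
  · obtain ⟨hx1, hx2⟩ := mem_of_tangentCutoff_ne_zero hχ hε hc
    have b1 := (mid_bounds hε h8 (k := i) hi.le).1
    have b2 := (mid_bounds hε h8 (k := i + 1) hi).2
    have hi' : (i : ℕ) + 1 ≤ N := hi
    have dl : (i : ℕ) + 1 = 1 ∨ node h ((i : ℕ) + 1 - 1) + ε < x :=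
      Or.inr (by rw [Nat.add_sub_cancel]; linarith)
    have dr : (i : ℕ) + 1 = N ∨ x < node h ((i : ℕ) + 1 + 1) - ε := Or.inr (by linarith)
    rw [productFun, tangentVec, baseFunPartial,
      (hasDerivAt_baseFun B hχ hε hg (k := i + 1) (by omega)
        hi' dl dr).deriv,
      (hasDerivAt_baseFun_update B hχ hε hg (k := i + 1) (by omega)
        hi' dl dr j).deriv,
      baseFun_eq_pieceFun hχ hε h8 (k := i + 1) (by omega) hi' dl dr,
      pieceFun_eq_layerFun B hε (by omega) (lt_gap_div hε hg hi'), hcut]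
    subst hf hf' hr hr' hs hs' hL hL'
    simp only [Nat.add_sub_cancel]
    ring

/-- The scalar products with `k^h_i`, in terms of the motion of the layer `i` and of its two
neighbours. -/
lemma exists_scalarProd_eq (hF : Continuous F) (B : BothSigns F K L₀ p q) (hχ : IsCutoff χ)
    (D : DataBounds F χ g Λ X G) (hε : 0 < ε) (hg : ∀ k ≤ N, L₀ * ε < gap h k) (i : Fin N) :
    ∃ I₀ I₁ I₂ : ℝ,
      (∀ j, IntervalIntegrable (productFun F χ g ε h j i) volume 0 1 ∧
        scalarProd F χ g ε h j i = ε⁻¹ * (nodeDeriv j (i + 1) * I₀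
          - (nodeDeriv j (i + 1) - nodeDeriv j i) * I₁
          - (nodeDeriv j (i + 2) - nodeDeriv j (i + 1)) * I₂)) ∧
      |I₀ - weightConst F g| ≤ 2 * (K * G + 4 * G * K ^ 2 + (Λ * (2 * K + 2 * X) ^ 2
        + G * ((1 + X) * ((2 * K + 2 * X) + K))) * (K * Real.exp Λ))
        * (betaAt F ε h i + betaAt F ε h (i + 1)) ∧
      |I₁| ≤ G * K * (2 + 2 * (2 * K + 2 * X)) * betaAt F ε h i ∧
      |I₂| ≤ G * K * (2 + 2 * (2 * K + 2 * X)) * betaAt F ε h (i + 1) := by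
  have P := layerPair_of_gaps B hχ D hε hg i
  have b1 : betaAt F ε h i = 1 - (-1) ^ ((i : ℕ) + 1)
      * profile F (gap h i / ε) ((-1) ^ ((i : ℕ) + 1)) 0 := by
    rw [betaAt, betaFun, steady, zero_div]
  have b2 : betaAt F ε h (i + 1) = 1 - -(-1) ^ ((i : ℕ) + 1)
      * profile F (gap h (i + 1) / ε) (-(-1) ^ ((i : ℕ) + 1)) 0 := by
    rw [betaAt, betaFun, steady, zero_div, pow_succ _ ((i : ℕ) + 1), mul_neg_one]
  refine ⟨_, _, _, fun j => ?_, b1 ▸ b2 ▸ P.mass hF, b1 ▸ P.correction_le, b2 ▸ P.correction_le'⟩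
  have hp := productFun_eq (g := g) B hχ hε hg i j rfl rfl rfl rfl rfl rfl rfl rfl
  obtain ⟨c1, c2, c3⟩ := P.continuous_layer
  obtain ⟨-, c5, c6⟩ := P.continuous_left
  obtain ⟨-, c7, c8⟩ := P.reflect.continuous_left
  have c9 := D.g_cont
  have c10 := hχ.continuous
  set σ : ℝ := (-1) ^ ((i : ℕ) + 1)
  set L := gap h i / ε
  set L' := gap h (i + 1) / ε
  set U := layerFun χ (profile F L σ) (profile F L' (-σ)) L L'
  set V := layerDeriv χ (profile F L σ) (p σ L) (profile F L' (-σ)) (p (-σ) L') L L'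
  set f₀ : ℝ → ℝ := fun y => layerCut χ L L' y * (g (U y) * V y ^ 2)
  set f₁ : ℝ → ℝ := fun y => layerCut χ L L' y *
    (g (U y) * ((1 - χ y) * (q σ L (L / 2 + y) + p σ L (L / 2 + y) / 2) * V y))
  set f₂ : ℝ → ℝ := fun y => layerCut χ L L' y *
    (g (U y) * (χ y * (q (-σ) L' (L' / 2 - y) + p (-σ) L' (L' / 2 - y) / 2) * V y))
  have cf₀ : Continuous f₀ := by fun_prop
  have cf₁ : Continuous f₁ := by fun_prop
  have cf₂ : Continuous f₂ := by fun_prop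
  set Ψ : ℝ → ℝ := fun y => ε⁻¹ ^ 2 * (nodeDeriv j (i + 1) * f₀ y
    - (nodeDeriv j (i + 1) - nodeDeriv j i) * f₁ y
    - (nodeDeriv j (i + 2) - nodeDeriv j (i + 1)) * f₂ y)
  have cΨ : Continuous Ψ := by fun_prop
  have hp' : productFun F χ g ε h j i = fun x => Ψ ((x - node h (i + 1)) / ε) := funext hp
  have cp : Continuous (productFun F χ g ε h j i) := by rw [hp']; fun_prop
  refine ⟨cp.intervalIntegrable _ _, ?_⟩
  have h8 := gap_bound B hε hg
  have hN : 0 < N := i.pos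
  have m0 : 0 ≤ mid h i := by
    rw [← mid_zero h hN]; exact mid_mono hε h8 (Nat.zero_le _) i.2.le
  have m1 : mid h (i + 1) ≤ 1 := by
    rw [← mid_last h hN]; exact mid_mono hε h8 i.2 le_rfl
  have hzero : ∀ x, x ≤ mid h i ∨ mid h (i + 1) ≤ x → productFun F χ g ε h j i x = 0 :=
    fun x hx => by rw [productFun, tangentVec, tangentCutoff_eq_zero hχ hε hx]; ring
  have z1 : (∫ x in (0 : ℝ)..mid h i, productFun F χ g ε h j i x) = 0 := by
    rw [intervalIntegral.integral_congr (g := fun _ => 0), intervalIntegral.integral_zero]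
    intro x hx
    rw [uIcc_of_le m0] at hx
    exact hzero x (Or.inl hx.2)
  have z2 : (∫ x in mid h (i + 1)..1, productFun F χ g ε h j i x) = 0 := by
    rw [intervalIntegral.integral_congr (g := fun _ => 0), intervalIntegral.integral_zero]
    intro x hx
    rw [uIcc_of_le m1] at hx
    exact hzero x (Or.inr hx.1)
  have e1 : mid h i / ε - node h (i + 1) / ε = -(L / 2) := by
    simp only [mid, gap, L]; ring
  have e2 : mid h (i + 1) / ε - node h (i + 1) / ε = L' / 2 := by
    simp only [mid, gap, L']; ring
  rw [scalarProd, ← intervalIntegral.integral_add_adjacent_intervals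
    (cp.intervalIntegrable 0 (mid h i)) (cp.intervalIntegrable _ 1), z1, zero_add,
    ← intervalIntegral.integral_add_adjacent_intervals
    (cp.intervalIntegrable (mid h i) (mid h (i + 1))) (cp.intervalIntegrable _ 1), z2, add_zero,
    hp']
  simp only [sub_div]
  rw [intervalIntegral.integral_comp_div_sub Ψ hε.ne', e1, e2, smul_eq_mul]
  simp only [Ψ]
  rw [intervalIntegral.integral_const_mul, intervalIntegral.integral_sub,
    intervalIntegral.integral_sub, intervalIntegral.integral_const_mul,
    intervalIntegral.integral_const_mul, intervalIntegral.integral_const_mul]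
  · rw [← mul_assoc, show ε * ε⁻¹ ^ 2 = ε⁻¹ by field_simp]
  all_goals exact Continuous.intervalIntegrable (by fun_prop) _ _

lemma betaAt_pos (B : BothSigns F K L₀ p q) (hε : 0 < ε) (hg : ∀ k ≤ N, L₀ * ε < gap h k) {k : ℕ}
    (hk : k ≤ N) : 0 < betaAt F ε h k := by
  rw [betaAt, betaFun, steady, zero_div]
  exact (B.2.2 _ (neg_one_pow_eq_or ℝ _)).beta_pos _ (lt_gap_div hε hg hk)

lemma minGap_le (h : Fin N → ℝ) {k : ℕ} (hk : k ≤ N) : minGap h ≤ gap h k :=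
  ciInf_le (f := fun k : Fin (N + 1) => gap h k) (Set.finite_range _).bddBelow
    ⟨k, Nat.lt_succ_of_le hk⟩

lemma betaAt_le (B : BothSigns F K L₀ p q) (hε : 0 < ε) (hg : ∀ k ≤ N, L₀ * ε < gap h k) {k : ℕ}
    (hk : k ≤ N) :
    betaAt F ε h k ≤ K * Real.exp (-(decayRate F * minGap h / (2 * ε))) := by
  rw [betaAt, betaFun, steady, zero_div]
  refine ((B.2.2 _ (neg_one_pow_eq_or ℝ _)).beta_le _ (lt_gap_div hε hg hk)).trans ?_
  have hK := B.1
  have hA : 0 ≤ decayRate F := le_min (Real.sqrt_nonneg _) (Real.sqrt_nonneg _)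
  have := minGap_le h hk
  rw [show decayRate F * (gap h k / ε / 2) = decayRate F * gap h k / (2 * ε) by
    field_simp]
  gcongr

/-- The estimates of all scalar products, for one weight `g`. -/
lemma exists_scalarProd_estimates (hF : ContDiff ℝ 3 F) (B : BothSigns F K L₀ p q)
    (hχ : IsCutoff χ) (hg : ContDiff ℝ 1 g) :
    ∃ C > 0, ∀ ε > 0, ∀ (N : ℕ) (h : Fin N → ℝ), (∀ k ≤ N, L₀ * ε < gap h k) →
      (∀ i j, IntervalIntegrable (productFun F χ g ε h j i) volume 0 1) ∧
      (∀ j : Fin N, |scalarProd F χ g ε h j j - ε⁻¹ * weightConst F g|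
        ≤ C * ε⁻¹ * max (betaAt F ε h j) (betaAt F ε h (j + 1))) ∧
      (∀ j j' : Fin N, (j' : ℕ) = j + 1 →
        |scalarProd F χ g ε h j j'| + |scalarProd F χ g ε h j' j|
            ≤ C * ε⁻¹ * betaAt F ε h (j + 1)) ∧
      ∀ i j : Fin N, i ≠ j → (i : ℕ) ≠ j + 1 → (j : ℕ) ≠ i + 1 →
        scalarProd F χ g ε h j i = 0 := by
  obtain ⟨Λ, X, G, D⟩ := exists_dataBounds hF hχ hg
  have hK : 0 < K := zero_lt_one.trans_le B.1
  have hΛ : 0 < Λ := zero_lt_one.trans_le D.one_le_Λ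
  have hX := D.X_nonneg
  have hG : 0 ≤ G := (abs_nonneg _).trans (D.g_le 0 (by simp))
  set C₀ := 2 * (K * G + 4 * G * K ^ 2 + (Λ * (2 * K + 2 * X) ^ 2
        + G * ((1 + X) * ((2 * K + 2 * X) + K))) * (K * Real.exp Λ))
  set C₁ := G * K * (2 + 2 * (2 * K + 2 * X))
  have hC₀ : 0 < C₀ := by positivity
  have hC₁ : 0 ≤ C₁ := by positivity
  refine ⟨2 * C₀ + 4 * C₁, by linarith, fun ε hε N h hgap => ?_⟩
  have S := exists_scalarProd_eq (g := g) hF.continuous B hχ D hε hgap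
  choose I₀ I₁ I₂ hI hI₀ hI₁ hI₂ using S
  have hε' : 0 < ε⁻¹ := inv_pos.2 hε
  refine ⟨fun i j => (hI i j).1, fun j => ?_, fun j j' hjj => ?_, fun i j h1 h2 h3 => ?_⟩
  · have hn₀ := abs_nodeDeriv_le j j
    have hn₂ := abs_nodeDeriv_le j (j + 2)
    rw [(hI j j).2, nodeDeriv_self, one_mul, ← mul_sub, abs_mul, abs_of_pos hε']
    have m1 := le_max_left (betaAt F ε h j) (betaAt F ε h (j + 1))
    have m2 := le_max_right (betaAt F ε h j) (betaAt F ε h (j + 1))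
    set m := max (betaAt F ε h j) (betaAt F ε h (j + 1))
    have hm : 0 < m := (betaAt_pos B hε hgap j.2.le).trans_le m1
    have t1 : |(1 - nodeDeriv j j) * I₁ j| ≤ 2 * (C₁ * m) := by
      rw [abs_mul]
      have : |1 - nodeDeriv j j| ≤ 2 := by
        rw [abs_le] at hn₀ ⊢; constructor <;> linarith
      gcongr
      exact (hI₁ j).trans (by gcongr)
    have t2 : |(nodeDeriv j (j + 2) - 1) * I₂ j| ≤ 2 * (C₁ * m) := by
      rw [abs_mul]
      have : |nodeDeriv j (j + 2) - 1| ≤ 2 := by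
        rw [abs_le] at hn₂ ⊢; constructor <;> linarith
      gcongr
      exact (hI₂ j).trans (by gcongr)
    have t3 : |I₀ j - weightConst F g| ≤ C₀ * (m + m) := (hI₀ j).trans (by gcongr)
    rw [show (2 * C₀ + 4 * C₁) * ε⁻¹ * m = ε⁻¹ * (C₀ * (m + m) + 2 * (C₁ * m) + 2 * (C₁ * m)) by
      ring]
    gcongr
    rw [show I₀ j - (1 - nodeDeriv j j) * I₁ j - (nodeDeriv j (j + 2) - 1) * I₂ j
        - weightConst F g = (I₀ j - weightConst F g) - (1 - nodeDeriv j j) * I₁ j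
        - (nodeDeriv j (j + 2) - 1) * I₂ j by ring]
    exact (abs_sub _ _).trans (add_le_add ((abs_sub _ _).trans (add_le_add t3 t1)) t2)
  · have hne : j' ≠ j := fun e => by rw [e] at hjj; omega
    have hβ := betaAt_pos B hε hgap (k := j + 1) j.2
    have e1 := hI₁ j'
    rw [hjj] at e1
    have e2 := hI₂ j
    have n1 := abs_nodeDeriv_le j j'
    have n2 := abs_nodeDeriv_le j' (j + 2)
    have t1 : |nodeDeriv j j'| * |I₁ j'| ≤ 1 * (C₁ * betaAt F ε h (j + 1)) := by gcongr
    have t2 : |nodeDeriv j' (j + 2)| * |I₂ j| ≤ 1 * (C₁ * betaAt F ε h (j + 1)) := by gcongr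
    rw [(hI j' j).2, (hI j j').2, nodeDeriv_eq_zero hne, nodeDeriv_eq_zero hne.symm,
      nodeDeriv_succ_eq_zero hne (by omega), nodeDeriv_pred_eq_zero hne.symm (by omega)]
    simp only [zero_mul, zero_sub, sub_zero, sub_self, neg_mul, neg_neg, abs_mul, abs_neg,
      abs_of_pos hε']
    rw [← mul_add]
    calc _ ≤ ε⁻¹ * (1 * (C₁ * betaAt F ε h (j + 1)) + 1 * (C₁ * betaAt F ε h (j + 1))) := by
          gcongr
      _ = 2 * C₁ * (ε⁻¹ * betaAt F ε h (j + 1)) := by ring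
      _ ≤ (2 * C₀ + 4 * C₁) * (ε⁻¹ * betaAt F ε h (j + 1)) := by
          gcongr
          linarith
      _ = _ := by ring
  · rw [(hI i j).2, nodeDeriv_eq_zero h1, nodeDeriv_pred_eq_zero h1 h2,
      nodeDeriv_succ_eq_zero h1 h3]
    ring

end Products

/-! ### Perturbations of multiples of the identity matrix -/

section Matrices

variable {N : ℕ} {D B X : Matrix (Fin N) (Fin N) ℝ} {d c e e' : ℝ}

lemma isUnit_det_of_near_smul_one (hd : 0 < d)
    (hD : ∀ i j, |D i j - (if i = j then d else 0)| ≤ e) (he : N * e ≤ d / 2) : IsUnit D.det := by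
  refine isUnit_iff_ne_zero.2 (det_ne_zero_of_sum_row_lt_diag fun k => ?_)
  have h1 : ∑ j ∈ Finset.univ.erase k, ‖D k j‖ ≤ ∑ j ∈ Finset.univ.erase k, e :=
    Finset.sum_le_sum fun j hj => by
      have := hD k j
      rwa [if_neg (Finset.ne_of_mem_erase hj).symm, sub_zero] at this
  have h2 : ∑ j ∈ Finset.univ.erase k, e + e = N * e := by
    rw [Finset.sum_erase_add _ _ (Finset.mem_univ k)]
    simp
  have h3 := hD k k
  rw [if_pos rfl] at h3
  have h4 := (abs_le.1 h3).1
  have h5 := le_abs_self (D k k)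
  rw [Real.norm_eq_abs]
  linarith

/-- The maximum of the absolute values in a column of `X - (c / d) • 1` is estimated by the row of
the equation in which it is attained. -/
lemma abs_sub_le_of_mul_eq (hd : 0 < d)
    (hD : ∀ i j, |D i j - (if i = j then d else 0)| ≤ e) (he : N * e ≤ d / 2)
    (hB : ∀ i j, |B i j - (if i = j then c else 0)| ≤ e') (hX : D * X = B) (i j : Fin N) :
    |X i j - (if i = j then c / d else 0)| ≤ 2 / d * (e' + |c| / d * e) := by
  set y : Fin N → ℝ := fun l => X l j - (if l = j then c / d else 0)
  have : Nonempty (Fin N) := ⟨j⟩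
  obtain ⟨k, hk⟩ := Finite.exists_max fun l => |y l|
  have h1 : ∑ l, D k l * X l j = B k j := by rw [← hX, Matrix.mul_apply]
  have h2 : ∑ l, D k l * y l = B k j - c / d * D k j := by
    simp only [y, mul_sub, Finset.sum_sub_distrib, h1, mul_ite, mul_zero, Finset.sum_ite_eq',
      Finset.mem_univ, if_true]
    ring
  have h3 : ∑ l, (D k l - (if k = l then d else 0)) * y l + d * y k = B k j - c / d * D k j := by
    rw [← h2]
    simp [sub_mul, Finset.sum_sub_distrib]
  have h4 : |∑ l, (D k l - (if k = l then d else 0)) * y l| ≤ d / 2 * |y k| := by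
    calc _ ≤ ∑ l, |(D k l - (if k = l then d else 0)) * y l| := Finset.abs_sum_le_sum_abs _ _
      _ ≤ ∑ _l : Fin N, e * |y k| := Finset.sum_le_sum fun l _ => by
          rw [abs_mul]
          exact mul_le_mul (hD k l) (hk l) (abs_nonneg _) ((abs_nonneg _).trans (hD k l))
      _ = N * e * |y k| := by simp [mul_assoc]
      _ ≤ _ := by gcongr
  have h5 : |B k j - c / d * D k j| ≤ e' + |c| / d * e := by
    have e1 : B k j - c / d * D k j = (B k j - (if k = j then c else 0))
        - c / d * (D k j - (if k = j then d else 0)) := by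
      split_ifs
      · field_simp; ring
      · ring
    rw [e1]
    refine (abs_sub _ _).trans (add_le_add (hB k j) ?_)
    rw [abs_mul, abs_div, abs_of_pos hd]
    exact mul_le_mul_of_nonneg_left (hD k j) (by positivity)
  have h6 : d * |y k| ≤ (e' + |c| / d * e) + d / 2 * |y k| := by
    have : d * y k = (B k j - c / d * D k j)
        - ∑ l, (D k l - (if k = l then d else 0)) * y l := by linarith
    rw [← abs_of_pos hd, ← abs_mul, this, abs_of_pos hd]
    exact (abs_sub _ _).trans (add_le_add h5 h4)
  refine (hk i).trans ?_
  rw [div_mul_eq_mul_div, le_div_iff₀ hd]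
  linarith

end Matrices

/-! ### The friction matrix -/

lemma weightConst_one (F : ℝ → ℝ) : weightConst F (fun _ => 1) = dInfty F := by
  simp [weightConst, dInfty]

lemma dInfty_pos {F : ℝ → ℝ} (hF : Continuous F) (hw : IsDoubleWell F) : 0 < dInfty F := by
  refine intervalIntegral.intervalIntegral_pos_of_pos_on
    (Continuous.intervalIntegrable (by fun_prop) _ _) (fun s hs => ?_) (by norm_num)
  have := hw.pos s (by linarith [hs.2]) (by linarith [hs.1])
  positivity

lemma decayRate_pos {F : ℝ → ℝ} (hw : IsDoubleWell F) : 0 < decayRate F :=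
  lt_min (Real.sqrt_pos.2 hw.deriv2_one) (Real.sqrt_pos.2 hw.deriv2_neg_one)

/-- The matrix of scalar products is, up to the factor `ε⁻¹`, an exponentially small perturbation
of a multiple of the identity. -/
lemma abs_prodMatrix_sub_le {F χ g : ℝ → ℝ} {ε C c t : ℝ} {N : ℕ} {h : Fin N → ℝ} (hε : 0 < ε)
    (hC : 0 ≤ C) (ht : 0 ≤ t) (hβ : ∀ k ≤ N, betaAt F ε h k ≤ t)
    (h1 : ∀ j : Fin N, |scalarProd F χ g ε h j j - ε⁻¹ * c|
        ≤ C * ε⁻¹ * max (betaAt F ε h j) (betaAt F ε h (j + 1)))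
    (h2 : ∀ j j' : Fin N, (j' : ℕ) = j + 1 →
        |scalarProd F χ g ε h j j'| + |scalarProd F χ g ε h j' j| ≤ C * ε⁻¹ * betaAt F ε h (j + 1))
    (h3 : ∀ i j : Fin N, i ≠ j → (i : ℕ) ≠ j + 1 → (j : ℕ) ≠ i + 1 →
        scalarProd F χ g ε h j i = 0) (i j : Fin N) :
    |(ε • prodMatrix F χ g ε h) i j - (if i = j then c else 0)| ≤ C * t := by
  have key : ∀ z b, b ≤ t → |z| ≤ C * ε⁻¹ * b → |ε * z| ≤ C * t := fun z b hb hz => by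
    rw [abs_mul, abs_of_pos hε]
    calc _ ≤ ε * (C * ε⁻¹ * t) := by gcongr; exact hz.trans (by gcongr)
      _ = C * t := by field_simp
  simp only [Matrix.smul_apply, prodMatrix, Matrix.of_apply, smul_eq_mul]
  by_cases hij : i = j
  · subst hij
    rw [if_pos rfl, show ε * scalarProd F χ g ε h i i - c
      = ε * (scalarProd F χ g ε h i i - ε⁻¹ * c) by field_simp]
    exact key _ _ (max_le (hβ i i.2.le) (hβ (i + 1) i.2)) (h1 i)
  rw [if_neg hij, sub_zero]
  by_cases e1 : (i : ℕ) = j + 1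
  · exact key _ _ (hβ (j + 1) j.2) ((le_add_of_nonneg_right (abs_nonneg _)).trans (h2 j i e1))
  by_cases e2 : (j : ℕ) = i + 1
  · exact key _ _ (hβ (i + 1) i.2) ((le_add_of_nonneg_left (abs_nonneg _)).trans (h2 i j e2))
  · rw [h3 i j hij e1 e2, mul_zero, abs_zero]
    positivity

theorem proposition4p2 (F g χ : ℝ → ℝ) (hF : ContDiff ℝ 3 F) (hFw : IsDoubleWell F)
    (hg : ContDiff ℝ 1 g) (hχ : IsCutoff χ) (N : ℕ) (hN : 0 < N) :
    ∃ ρ₀ > 0, ∃ C₁ > 0, ∃ C₂ > 0, ∀ ε > 0, ∀ ρ > 0, ρ < ρ₀ → ∀ h ∈ layerSet N ε ρ,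
      -- the objects involved are well defined
      (∀ k : Fin (N + 1), ∃! φ : ℝ → ℝ, IsMaxProfile F (gap h k / ε) ((-1) ^ ((k : ℕ) + 1)) φ) ∧
      (∀ x ∈ Set.Icc (0 : ℝ) 1, DifferentiableAt ℝ (fun y => baseFun F χ ε h y) x ∧
        ∀ j : Fin N, DifferentiableAt ℝ
          (fun s : ℝ => baseFun F χ ε (Function.update h j s) x) (h j)) ∧
      (∀ i j : Fin N, IntervalIntegrable (productFun F χ g ε h j i) MeasureTheory.volume 0 1) ∧
      -- diagonal products
      (∀ j : Fin N,
        |scalarProd F χ g ε h j j - ε⁻¹ * weightConst F g|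
            ≤ C₁ * ε⁻¹ * max (betaAt F ε h j) (betaAt F ε h (j + 1)) ∧
        C₁ * ε⁻¹ * max (betaAt F ε h j) (betaAt F ε h (j + 1))
            ≤ C₂ * ε⁻¹ * Real.exp (-(decayRate F * minGap h / (2 * ε)))) ∧
      -- products of nearest neighbours
      (∀ j j' : Fin N, (j' : ℕ) = j + 1 →
        |scalarProd F χ g ε h j j'| + |scalarProd F χ g ε h j' j|
            ≤ C₁ * ε⁻¹ * betaAt F ε h (j + 1) ∧
        C₁ * ε⁻¹ * betaAt F ε h (j + 1)
            ≤ C₂ * ε⁻¹ * Real.exp (-(decayRate F * minGap h / (2 * ε)))) ∧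
      -- the other products
      (∀ i j : Fin N, 1 < |(j : ℤ) - (i : ℤ)| → scalarProd F χ g ε h j i = 0) ∧
      -- the friction coefficient in the reduced equation
      IsUnit (gramMatrix F χ ε h).det ∧
      ∀ i j : Fin N,
        |frictionMatrix F χ g ε h i j - (if i = j then weightConst F g / dInfty F else 0)|
          ≤ C₂ * Real.exp (-(decayRate F * minGap h / (2 * ε))) := by
  obtain ⟨K, L₀, p, q, B⟩ := exists_profileEstimates hF hFw
  obtain ⟨C, hC, H⟩ := exists_scalarProd_estimates hF B hχ hg
  obtain ⟨C', hC', H'⟩ := exists_scalarProd_estimates (g := fun _ => 1) hF B hχ contDiff_const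
  have hd := dInfty_pos hF.continuous hFw
  have hA := decayRate_pos hFw
  have hK : 0 < K := zero_lt_one.trans_le B.1
  have hL₀ : 0 < L₀ := lt_of_lt_of_le (by norm_num) B.2.1
  have hN' : (0 : ℝ) < N := Nat.cast_pos.2 hN
  simp only [weightConst_one] at H'
  set A := decayRate F
  set d := dInfty F
  set c := weightConst F g
  set R := 2 / d * (C * K + |c| / d * (C' * K))
  have hR : 0 ≤ R := by positivity
  -- For `ρ < 1 / L₀` the profiles exist; the second bound makes `D(h)` diagonally dominant.
  refine ⟨min (1 / L₀) (A * d / (4 * N * C' * K)), by positivity, C, hC, C * K + R, by positivity,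
    fun ε hε ρ hρ hρ₀ h hh => ?_⟩
  obtain ⟨-, -, hgap⟩ := hh
  have hg' : ∀ k ≤ N, L₀ * ε < gap h k := fun k hk => by
    refine lt_trans ?_ (hgap ⟨k, Nat.lt_succ_of_le hk⟩)
    have := hρ₀.trans_le (min_le_left _ _)
    rw [lt_div_iff₀ hL₀] at this
    rw [lt_div_iff₀ hρ]
    nlinarith
  obtain ⟨a1, a2, a3, a4⟩ := H ε hε N h hg'
  obtain ⟨-, b2, b3, b4⟩ := H' ε hε N h hg'
  have hβ : ∀ k ≤ N, betaAt F ε h k ≤ K * Real.exp (-(A * minGap h / (2 * ε))) :=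
    fun k hk => betaAt_le B hε hg' hk
  have hη₀ : Real.exp (-(A * minGap h / (2 * ε))) ≤ 2 * ρ / A := by
    have h1 : ε / ρ ≤ minGap h := le_ciInf fun k => (hgap k).le
    have h2 : A / (2 * ρ) ≤ A * minGap h / (2 * ε) := by
      rw [div_le_iff₀ hρ] at h1
      rw [div_le_div_iff₀ (by positivity) (by positivity)]
      nlinarith
    rw [Real.exp_neg, show 2 * ρ / A = (A / (2 * ρ))⁻¹ by field_simp]
    refine inv_anti₀ (by positivity) (h2.trans ?_)
    linarith [Real.add_one_le_exp (A * minGap h / (2 * ε))]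
  set η := Real.exp (-(A * minGap h / (2 * ε)))
  have hη : 0 < η := Real.exp_pos _
  have hε' : 0 < ε⁻¹ := inv_pos.2 hε
  have hfin : ∀ b, b ≤ K * η → C * ε⁻¹ * b ≤ (C * K + R) * ε⁻¹ * η := fun b hb =>
    calc _ ≤ C * ε⁻¹ * (K * η) := by gcongr
      _ = C * K * (ε⁻¹ * η) := by ring
      _ ≤ (C * K + R) * (ε⁻¹ * η) := by gcongr; linarith
      _ = _ := by ring
  have hdom : N * (C' * (K * η)) ≤ d / 2 := by
    have := hρ₀.trans_le (min_le_right _ _)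
    rw [lt_div_iff₀ (by positivity)] at this
    rw [le_div_iff₀ hA] at hη₀
    have : N * C' * K * (η * A) ≤ N * C' * K * (2 * ρ) := by gcongr
    refine le_of_mul_le_mul_right ?_ hA
    linarith
  have hD := abs_prodMatrix_sub_le hε hC'.le (by positivity : 0 ≤ K * η) hβ b2 b3 b4
  have hB := abs_prodMatrix_sub_le hε hC.le (by positivity : 0 ≤ K * η) hβ a2 a3 a4
  have hunit : IsUnit (gramMatrix F χ ε h).det := by
    have := isUnit_det_of_near_smul_one hd hD hdom
    rw [Matrix.det_smul] at this
    exact isUnit_of_mul_isUnit_right this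
  refine ⟨fun k => ?_, fun x _ => ?_, a1, fun j => ⟨a2 j, hfin _ (max_le (hβ j j.2.le)
    (hβ (j + 1) j.2))⟩, fun j j' hjj => ⟨a3 j j' hjj, hfin _ (hβ (j + 1) j.2)⟩,
    fun i j hij => a4 i j ?_ ?_ ?_, hunit, fun i j => ?_⟩
  · have E := B.2.2 _ (neg_one_pow_eq_or ℝ ((k : ℕ) + 1))
    have hk := lt_gap_div hε hg' (Nat.lt_succ_iff.1 k.2)
    exact ⟨_, E.isMax _ hk, fun ψ hψ => E.unique _ hk ψ hψ⟩
  · obtain ⟨k, h1, h2, h3, h4⟩ := exists_piece_domain hε (gap_bound B hε hg') hN x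
    exact ⟨(hasDerivAt_baseFun B hχ hε hg' h1 h2 h3 h4).differentiableAt,
      fun j => (hasDerivAt_baseFun_update B hχ hε hg' h1 h2 h3 h4 j).differentiableAt⟩
  · rintro rfl
    simp at hij
  · intro e
    rw [e] at hij
    simp at hij
  · intro e
    rw [e] at hij
    simp at hij
  · have hX : (ε • gramMatrix F χ ε h) * frictionMatrix F χ g ε h
        = ε • prodMatrix F χ g ε h := by
      rw [frictionMatrix, Matrix.smul_mul, Matrix.mul_nonsing_inv_cancel_left _ _ hunit]
    refine (abs_sub_le_of_mul_eq hd hD hdom hB hX i j).trans ?_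
    calc _ = R * η := by simp only [R]; ring
      _ ≤ (C * K + R) * η := by gcongr; linarith [mul_pos hC hK]
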